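/- **Theorem.** *Setting.* Let $d\in\mathbb N$ and, for $i=1,\dots,d$, let $X_i=(\sigma_i,\Sigma_i)$ with $-\infty\le\sigma_i<\Sigma_i\le\infty$; let $p_i,q_i,w_i\in C^\infty(X_i)$ be real-valued with $p_i\ne0$ and $w_i>0$ on $X_i$, and let $a_i\ge 0$. Put $d\mu_i=w_i\,dx_i$, $X=X_1\times\dots\times X_d$, $\mu=\mu_1\otimes\dots\otimes\mu_d$, $L^p=L^p(X,\mu)$ (real-valued functions), and $$\delta_i=p_i\partial_{x_i}+q_i,\qquad \delta_i^*f=-\tfrac1{w_i}\partial_{x_i}(p_iw_if)+q_if,\qquad L_i=\delta_i^*\delta_i+a_i,\qquad L=\sum_{i=1}^d L_i .$$ The commutator $[\delta_i,\delta_i^*]$ is multiplication by $v_i=p_i\big(2q_i'-(p_iw_i'/w_i)'-p_i''\big)$, and the potential (zero-order) term of $L$ is $r(x)=\sum_i r_i(x_i)$ with $r_i=a_i+q_i^2-p_iq_i'-p_i'q_i-p_iq_iw_i'/w_i$. Assume that for each $i$ there is an orthonormal basis $\{\varphi^i_k\}_{k\in\mathbb N}$ of $L^2(X_i,\mu_i)$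 ($\mathbb N\ni 0$) consisting of (classical) eigenfunctions, $L_i\varphi^i_k=\lambda^i_k\varphi^i_k$ on $X_i$, with $\lambda^i_k\ge 0$ strictly increasing in $k$ and $\lambda^i_k\to\infty$. For $k\in\mathbb N^d$ let $\varphi_k=\varphi^1_{k_1}\otimes\dots\otimes\varphi^d_{k_d}$ and $\lambda_k=\lambda^1_{k_1}+\dots+\lambda^d_{k_d}$; let $\mathcal D=\mathrm{lin}\{\varphi_k\}$, $\mathcal D_i=\mathrm{lin}\{\delta_i\varphi_k\}$; let $\mathbb N^d_\Lambda=\mathbb N^d$ if $\lambda_{0}>0$ and $\mathbb N^d_\Lambda=\mathbb N^d\setminus\{0\}$ if $\lambda_0=0$. On $L^2$ define, with convergence in $L^2$, $$\Pi f=\sum_{k\in\mathbb N^d_\Lambda}\langle f,\varphi_k\rangle\varphi_k,\qquad R_if=\sum_{k\in\mathbb N^d_\Lambda}\lambda_k^{-1/2}\langle f,\varphi_k\rangle\,\delta_i\varphi_k,\qquad \mathbf Rf=(R_1f,\dots,R_df).$$ *Assumptions.* * (A1) $v_i\ge0$ on $X_i$ for all $i$. * (A2) $K\ge0$ is a constant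 with $\sum_{i=1}^d q_i(x_i)^2\le K\,r(x)$ for all $x\in X$. * (T1) $\delta_i\varphi^i_k\in L^2(X_i,\mu_i)$ and $\langle\delta_i\varphi^i_k,\delta_i\varphi^i_m\rangle_{L^2(X_i,\mu_i)}=\langle\delta_i^*\delta_i\varphi^i_k,\varphi^i_m\rangle_{L^2(X_i,\mu_i)}$ for all $i,k,m$. * (T2) For all $i,k$, all $s_1,s_2>0$ and $z\in\{\sigma_i,\Sigma_i\}$, both $\big(1+|\varphi^i_k|^{s_1}+|\delta_i\varphi^i_k|^{s_2}\big)\,p_i^2w_i\,\partial_{x_i}\varphi^i_k$ and $\big(1+|\varphi^i_k|^{s_1}+|\delta_i\varphi^i_k|^{s_2}\big)\,p_i^2w_i\,\partial_{x_i}\delta_i\varphi^i_k$ tend to $0$ as $x_i\to z$ within $X_i$. * (T3) $\mathcal D$ and $\mathcal D_1,\dots,\mathcal D_d$ are contained in $L^p$ and dense in $L^p$ for every $1\le p<\infty$. *Conclusion.* Let $1<p<\infty$ and $p^*=\max\big(p,\tfrac p{p-1}\big)$. The operators $\Pi$ and $\mathbf R$ have unique extensions to bounded linear operators, from $L^p$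 to $L^p$ and from $L^p$ to $L^p(X,\mu;\mathbb R^d)$ respectively (an extension being an operator that takes the value $\Pi f$, respectively $\mathbf Rf$, at every $f\in L^2\cap L^p$ for which this value lies in $L^p$; this includes all $f\in\mathcal D$). Denoting the extensions by the same symbols, $$\|\mathbf Rf\|_p\le 24\,(1+\sqrt K)\,(p^*-1)\,\|\Pi f\|_p\qquad\text{for all } f\in L^p,$$ where $\|\mathbf g\|_p=\big(\int_X|\mathbf g|^p\,d\mu\big)^{1/p}$ with $|\cdot|$ the Euclidean norm on $\mathbb R^d$. In particular the constant does not depend on the dimension $d$. -/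

import Mathlib

open MeasureTheory Filter Topology
open scoped ENNReal

noncomputable section

/-- `p^* = max (p, p / (p - 1))`, for an exponent `1 < p < ∞`. -/
def pStar (p : ℝ≥0∞) : ℝ := max p.toReal (p.toReal / (p.toReal - 1))

/-- The linear space `V` of functions is contained in `L^p(μ)` and dense in it
(for the distance `‖f - g‖_p`). -/
def IsDenseSubspaceOfLp {α : Type*} [MeasurableSpace α] (V : Submodule ℝ (α → ℝ)) (p : ℝ≥0∞)
    (μ : Measure α) : Prop :=
  (∀ f ∈ V, MemLp f p μ) ∧
    ∀ f : α → ℝ, MemLp f p μ → ∀ ε : ℝ≥0∞, ε ≠ 0 → ∃ g ∈ V, eLpNorm (f - g) p μ ≤ ε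

/-- `g = ∑ₖ ⟨f, φₖ⟩ eₖ`, where `⟨f, φₖ⟩ = ∫ f φₖ dμ` and the series converges
(unconditionally) to `g` in `L²(μ)`. -/
def HasL2Expansion {α ι E : Type*} [MeasurableSpace α] [NormedAddCommGroup E] [NormedSpace ℝ E]
    (μ : Measure α) (φ : ι → α → ℝ) (e : ι → α → E) (f : α → ℝ) (g : α → E) : Prop :=
  MemLp g 2 μ ∧
    Tendsto (fun s : Finset ι =>
      eLpNorm (fun x => g x - ∑ k ∈ s, (∫ y, f y * φ k y ∂μ) • e k x) 2 μ) atTop (𝓝 0)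

/-- `T`, a bounded operator on `L^p(μ)`, extends the `L²`-operator whose graph is `S`: one has
`T f = g` whenever `f ∈ L² ∩ L^p` is mapped by the `L²`-operator to a `g` that lies in `L^p`. -/
def ExtendsL2Operator {α E : Type*} [MeasurableSpace α] [NormedAddCommGroup E] [NormedSpace ℝ E]
    {μ : Measure α} {p : ℝ≥0∞} [Fact (1 ≤ p)] (S : (α → ℝ) → (α → E) → Prop)
    (T : Lp ℝ p μ →L[ℝ] Lp E p μ) : Prop :=
  ∀ (f : Lp ℝ p μ) (g : Lp E p μ), MemLp f 2 μ → S f g → T f = g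

/-- The open interval `(σ, Σ)` of the real line, where `-∞ ≤ σ < Σ ≤ ∞`. -/
def openInterval (lo hi : EReal) : Set ℝ := {x : ℝ | lo < (x : EReal) ∧ (x : EReal) < hi}

/-- The intervals `Xᵢ = (loᵢ, hiᵢ)`, the smooth coefficients `pᵢ`, `qᵢ` of
`δᵢ = pᵢ ∂ + qᵢ`, the smooth positive densities `wᵢ` and the constants `aᵢ ≥ 0`.
The values of `pᵢ`, `qᵢ`, `wᵢ` off `Xᵢ` play no role. -/
structure ProductSetting (d : ℕ) where
  lo : Fin d → EReal
  hi : Fin d → EReal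
  p : Fin d → ℝ → ℝ
  q : Fin d → ℝ → ℝ
  w : Fin d → ℝ → ℝ
  a : Fin d → ℝ
  lo_lt_hi : ∀ i, lo i < hi i
  p_smooth : ∀ i, ContDiffOn ℝ (⊤ : ℕ∞) (p i) (openInterval (lo i) (hi i))
  q_smooth : ∀ i, ContDiffOn ℝ (⊤ : ℕ∞) (q i) (openInterval (lo i) (hi i))
  w_smooth : ∀ i, ContDiffOn ℝ (⊤ : ℕ∞) (w i) (openInterval (lo i) (hi i))
  p_ne_zero : ∀ i, ∀ x ∈ openInterval (lo i) (hi i), p i x ≠ 0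
  w_pos : ∀ i, ∀ x ∈ openInterval (lo i) (hi i), 0 < w i x
  a_nonneg : ∀ i, 0 ≤ a i

namespace ProductSetting

variable {d : ℕ} (S : ProductSetting d)

/-- The interval `Xᵢ`. -/
def X (i : Fin d) : Set ℝ := openInterval (S.lo i) (S.hi i)

/-- `dμᵢ = wᵢ dx` on `Xᵢ`, as a measure on `ℝ` carried by `Xᵢ`. -/
def mu1 (i : Fin d) : Measure ℝ :=
  (volume.restrict (S.X i)).withDensity (fun x => ENNReal.ofReal (S.w i x))

/-- `μ = μ₁ ⊗ ⋯ ⊗ μ_d`, as a measure on `ℝ^d` carried by `X = X₁ × ⋯ × X_d`. -/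
def mu : Measure (Fin d → ℝ) := Measure.pi S.mu1

/-- `δᵢ = pᵢ ∂ + qᵢ` on functions of one variable. -/
def delta1 (i : Fin d) (f : ℝ → ℝ) (x : ℝ) : ℝ := S.p i x * deriv f x + S.q i x * f x

/-- The formal adjoint `δᵢ^* f = -(1 / wᵢ) ∂(pᵢ wᵢ f) + qᵢ f`. -/
def delta1Star (i : Fin d) (f : ℝ → ℝ) (x : ℝ) : ℝ :=
  -(1 / S.w i x) * deriv (fun y => S.p i y * S.w i y * f y) x + S.q i x * f x

/-- `Lᵢ = δᵢ^* δᵢ + aᵢ` on functions of one variable. -/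
def L1 (i : Fin d) (f : ℝ → ℝ) (x : ℝ) : ℝ := S.delta1Star i (S.delta1 i f) x + S.a i * f x

/-- `δᵢ` acting in the `i`-th variable of a function on `X`. -/
def delta (i : Fin d) (f : (Fin d → ℝ) → ℝ) (x : Fin d → ℝ) : ℝ :=
  S.delta1 i (fun t => f (Function.update x i t)) (x i)

/-- The commutator `vᵢ = [δᵢ, δᵢ^*] = pᵢ (2 qᵢ' - (pᵢ wᵢ' / wᵢ)' - pᵢ'')`. -/
def v (i : Fin d) (x : ℝ) : ℝ :=
  S.p i x * (2 * deriv (S.q i) x - deriv (fun y => S.p i y * (deriv (S.w i) y / S.w i y)) x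
    - deriv (deriv (S.p i)) x)

/-- The potential `rᵢ` of `Lᵢ`, that is `Lᵢ = (pᵢ ∂)^* (pᵢ ∂) + rᵢ`. -/
def r1 (i : Fin d) (x : ℝ) : ℝ :=
  S.a i + (S.q i x ^ 2 - S.p i x * deriv (S.q i) x - deriv (S.p i) x * S.q i x
    - S.p i x * S.q i x * (deriv (S.w i) x / S.w i x))

/-- The potential `r = ∑ᵢ rᵢ` of `L = ∑ᵢ Lᵢ`. -/
def r (x : Fin d → ℝ) : ℝ := ∑ i, S.r1 i (x i)

/-- (A1): the commutators `vᵢ` are non-negative. -/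
def A1 : Prop := ∀ i, ∀ x ∈ S.X i, 0 ≤ S.v i x

/-- (A2): `∑ᵢ qᵢ² ≤ K r` on `X`. -/
def A2 (K : ℝ) : Prop :=
  ∀ x : Fin d → ℝ, (∀ i, x i ∈ S.X i) → ∑ i, S.q i (x i) ^ 2 ≤ K * S.r x

/-- The filter of neighbourhoods, within the real line, of the left endpoint of `Xᵢ` from the
right. -/
def leftEnd (i : Fin d) : Filter ℝ := comap ((↑) : ℝ → EReal) (𝓝[>] S.lo i)

/-- The filter of neighbourhoods, within the real line, of the right endpoint of `Xᵢ` from the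
left. -/
def rightEnd (i : Fin d) : Filter ℝ := comap ((↑) : ℝ → EReal) (𝓝[<] S.hi i)

end ProductSetting

/-- For each `i`, an orthonormal basis `(φⁱₖ)ₖ` of `L²(Xᵢ, μᵢ)` of eigenfunctions of the
differential operator `Lᵢ`, with eigenvalues `0 ≤ evⁱ₀ < evⁱ₁ < ⋯ → ∞`. Eigenfunctions
are represented by classical solutions of the eigenvalue equation on `Xᵢ`. -/
structure EigenSystem {d : ℕ} (S : ProductSetting d) where
  phi1 : Fin d → ℕ → ℝ → ℝ
  ev1 : Fin d → ℕ → ℝ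
  phi1_contDiffOn : ∀ i k, ContDiffOn ℝ 2 (phi1 i k) (S.X i)
  eigen : ∀ i k, ∀ x ∈ S.X i, S.L1 i (phi1 i k) x = ev1 i k * phi1 i k x
  orthonormal : ∀ i k m, ∫ x, phi1 i k x * phi1 i m x ∂(S.mu1 i) = if k = m then 1 else 0
  complete : ∀ i, IsDenseSubspaceOfLp (Submodule.span ℝ (Set.range (phi1 i))) 2 (S.mu1 i)
  ev1_nonneg : ∀ i k, 0 ≤ ev1 i k
  ev1_strictMono : ∀ i, StrictMono (ev1 i)
  ev1_tendsto : ∀ i, Tendsto (ev1 i) atTop atTop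

namespace EigenSystem

variable {d : ℕ} {S : ProductSetting d} (B : EigenSystem S)

/-- `φₖ = φ¹_{k₁} ⊗ ⋯ ⊗ φᵈ_{k_d}`. -/
def phi (k : Fin d → ℕ) (x : Fin d → ℝ) : ℝ := ∏ i, B.phi1 i (k i) (x i)

/-- The eigenvalue `λₖ = λ¹_{k₁} + ⋯ + λᵈ_{k_d}` of `L = ∑ᵢ Lᵢ`. -/
def ev (k : Fin d → ℕ) : ℝ := ∑ i, B.ev1 i (k i)

/-- `ℕ^d_Λ`: all of `ℕ^d` if the smallest eigenvalue `Λ₀` of `L` is positive, and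
`ℕ^d ∖ {0}` if `Λ₀ = 0`. -/
def indexSet : Set (Fin d → ℕ) := {k | 0 < B.ev 0 ∨ k ≠ 0}

/-- `𝒟 = lin {φₖ}`. -/
def D : Submodule ℝ ((Fin d → ℝ) → ℝ) := Submodule.span ℝ (Set.range B.phi)

/-- `𝒟ᵢ = lin {δᵢ φₖ}`. -/
def Di (i : Fin d) : Submodule ℝ ((Fin d → ℝ) → ℝ) :=
  Submodule.span ℝ (Set.range fun k => S.delta i (B.phi k))

/-- (T1): the `δᵢ φⁱₖ` are in `L²(μᵢ)`, and
`⟨δᵢ φⁱₖ, δᵢ φⁱₘ⟩ = ⟨δᵢ^* δᵢ φⁱₖ, φⁱₘ⟩` in `L²(μᵢ)`. -/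
def T1 : Prop :=
  ∀ i, (∀ k, MemLp (S.delta1 i (B.phi1 i k)) 2 (S.mu1 i)) ∧
    ∀ k m, ∫ x, S.delta1 i (B.phi1 i k) x * S.delta1 i (B.phi1 i m) x ∂(S.mu1 i) =
      ∫ x, S.delta1Star i (S.delta1 i (B.phi1 i k)) x * B.phi1 i m x ∂(S.mu1 i)

/-- (T2): the boundary condition at both endpoints of each `Xᵢ`. -/
def T2 : Prop :=
  ∀ i k, ∀ s₁ s₂ : ℝ, 0 < s₁ → 0 < s₂ → ∀ l ∈ ({S.leftEnd i, S.rightEnd i} : Set (Filter ℝ)),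
    Tendsto (fun x => (1 + |B.phi1 i k x| ^ s₁ + |S.delta1 i (B.phi1 i k) x| ^ s₂) *
      (S.p i x ^ 2 * S.w i x * deriv (B.phi1 i k) x)) l (𝓝 0) ∧
    Tendsto (fun x => (1 + |B.phi1 i k x| ^ s₁ + |S.delta1 i (B.phi1 i k) x| ^ s₂) *
      (S.p i x ^ 2 * S.w i x * deriv (S.delta1 i (B.phi1 i k)) x)) l (𝓝 0)

/-- (T3): `𝒟` and the `𝒟ᵢ` are dense subspaces of `L^p(X, μ)` for all `1 ≤ p < ∞`. -/
def T3 : Prop :=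
  ∀ p : ℝ≥0∞, 1 ≤ p → p ≠ ∞ →
    IsDenseSubspaceOfLp B.D p S.mu ∧ ∀ i, IsDenseSubspaceOfLp (B.Di i) p S.mu

/-- The graph of `Π` on `L²`: `g = Π f = ∑_{k ∈ ℕ^d_Λ} ⟨f, φₖ⟩ φₖ`. -/
def IsProj (f g : (Fin d → ℝ) → ℝ) : Prop :=
  HasL2Expansion S.mu (fun k : B.indexSet => B.phi k) (fun k : B.indexSet => B.phi k) f g

/-- The graph of the vector of Riesz transforms on `L²`: `g = 𝐑 f = (R₁ f, …, R_d f)` with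
`Rᵢ f = ∑_{k ∈ ℕ^d_Λ} λₖ^{-1/2} ⟨f, φₖ⟩ δᵢ φₖ`. -/
def IsRiesz (f : (Fin d → ℝ) → ℝ) (g : (Fin d → ℝ) → EuclideanSpace ℝ (Fin d)) : Prop :=
  HasL2Expansion S.mu (fun k : B.indexSet => B.phi k)
    (fun (k : B.indexSet) x =>
      WithLp.toLp 2 (fun i => (Real.sqrt (B.ev k))⁻¹ * S.delta i (B.phi k) x)) f g

end EigenSystem

end

/-! By duality the bound for `𝐑` is a bilinear estimate. For finite sums `f = ∑ c_k φ_k` over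
`ℕ^d_Λ` and `g_j = ∑ e_{jk} δ_j φ_k`, the pairing `⟨𝐑f, g⟩` must be at most `24 (1 + √K) (p* - 1)
‖f‖_p ‖g‖_q`. Take the Poisson extensions `F = ∑ c_k e^{-t√λ_k} φ_k` and `G_j = ∑ e_{jk} e^{-t√λ_k}
δ_j φ_k`. Because `δ_j L = (L + v_j) δ_j`, both solve `∂_t² U = (elliptic operator) U`, with
potential `r` for `F` and `r + v_j ≥ r` for `G_j`. Orthogonality of the `δ_j φ_k` gives `⟨𝐑f, g⟩ =
-4 ∫∫ ∑_j δ_jF ∂_tG_j t dt dμ`.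

The integral is estimated by a Bellman function `b(ζ, η)`. For `p ≥ 2` it is smooth away from zero
and satisfies `0 ≤ b ≤ 12 (p - 1) (|ζ|^p / p + |η|^q / q)`. Its convexity (`le_hess`) and the lower
bounds for its gradient (`le_pair`) show that `(∂_t² + ∑ w_i⁻¹ ∂_i p_i² w_i ∂_i) b(F, G)` is at
least `τ N(F) + τ⁻¹ N(G)` for some `τ > 0`, where `N(U) = |∂_tU|² + ∑ |p_i ∂_iU|² + r |U|²`. By
Cauchy–Schwarz and (A2) this dominates `2 (1 + √K)⁻¹ |∑ δ_jF ∂_tG_j|` (`two_mul_abs_theta_le`).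
Integrated against `t dt dμ`, the time part leaves at most `∫ b(f, g)` and the divergence part
leaves nothing. For `p < 2` the two groups of variables are exchanged. Scaling `f` and `g` turns the
resulting sum of powers into the product of norms, and no constant involves `d`.

The delicate point is the divergence. (T2) controls boundary products whose factors all carry one
index `k`, whereas the flux of `b(F, G)` mixes indices. Decay of mixed products along suitable
sequences (`EndDecay.exists_seq`) follows from the Sturm–Liouville equations, from `v ≥ 0`, and from
a dichotomy: either `∫ dx/|p|` diverges at the endpoint and a sequence exists by averaging, or it
converges and Gronwall estimates compare solutions of different indices. Boxes with corners on such
sequences exhaust `X`.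

On `L^p`, `Π` is the identity up to an operator of rank one, and `𝐑` is extended by continuity from
the span of the `φ_k`. Pairing with the dense families `φ_l` and `δ_j φ_l` identifies both with the
`L²`-operators. -/

noncomputable section

/-! ### The Bellman function: derivatives, convexity and size -/

namespace Bellman

/-- The constant `12 (p - 1)`, where `P = p / 2`. -/
def D (P : ℝ) : ℝ := 12 * (2 * P - 1)

/-- Half of the exponent conjugate to `2 P`. -/
def conj (P : ℝ) : ℝ := P / (2 * P - 1)

/-- `A^P + B^Q`, where `2 P` and `2 Q` are conjugate exponents. -/
def S (P A B : ℝ) : ℝ := A ^ P + B ^ conj P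

/-- A smooth Bellman function, as a function of the squares `A`, `B` of the two variables. -/
def psi (P A B : ℝ) : ℝ :=
  A * S P A B ^ (1 - 1 / P) + (D P - 2 * conj P) / (2 * conj P) * B ^ conj P

def psiA (P A B : ℝ) : ℝ := S P A B ^ (-1 / P) * (P * A ^ P + B ^ conj P)

def psiB (P A B : ℝ) : ℝ :=
  B ^ (conj P - 1) * ((1 - conj P) * A * S P A B ^ (-1 / P) + (D P - 2 * conj P) / 2)

def psiAA (P A B : ℝ) : ℝ :=
  S P A B ^ (-1 / P - 1) * A ^ (P - 1) * ((P ^ 2 - P) * A ^ P + (P ^ 2 - 1) * B ^ conj P)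

def psiAB (P A B : ℝ) : ℝ :=
  (1 - conj P) * B ^ (2 * conj P - 1) * S P A B ^ (-1 / P - 1)

def psiBB (P A B : ℝ) : ℝ :=
  (1 - conj P) * A * ((conj P - 1) * B ^ (conj P - 2) * S P A B ^ (-1 / P)
    - (2 * conj P - 1) * B ^ (2 * conj P - 2) * S P A B ^ (-1 / P - 1))
    + (D P - 2 * conj P) / 2 * (conj P - 1) * B ^ (conj P - 2)

/-- The second derivative of `psi P (A y) (B y)`, where `A'' = 2 a`, `B'' = 2 b` up to terms that
are collected elsewhere. -/
def hess (P A B A' B' a b : ℝ) : ℝ :=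
  psiAA P A B * A' ^ 2 + 2 * psiAB P A B * A' * B' + psiBB P A B * B' ^ 2
    + 2 * psiA P A B * a + 2 * psiB P A B * b

section exponents

variable {P : ℝ} (hP : 1 ≤ P)
include hP

lemma conj_mul : conj P * (2 * P - 1) = P := by
  unfold conj; rw [div_mul_cancel₀ _ (by linarith)]

lemma half_lt_conj : 1 / 2 < conj P := by
  unfold conj; rw [lt_div_iff₀ (by linarith)]; linarith

lemma conj_le_one : conj P ≤ 1 := by
  unfold conj; rw [div_le_one (by linarith)]; linarith

/-- The duality relation for the exponents `2P` and `2Q`, in the form needed to trade powers of `S`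
for powers of `B`: for example `(B^Q)^(1 - 1/P) = B^(1 - Q)`. -/
lemma conj_div : conj P / P = 2 * conj P - 1 := by
  have := conj_mul hP
  rw [div_eq_iff (by linarith)]; linarith

lemma D_mul : D P * (2 * conj P - 1) = 12 := by
  have h1 := conj_div hP
  rw [← h1]; unfold D
  have := conj_mul hP
  rw [mul_div_assoc', div_eq_iff (by linarith)]; linear_combination 12 * this

lemma twelve_le_D : 12 ≤ D P := by unfold D; linarith

end exponents

variable {P A B : ℝ}

lemma S_pos (hA : 0 < A) (hB : 0 < B) : 0 < S P A B := by
  unfold S; positivity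

lemma S_rpow_sub (hA : 0 < A) (hB : 0 < B) (x : ℝ) : S P A B ^ x = S P A B * S P A B ^ (x - 1) := by
  rw [Real.rpow_sub_one (S_pos hA hB).ne', mul_div_cancel₀ _ (S_pos hA hB).ne']

lemma rpow_eq_mul_sub (hA : 0 < A) (x : ℝ) : A ^ x = A * A ^ (x - 1) := by
  rw [Real.rpow_sub_one hA.ne', mul_div_cancel₀ _ hA.ne']

lemma hasDerivAt_S {A B : ℝ → ℝ} {A' B' y : ℝ} (hA : HasDerivAt A A' y) (hB : HasDerivAt B B' y)
    (h0A : 0 < A y) (h0B : 0 < B y) :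
    HasDerivAt (fun y => S P (A y) (B y))
      (A' * P * A y ^ (P - 1) + B' * conj P * B y ^ (conj P - 1)) y :=
  (hA.rpow_const (Or.inl h0A.ne')).add (hB.rpow_const (Or.inl h0B.ne'))

lemma hasDerivAt_psi (hP : 1 ≤ P) {A B : ℝ → ℝ} {A' B' y : ℝ} (hA : HasDerivAt A A' y)
    (hB : HasDerivAt B B' y) (h0A : 0 < A y) (h0B : 0 < B y) :
    HasDerivAt (fun y => psi P (A y) (B y))
      (psiA P (A y) (B y) * A' + psiB P (A y) (B y) * B') y := by
  have hS := hasDerivAt_S (P := P) hA hB h0A h0B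
  have hp := S_pos (P := P) h0A h0B
  have h1 := (hA.mul (hS.rpow_const (p := 1 - 1 / P) (Or.inl hp.ne'))).add
    ((hB.rpow_const (p := conj P) (Or.inl h0B.ne')).const_mul ((D P - 2 * conj P) / (2 * conj P)))
  refine h1.congr_deriv ?_
  have e1 : (1 - 1 / P - 1) = -1 / P := by ring
  have e2 := S_rpow_sub (P := P) h0A h0B (1 - 1 / P)
  rw [e1] at e2 ⊢
  rw [e2]
  have e3 := rpow_eq_mul_sub h0A P
  have e5 := conj_div hP
  have e6 := half_lt_conj hP
  have e4 : (1 - 1 / P) * conj P = 1 - conj P := by rw [sub_mul, one_div_mul_eq_div, e5]; ring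
  have e7 : (1 - 1 / P) * P = P - 1 := by field_simp
  have e8 : (D P - 2 * conj P) / (2 * conj P) * conj P = (D P - 2 * conj P) / 2 := by
    field_simp
  unfold psiA psiB
  rw [show S P (A y) (B y) * S P (A y) (B y) ^ (-1 / P) = (A y ^ P + B y ^ conj P) *
    S P (A y) (B y) ^ (-1 / P) from rfl]
  -- Once the powers are free variables, the claim is polynomial and uses only the exponent
  -- identities `e7`, `e4` and `e8`.
  generalize S P (A y) (B y) ^ (-1 / P) = s
  rw [e3]
  generalize A y ^ (P - 1) = α at *
  generalize B y ^ (conj P - 1) = β at *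
  linear_combination (A y * s * A' * α) * e7 + (A y * s * B' * β) * e4 + (B' * β) * e8

lemma hasDerivAt_psiA (hP : 1 ≤ P) {A B : ℝ → ℝ} {A' B' y : ℝ} (hA : HasDerivAt A A' y)
    (hB : HasDerivAt B B' y) (h0A : 0 < A y) (h0B : 0 < B y) :
    HasDerivAt (fun y => psiA P (A y) (B y))
      (psiAA P (A y) (B y) * A' + psiAB P (A y) (B y) * B') y := by
  have hS := hasDerivAt_S (P := P) hA hB h0A h0B
  have hp := S_pos (P := P) h0A h0B
  have h1 := (hS.rpow_const (p := -1 / P) (Or.inl hp.ne')).mul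
    (((hA.rpow_const (p := P) (Or.inl h0A.ne')).const_mul P).add
      (hB.rpow_const (p := conj P) (Or.inl h0B.ne')))
  refine h1.congr_deriv ?_
  have e2 := S_rpow_sub (P := P) h0A h0B (-1 / P)
  rw [e2]
  have e3 := rpow_eq_mul_sub h0A P
  have e3' := rpow_eq_mul_sub h0B (conj P)
  have e5 := conj_div hP
  have e4 : (1 - 1 / P) * conj P = 1 - conj P := by rw [sub_mul, one_div_mul_eq_div, e5]; ring
  have e7 : (-1 / P) * P = - 1 := by field_simp
  have e9 : B y ^ (2 * conj P - 1) = B y * (B y ^ (conj P - 1)) ^ 2 := by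
    rw [← Real.rpow_natCast, ← Real.rpow_mul h0B.le, rpow_eq_mul_sub h0B]; congr 2; push_cast; ring
  unfold psiAA psiAB
  simp only [Pi.add_apply]
  rw [show S P (A y) (B y) * S P (A y) (B y) ^ (-1 / P - 1) = (A y ^ P + B y ^ conj P) *
    S P (A y) (B y) ^ (-1 / P - 1) from rfl, e9]
  generalize S P (A y) (B y) ^ (-1 / P - 1) = s
  rw [e3, e3']
  generalize A y ^ (P - 1) = α at *
  generalize B y ^ (conj P - 1) = β at *
  linear_combination (s * A' * α * (P * A y * α + B y * β)) * e7 +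
    (s * B' * β * B y * β) * e4 + (B' * β * conj P * s * A y * α) * e7

lemma hasDerivAt_psiB (hP : 1 ≤ P) {A B : ℝ → ℝ} {A' B' y : ℝ} (hA : HasDerivAt A A' y)
    (hB : HasDerivAt B B' y) (h0A : 0 < A y) (h0B : 0 < B y) :
    HasDerivAt (fun y => psiB P (A y) (B y))
      (psiAB P (A y) (B y) * A' + psiBB P (A y) (B y) * B') y := by
  have hS := hasDerivAt_S (P := P) hA hB h0A h0B
  have hp := S_pos (P := P) h0A h0B
  have h1 := (hB.rpow_const (p := conj P - 1) (Or.inl h0B.ne')).mul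
    (((hA.const_mul (1 - conj P)).mul (hS.rpow_const (p := -1 / P) (Or.inl hp.ne'))).add
      (hasDerivAt_const y ((D P - 2 * conj P) / 2)))
  refine h1.congr_deriv ?_
  have e2 := S_rpow_sub (P := P) h0A h0B (-1 / P)
  rw [show conj P - 1 - 1 = conj P - 2 by ring]
  have e3 := rpow_eq_mul_sub h0A P
  have e3' := rpow_eq_mul_sub h0B (conj P)
  have e5 := conj_div hP
  have e4 : (- 1 / P) * conj P = 1 - 2 * conj P := by
    rw [show -1 / P * conj P = - (conj P / P) by ring, e5]; ring
  have e7 : (-1 / P) * P = - 1 := by field_simp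
  have e9 : B y ^ (2 * conj P - 1) = B y * (B y ^ (conj P - 1)) ^ 2 := by
    rw [← Real.rpow_natCast, ← Real.rpow_mul h0B.le, rpow_eq_mul_sub h0B]; congr 2; push_cast; ring
  have e10 : B y ^ (2 * conj P - 2) = (B y ^ (conj P - 1)) ^ 2 := by
    rw [← Real.rpow_natCast, ← Real.rpow_mul h0B.le]; congr 1; push_cast; ring
  unfold psiAB psiBB
  simp only [Pi.add_apply, Pi.mul_apply, add_zero]
  rw [e9, e10, e2, show S P (A y) (B y) * S P (A y) (B y) ^ (-1 / P - 1) =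
    (A y ^ P + B y ^ conj P) * S P (A y) (B y) ^ (-1 / P - 1) from rfl]
  generalize S P (A y) (B y) ^ (-1 / P - 1) = s
  rw [e3, e3']
  generalize A y ^ (P - 1) = α at *
  generalize B y ^ (conj P - 1) = β at *
  generalize B y ^ (conj P - 2) = γ at *
  linear_combination (s * A' * α * β * (1 - conj P) * A y) * e7 +
    (s * B' * β * (1 - conj P) * A y * β) * e4

/-- `A = (A^P)^(1/P)` and `A^P` is one of the two summands of `S`. -/
lemma A_mul_le_one (hP : 1 ≤ P) (hA : 0 < A) (hB : 0 < B) : A * S P A B ^ (-1 / P) ≤ 1 := by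
  have hS := S_pos (P := P) hA hB
  have h1 : A ≤ S P A B ^ (1 / P) := by
    calc A = (A ^ P) ^ (1 / P) := by
          rw [← Real.rpow_mul hA.le, mul_one_div_cancel (by linarith), Real.rpow_one]
      _ ≤ _ := Real.rpow_le_rpow (by positivity)
          (by unfold S; linarith [Real.rpow_pos_of_pos hB (conj P)]) (by positivity)
  calc A * S P A B ^ (-1 / P) ≤ S P A B ^ (1 / P) * S P A B ^ (-1 / P) := by gcongr
    _ = 1 := by rw [← Real.rpow_add hS]; simp [neg_div]

/-- After regrouping, `psiAB² A B` is `(1 - Q)²` times `(B^Q / S)^(2 + 1/P)` times `A S^(-1/P)`. The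
last two factors are at most one, and `1/2 < Q ≤ 1` bounds the first by `1/4`. -/
lemma psiAB_sq_le (hP : 1 ≤ P) (hA : 0 < A) (hB : 0 < B) :
    4 * (psiAB P A B ^ 2 * (A * B)) ≤ 1 := by
  have hS := S_pos (P := P) hA hB
  have hQ := half_lt_conj hP
  have hQ1 := conj_le_one hP
  have h1 := A_mul_le_one hP hA hB
  have h2 : B ^ (4 * conj P - 1) ≤ S P A B ^ (2 + 1 / P) := by
    calc B ^ (4 * conj P - 1) = (B ^ conj P) ^ (2 + 1 / P) := by
          rw [← Real.rpow_mul hB.le]; congr 1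
          have := conj_div hP
          rw [mul_add, mul_one_div, this]; ring
      _ ≤ _ := Real.rpow_le_rpow (by positivity)
          (by unfold S; linarith [Real.rpow_pos_of_pos hA P]) (by positivity)
  have e1 : B ^ (4 * conj P - 1) = (B ^ (2 * conj P - 1)) ^ 2 * B := by
    rw [← Real.rpow_natCast, ← Real.rpow_mul hB.le, rpow_eq_mul_sub hB, mul_comm]
    congr 2; push_cast; ring
  have e2 : (S P A B ^ (-1 / P - 1)) ^ 2 = S P A B ^ (-1 / P) * S P A B ^ (-(2 + 1 / P)) := by
    rw [← Real.rpow_natCast, ← Real.rpow_mul hS.le, ← Real.rpow_add hS]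
    congr 1; push_cast; ring
  have e3 : S P A B ^ (2 + 1 / P) * S P A B ^ (-(2 + 1 / P)) = 1 := by
    rw [← Real.rpow_add hS]; simp
  have e4 : psiAB P A B ^ 2 * (A * B) = (1 - conj P) ^ 2 * (B ^ (4 * conj P - 1) *
      S P A B ^ (-(2 + 1 / P))) * (A * S P A B ^ (-1 / P)) := by
    unfold psiAB; rw [e1, mul_pow, mul_pow, e2]; ring
  have h3 : B ^ (4 * conj P - 1) * S P A B ^ (-(2 + 1 / P)) ≤ 1 := by
    calc _ ≤ S P A B ^ (2 + 1 / P) * S P A B ^ (-(2 + 1 / P)) := by gcongr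
      _ = 1 := e3
  rw [e4]
  have h4 : (1 - conj P) ^ 2 ≤ 1 / 4 := by nlinarith
  have h5 : (1 - conj P) ^ 2 * (B ^ (4 * conj P - 1) * S P A B ^ (-(2 + 1 / P))) ≤ 1 / 4 * 1 := by
    gcongr
  have h6 : (1 - conj P) ^ 2 * (B ^ (4 * conj P - 1) *
      S P A B ^ (-(2 + 1 / P))) * (A * S P A B ^ (-1 / P)) ≤ (1 / 4 * 1) * 1 := by
    gcongr
  linarith

/-- The quantity `τ = B^(1 - Q)`, that is `|η|^(2 - q)`, is the weight of the whole estimate: `psiA`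
is bounded below by `τ` and `psiB` by `τ⁻¹`. -/
lemma rpow_le_psiA (hP : 1 ≤ P) (hA : 0 < A) (hB : 0 < B) : B ^ (1 - conj P) ≤ psiA P A B := by
  have hS := S_pos (P := P) hA hB
  calc B ^ (1 - conj P) = (B ^ conj P) ^ (1 - 1 / P) := by
        rw [← Real.rpow_mul hB.le, mul_sub, mul_one_div, conj_div hP]; congr 1; ring
    _ ≤ S P A B ^ (1 - 1 / P) := Real.rpow_le_rpow (by positivity)
          (by unfold S; linarith [Real.rpow_pos_of_pos hA P])
          (by rw [sub_nonneg, div_le_one] <;> linarith)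
    _ = S P A B ^ (-1 / P) * S P A B := by
        rw [S_rpow_sub hA hB, mul_comm]; congr 2; ring
    _ ≤ psiA P A B := by
        unfold psiA
        gcongr
        unfold S
        nlinarith [Real.rpow_pos_of_pos hA P]

lemma rpow_neg_eq_inv (hB : 0 < B) : (B ^ (1 - conj P))⁻¹ = B ^ (conj P - 1) := by
  rw [← Real.rpow_neg hB.le]; congr 1; ring

lemma inv_rpow_le_psiB (hP : 1 ≤ P) (hA : 0 < A) (hB : 0 < B) :
    (B ^ (1 - conj P))⁻¹ ≤ psiB P A B := by
  rw [rpow_neg_eq_inv hB]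
  have hS := S_pos (P := P) hA hB
  have hQ1 := conj_le_one hP
  have hD := twelve_le_D hP
  unfold psiB
  refine le_mul_of_one_le_right (by positivity) ?_
  have : 0 ≤ (1 - conj P) * A * S P A B ^ (-1 / P) := by
    have : 0 ≤ 1 - conj P := by linarith
    positivity
  linarith

lemma psiA_pos (hP : 1 ≤ P) (hA : 0 < A) (hB : 0 < B) : 0 < psiA P A B :=
  lt_of_lt_of_le (by positivity) (rpow_le_psiA hP hA hB)

lemma psiB_pos (hP : 1 ≤ P) (hA : 0 < A) (hB : 0 < B) : 0 < psiB P A B :=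
  lt_of_lt_of_le (by positivity) (inv_rpow_le_psiB hP hA hB)

lemma psiAA_nonneg (hP : 1 ≤ P) (hA : 0 < A) (hB : 0 < B) : 0 ≤ psiAA P A B := by
  have hS := S_pos (P := P) hA hB
  have h1 : 0 ≤ P ^ 2 - P := by nlinarith
  have h2 : 0 ≤ P ^ 2 - 1 := by nlinarith
  unfold psiAA
  positivity

lemma psiBB_nonpos (hP : 1 ≤ P) (hA : 0 < A) (hB : 0 < B) : psiBB P A B ≤ 0 := by
  have hS := S_pos (P := P) hA hB
  have hQ := half_lt_conj hP
  have hQ1 : 0 ≤ 1 - conj P := by linarith [conj_le_one hP]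
  have hQ2 : 0 ≤ 2 * conj P - 1 := by linarith
  have hD : 0 ≤ D P - 2 * conj P := by linarith [twelve_le_D hP, conj_le_one hP]
  have : psiBB P A B = -((1 - conj P) * A * ((1 - conj P) * B ^ (conj P - 2) * S P A B ^ (-1 / P)
    + (2 * conj P - 1) * B ^ (2 * conj P - 2) * S P A B ^ (-1 / P - 1))
    + (D P - 2 * conj P) / 2 * (1 - conj P) * B ^ (conj P - 2)) := by unfold psiBB; ring
  rw [this, neg_nonpos]
  positivity

/-- This fixes the size of `D P`. Since `psiBB ≤ 0`, the worst direction has `B'² = 4 B b`. There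
the leading term of `psiB` is reduced by the factor `2Q - 1`, which `D P * (2Q - 1) = 12`
compensates. Of the `12`, at most `2` is lost to the remaining terms. -/
lemma psiBB_bound (hP : 1 ≤ P) (hA : 0 < A) (hB : 0 < B) :
    10 * B ^ (conj P - 1) ≤ 2 * psiB P A B + 4 * B * psiBB P A B := by
  have hS := S_pos (P := P) hA hB
  have hQ := half_lt_conj hP
  have hQ1 : 0 ≤ 1 - conj P := by linarith [conj_le_one hP]
  have hQ2 : 0 ≤ 2 * conj P - 1 := by linarith
  have hD := D_mul hP
  have h1 := A_mul_le_one hP hA hB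
  have e1 : B * B ^ (conj P - 2) = B ^ (conj P - 1) := by
    rw [rpow_eq_mul_sub hB (conj P - 1)]; congr 2; ring
  have e2 : B * B ^ (2 * conj P - 2) = B ^ (conj P - 1) * B ^ (conj P) := by
    rw [← Real.rpow_add hB, show 2 * conj P - 2 = 2 * conj P - 1 - 1 by ring,
      ← rpow_eq_mul_sub hB (2 * conj P - 1)]
    congr 1; ring
  have e3 := S_rpow_sub (P := P) hA hB (-1 / P)
  have h2 : B ^ conj P * S P A B ^ (-1 / P - 1) ≤ S P A B ^ (-1 / P) := by
    rw [e3]; gcongr; unfold S; linarith [Real.rpow_pos_of_pos hA P]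
  have h3 : A * (B ^ conj P * S P A B ^ (-1 / P - 1)) ≤ A * S P A B ^ (-1 / P) := by gcongr
  have e4 : 2 * psiB P A B + 4 * B * psiBB P A B = B ^ (conj P - 1) * ((2 * conj P - 1) *
      (D P - 2 * conj P + (1 - conj P) * (2 * (A * S P A B ^ (-1 / P)) -
        4 * (A * (B ^ conj P * S P A B ^ (-1 / P - 1)))))) := by
    unfold psiB psiBB
    linear_combination (4 * (1 - conj P) * A * (conj P - 1) * S P A B ^ (-1 / P) +
      4 * (D P - 2 * conj P) / 2 * (conj P - 1)) * e1 -
      (4 * (1 - conj P) * A * (2 * conj P - 1) * S P A B ^ (-1 / P - 1)) * e2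
  rw [e4, mul_comm 10]
  gcongr
  -- With `u' ≤ u ≤ 1` for the two products, `2u - 4u' ≥ -2u ≥ -2`.
  have h4 : -2 ≤ (2 * (A * S P A B ^ (-1 / P)) -
        4 * (A * (B ^ conj P * S P A B ^ (-1 / P - 1)))) := by linarith
  calc (10 : ℝ) ≤ (2 * conj P - 1) * (D P - 2 * conj P + (1 - conj P) * (-2)) := by
        nlinarith [conj_le_one hP]
    _ ≤ _ := by gcongr

/-- The convexity property of the Bellman function. -/
lemma le_hess (hP : 1 ≤ P) (hA : 0 < A) (hB : 0 < B) {A' B' a b : ℝ} (ha : 0 ≤ a) (hb : 0 ≤ b)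
    (hA' : A' ^ 2 ≤ 4 * A * a) (hB' : B' ^ 2 ≤ 4 * B * b) :
    B ^ (1 - conj P) * a + (B ^ (1 - conj P))⁻¹ * b ≤ hess P A B A' B' a b := by
  have h1 := rpow_le_psiA hP hA hB
  have h2 := psiBB_bound hP hA hB
  have h3 := psiBB_nonpos hP hA hB
  have h4 := psiAA_nonneg hP hA hB
  have h5 := psiAB_sq_le hP hA hB
  rw [← rpow_neg_eq_inv hB] at h2
  unfold hess
  set τ := B ^ (1 - conj P) with hτ
  have hτ0 : 0 < τ := by positivity
  -- The mixed term costs one of the two `τ a` supplied by `psiA` and four of the ten `τ⁻¹ b`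
  -- supplied by `psiBB_bound`. The `psiAA` term is nonnegative and is dropped.
  have c1 : |2 * psiAB P A B * A' * B'| ≤ τ * a + 4 * (τ⁻¹ * b) := by
    apply abs_le_of_sq_le_sq _ (by positivity)
    have k1 : A' ^ 2 * B' ^ 2 ≤ (4 * A * a) * (4 * B * b) := by gcongr
    have k2 : (2 * psiAB P A B * A' * B') ^ 2 ≤ 16 * (a * b) := by
      calc (2 * psiAB P A B * A' * B') ^ 2 = 4 * psiAB P A B ^ 2 * (A' ^ 2 * B' ^ 2) := by ring
        _ ≤ 4 * psiAB P A B ^ 2 * ((4 * A * a) * (4 * B * b)) := by gcongr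
        _ = (4 * (psiAB P A B ^ 2 * (A * B))) * (16 * (a * b)) := by ring
        _ ≤ 1 * (16 * (a * b)) := by gcongr
        _ = _ := one_mul _
    have k3 : (τ * a) * (τ⁻¹ * b) = a * b := by field_simp
    nlinarith [sq_nonneg (τ * a - 4 * (τ⁻¹ * b))]
  have c2 := (abs_le.1 c1).1
  have c3 : psiBB P A B * (4 * B * b) ≤ psiBB P A B * B' ^ 2 := mul_le_mul_of_nonpos_left hB' h3
  have c4 : 10 * τ⁻¹ * b ≤ (2 * psiB P A B + 4 * B * psiBB P A B) * b := by gcongr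
  have c5 : τ * a ≤ psiA P A B * a := by gcongr
  have c6 : 0 ≤ psiAA P A B * A' ^ 2 := by positivity
  have c7 : 0 ≤ τ⁻¹ * b := by positivity
  nlinarith

lemma psi_nonneg (hP : 1 ≤ P) (hA : 0 < A) (hB : 0 < B) : 0 ≤ psi P A B := by
  have hS := S_pos (P := P) hA hB
  have hQ := half_lt_conj hP
  have hD : 0 ≤ D P - 2 * conj P := by linarith [twelve_le_D hP, conj_le_one hP]
  unfold psi
  positivity

/-- The coefficient of `B^Q` in `psi` is `D/(2Q) - 1`. The missing `B^Q` is restored by the first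
term, through `A S^(1 - 1/P) ≤ A^P + B^Q`. -/
lemma psi_le (hP : 1 ≤ P) (hA : 0 < A) (hB : 0 < B) :
    psi P A B ≤ D P * (A ^ P / (2 * P) + B ^ conj P / (2 * conj P)) := by
  have hS := S_pos (P := P) hA hB
  have hQ := half_lt_conj hP
  have h1 := A_mul_le_one hP hA hB
  have e1 : S P A B ^ (1 - 1 / P) = S P A B * S P A B ^ (-1 / P) := by
    rw [S_rpow_sub hA hB]; congr 2; ring
  have h2 : A * S P A B ^ (1 - 1 / P) ≤ A ^ P + B ^ conj P := by
    rw [e1]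
    calc A * (S P A B * S P A B ^ (-1 / P)) = S P A B * (A * S P A B ^ (-1 / P)) := by ring
      _ ≤ S P A B * 1 := by gcongr
      _ = _ := by unfold S; ring
  have h3 : A ^ P ≤ D P * (A ^ P / (2 * P)) := by
    rw [mul_div_assoc', le_div_iff₀ (by linarith), mul_comm]
    have : 2 * P ≤ D P := by unfold D; linarith
    gcongr
  have h4 : (D P - 2 * conj P) / (2 * conj P) * B ^ conj P =
      D P * (B ^ conj P / (2 * conj P)) - B ^ conj P := by field_simp
  unfold psi
  rw [h4]
  linarith

lemma psiA_le (hP : 1 ≤ P) (hA : 0 < A) (hB : 0 < B) :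
    psiA P A B ≤ 2 * P * (A + B + 1) ^ P := by
  have hS := S_pos (P := P) hA hB
  have hQ := half_lt_conj hP
  have hQ1 := conj_le_one hP
  set M := A + B + 1 with hM
  have h1 : A ^ P ≤ M ^ P := Real.rpow_le_rpow hA.le (by linarith) (by linarith)
  have h2 : B ^ conj P ≤ M ^ P :=
    (Real.rpow_le_rpow hB.le (by linarith : B ≤ M) (by linarith)).trans
      (Real.rpow_le_rpow_of_exponent_le (by linarith) (by linarith))
  have hM1 : 1 ≤ M ^ P := Real.one_le_rpow (by linarith) (by linarith)
  have h3 : S P A B ≤ 2 * M ^ P := by unfold S; linarith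
  have h4 : psiA P A B ≤ P * S P A B ^ (1 - 1 / P) := by
    have : S P A B ^ (1 - 1 / P) = S P A B ^ (-1 / P) * S P A B := by
      rw [S_rpow_sub hA hB, mul_comm]; congr 2; ring
    rw [this]
    unfold psiA
    rw [mul_left_comm]
    gcongr
    unfold S
    nlinarith [Real.rpow_pos_of_pos hB (conj P)]
  have h5 : S P A B ^ (1 - 1 / P) ≤ 2 * M ^ P := by
    calc S P A B ^ (1 - 1 / P) ≤ (2 * M ^ P) ^ (1 - 1 / P) := Real.rpow_le_rpow hS.le h3
            (by rw [sub_nonneg, div_le_one] <;> linarith)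
      _ ≤ (2 * M ^ P) ^ (1 : ℝ) := Real.rpow_le_rpow_of_exponent_le (by linarith)
          (by have : 0 ≤ 1 / P := by positivity
              linarith)
      _ = _ := Real.rpow_one _
  calc psiA P A B ≤ P * S P A B ^ (1 - 1 / P) := h4
    _ ≤ P * (2 * M ^ P) := by gcongr
    _ = _ := by ring

lemma psiB_le (hP : 1 ≤ P) (hA : 0 < A) (hB : 0 < B) :
    psiB P A B ≤ D P * B ^ (conj P - 1) := by
  have hQ := half_lt_conj hP
  have hQ1 : 0 ≤ 1 - conj P := by linarith [conj_le_one hP]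
  have h1 := A_mul_le_one hP hA hB
  have hD := twelve_le_D hP
  unfold psiB
  rw [mul_comm]
  gcongr
  rw [mul_assoc]
  nlinarith

end Bellman

/-! ### The one-dimensional operators and their Sturm–Liouville equations -/

lemma isOpen_openInterval (lo hi : EReal) : IsOpen (openInterval lo hi) :=
  (isOpen_Ioi.preimage continuous_coe_real_ereal).inter
    (isOpen_Iio.preimage continuous_coe_real_ereal)

namespace ProductSetting

variable {d : ℕ} (S : ProductSetting d)

lemma isOpen_X (i : Fin d) : IsOpen (S.X i) := isOpen_openInterval _ _

/-- The derivative of `σᵢ` is `vᵢ / pᵢ`. -/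
def sigma (i : Fin d) (x : ℝ) : ℝ :=
  2 * S.q i x - deriv (S.p i) x - S.p i x * (deriv (S.w i) x / S.w i x)

lemma contDiffOn_deriv {f : ℝ → ℝ} {s : Set ℝ} (hf : ContDiffOn ℝ (⊤ : ℕ∞) f s) (hs : IsOpen s) :
    ContDiffOn ℝ (⊤ : ℕ∞) (deriv f) s :=
  hf.deriv_of_isOpen hs (by simp)

lemma hasDerivAt_of_contDiffOn {f : ℝ → ℝ} {s : Set ℝ} (hf : ContDiffOn ℝ (⊤ : ℕ∞) f s)
    (hs : IsOpen s) {x : ℝ} (hx : x ∈ s) : HasDerivAt f (deriv f x) x :=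
  ((hf.contDiffAt (hs.mem_nhds hx)).differentiableAt (by simp)).hasDerivAt

variable (i : Fin d)

lemma contDiffOn_p_mul_div : ContDiffOn ℝ (⊤ : ℕ∞) (fun y => S.p i y * (deriv (S.w i) y / S.w i y))
    (S.X i) :=
  (S.p_smooth i).mul ((contDiffOn_deriv (S.w_smooth i) (S.isOpen_X i)).div (S.w_smooth i)
    (fun x hx => (S.w_pos i x hx).ne'))

lemma contDiffOn_sigma : ContDiffOn ℝ (⊤ : ℕ∞) (S.sigma i) (S.X i) :=
  ((contDiffOn_const.mul (S.q_smooth i)).sub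
    (contDiffOn_deriv (S.p_smooth i) (S.isOpen_X i))).sub (S.contDiffOn_p_mul_div i)

variable {i} {x : ℝ} (hx : x ∈ S.X i)
include hx

lemma hasDerivAt_p : HasDerivAt (S.p i) (deriv (S.p i) x) x :=
  hasDerivAt_of_contDiffOn (S.p_smooth i) (S.isOpen_X i) hx

lemma hasDerivAt_q : HasDerivAt (S.q i) (deriv (S.q i) x) x :=
  hasDerivAt_of_contDiffOn (S.q_smooth i) (S.isOpen_X i) hx

lemma hasDerivAt_w : HasDerivAt (S.w i) (deriv (S.w i) x) x :=
  hasDerivAt_of_contDiffOn (S.w_smooth i) (S.isOpen_X i) hx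

/-- `δ_i + δ_i^*` is multiplication by `σ_i`. Hence `v_i = [δ_i, δ_i^*] = [δ_i, σ_i] = p_i σ_i'`. -/
lemma hasDerivAt_sigma : HasDerivAt (S.sigma i) (S.v i x / S.p i x) x := by
  have h1 := (((S.hasDerivAt_q hx).const_mul 2).sub (hasDerivAt_of_contDiffOn
    (contDiffOn_deriv (S.p_smooth i) (S.isOpen_X i)) (S.isOpen_X i) hx)).sub
    (hasDerivAt_of_contDiffOn (S.contDiffOn_p_mul_div i) (S.isOpen_X i) hx)
  refine h1.congr_deriv ?_
  rw [v, mul_div_cancel_left₀ _ (S.p_ne_zero i x hx)]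
  ring

omit hx in
lemma r1_eq : S.r1 i x = S.a i + S.q i x * (S.sigma i x - S.q i x) -
    S.p i x * deriv (S.q i) x := by
  unfold r1 sigma; ring

lemma deriv_p_mul_w : deriv (S.p i) x * S.w i x + S.p i x * deriv (S.w i) x =
    S.w i x * (2 * S.q i x - S.sigma i x) := by
  unfold sigma; field_simp [(S.w_pos i x hx).ne']; ring

omit hx in
lemma continuousOn_v : ContinuousOn (S.v i) (S.X i) := by
  have h : ContinuousOn (fun x => S.p i x * deriv (S.sigma i) x) (S.X i) :=
    (S.p_smooth i).continuousOn.mul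
      (contDiffOn_deriv (S.contDiffOn_sigma i) (S.isOpen_X i)).continuousOn
  refine h.congr fun x hx => ?_
  simp only []
  rw [(S.hasDerivAt_sigma hx).deriv, mul_div_cancel₀ _ (S.p_ne_zero i x hx)]

omit hx in
lemma continuousOn_r1 : ContinuousOn (S.r1 i) (S.X i) := by
  have h : ContinuousOn (fun x => S.a i + S.q i x * (S.sigma i x - S.q i x) -
      S.p i x * deriv (S.q i) x) (S.X i) :=
    (continuousOn_const.add ((S.q_smooth i).continuousOn.mul
      ((S.contDiffOn_sigma i).continuousOn.sub (S.q_smooth i).continuousOn))).sub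
      ((S.p_smooth i).continuousOn.mul
        (contDiffOn_deriv (S.q_smooth i) (S.isOpen_X i)).continuousOn)
  exact h.congr fun x _ => S.r1_eq

end ProductSetting

namespace EigenSystem

variable {d : ℕ} {S : ProductSetting d} (B : EigenSystem S)

/-- `φⁱₙ` or `δᵢ φⁱₙ`. -/
def Y (b : Bool) (i : Fin d) (n : ℕ) : ℝ → ℝ :=
  bif b then S.delta1 i (B.phi1 i n) else B.phi1 i n

/-- The potential in the Sturm-Liouville equation satisfied by `Y b i n`. -/
def _root_.ProductSetting.pot (S : ProductSetting d) (b : Bool) (i : Fin d) (x : ℝ) : ℝ :=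
  S.r1 i x + bif b then S.v i x else 0

variable {i : Fin d} {n : ℕ} {x : ℝ}

lemma hasDerivAt_phi1 (hx : x ∈ S.X i) :
    HasDerivAt (B.phi1 i n) (deriv (B.phi1 i n) x) x :=
  (((B.phi1_contDiffOn i n).contDiffAt ((S.isOpen_X i).mem_nhds hx)).differentiableAt
    (by simp)).hasDerivAt

lemma hasDerivAt_deriv_phi1 (hx : x ∈ S.X i) :
    HasDerivAt (deriv (B.phi1 i n)) (deriv (deriv (B.phi1 i n)) x) x := by
  have h := (B.phi1_contDiffOn i n).deriv_of_isOpen (m := 1) (S.isOpen_X i) (by norm_num)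
  exact ((h.contDiffAt ((S.isOpen_X i).mem_nhds hx)).differentiableAt (by simp)).hasDerivAt

lemma differentiableAt_delta1 (hx : x ∈ S.X i) :
    DifferentiableAt ℝ (S.delta1 i (B.phi1 i n)) x :=
  (((S.hasDerivAt_p hx).mul (B.hasDerivAt_deriv_phi1 hx)).add
    ((S.hasDerivAt_q hx).mul (B.hasDerivAt_phi1 hx))).differentiableAt

lemma hasDerivAt_Y (b : Bool) (hx : x ∈ S.X i) : HasDerivAt (B.Y b i n) (deriv (B.Y b i n) x) x := by
  cases b
  · exact B.hasDerivAt_phi1 hx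
  · exact (B.differentiableAt_delta1 hx).hasDerivAt

lemma p_mul_deriv_Y_false :
    S.p i x * deriv (B.Y false i n) x = B.Y true i n x - S.q i x * B.Y false i n x := by
  simp [Y, ProductSetting.delta1]

/-- This is `δ^*(δφ) = (λ - a) φ` with `δ^* = -p∂ + σ - q`. Together with the definition of `δφ` it
is a first-order system for the pair `(φ, δφ)`. -/
lemma p_mul_deriv_Y_true (hx : x ∈ S.X i) : S.p i x * deriv (B.Y true i n) x =
    (S.sigma i x - S.q i x) * B.Y true i n x - (B.ev1 i n - S.a i) * B.Y false i n x := by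
  have h1 := B.eigen i n x hx
  have h2 := (((S.hasDerivAt_p hx).mul (S.hasDerivAt_w hx)).mul
    (B.differentiableAt_delta1 (n := n) hx).hasDerivAt).deriv
  have hw := (S.w_pos i x hx).ne'
  simp only [ProductSetting.L1, ProductSetting.delta1Star] at h1
  rw [show (fun y => S.p i y * S.w i y * S.delta1 i (B.phi1 i n) y) =
    (S.p i * S.w i) * S.delta1 i (B.phi1 i n) from rfl, h2] at h1
  simp only [Y, cond_true, cond_false, ProductSetting.sigma]
  simp only [Pi.mul_apply] at h1
  field_simp at h1 ⊢
  linear_combination -h1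

/-- The Sturm-Liouville equation satisfied by `Y b i n`. -/
lemma hasDerivAt_mul_deriv_Y (b : Bool) (hx : x ∈ S.X i) :
    HasDerivAt (fun y => S.p i y ^ 2 * S.w i y * deriv (B.Y b i n) y)
      (S.w i x * ((S.pot b i x - B.ev1 i n) * B.Y b i n x)) x := by
  have hnhds := (S.isOpen_X i).mem_nhds hx
  have hpw := (S.hasDerivAt_p hx).mul (S.hasDerivAt_w hx)
  have hp := S.p_ne_zero i x hx
  have e0 := B.p_mul_deriv_Y_false (i := i) (n := n) (x := x)
  have e1 := B.p_mul_deriv_Y_true (n := n) hx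
  have e2 := S.deriv_p_mul_w hx
  have e3 := S.r1_eq (i := i) (x := x)
  cases b
  · have h1 := hpw.mul ((B.hasDerivAt_Y (n := n) true hx).sub
      ((S.hasDerivAt_q hx).mul (B.hasDerivAt_Y (n := n) false hx)))
    have h2 : (fun y => S.p i y ^ 2 * S.w i y * deriv (B.Y false i n) y) =
        (S.p i * S.w i) * (B.Y true i n - S.q i * B.Y false i n) := by
      ext y
      simp only [Pi.mul_apply, Pi.sub_apply]
      rw [← B.p_mul_deriv_Y_false]; ring
    rw [h2]
    refine h1.congr_deriv ?_
    simp only [Pi.mul_apply, Pi.sub_apply, ProductSetting.pot, cond_false]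
    rw [e2, e3]
    linear_combination (S.w i x) * e1 - (S.q i x * S.w i x) * e0
  -- Differentiating `σ` in the formula for `p (δφ)'` produces the extra potential `v`; this is the
  -- intertwining `δ L = (L + v) δ` for eigenfunctions.
  · have h1 := hpw.mul ((((S.hasDerivAt_sigma hx).sub (S.hasDerivAt_q hx)).mul
      (B.hasDerivAt_Y (n := n) true hx)).sub
      ((B.hasDerivAt_Y (n := n) false hx).const_mul (B.ev1 i n - S.a i)))
    have h2 : (fun y => S.p i y ^ 2 * S.w i y * deriv (B.Y true i n) y) =ᶠ[𝓝 x]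
        (S.p i * S.w i) * ((S.sigma i - S.q i) * B.Y true i n -
          fun y => (B.ev1 i n - S.a i) * B.Y false i n y) := by
      filter_upwards [hnhds] with y hy
      simp only [Pi.mul_apply, Pi.sub_apply]
      rw [← B.p_mul_deriv_Y_true hy]; ring
    refine (h1.congr_of_eventuallyEq h2).congr_deriv ?_
    simp only [Pi.mul_apply, Pi.sub_apply, ProductSetting.pot, cond_true]
    rw [e2, e3]
    have e4 : S.p i x * (S.v i x / S.p i x) = S.v i x := mul_div_cancel₀ _ hp
    linear_combination (S.w i x * (S.sigma i x - S.q i x)) * e1 - (S.w i x * (B.ev1 i n - S.a i)) * e0 +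
      (S.w i x * B.Y true i n x) * e4

lemma continuousOn_Y (b : Bool) : ContinuousOn (B.Y b i n) (S.X i) :=
  fun _ hx => (B.hasDerivAt_Y b hx).continuousAt.continuousWithinAt

/-- Read off from the equation: `p² w Y'` is differentiable and `p² w` does not vanish. -/
lemma continuousOn_deriv_Y (b : Bool) : ContinuousOn (deriv (B.Y b i n)) (S.X i) := by
  have h : ContinuousOn (fun y => (S.p i y ^ 2 * S.w i y * deriv (B.Y b i n) y) /
      (S.p i y ^ 2 * S.w i y)) (S.X i) := by
    refine ContinuousOn.div (fun _ hx =>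
      (B.hasDerivAt_mul_deriv_Y b hx).continuousAt.continuousWithinAt)
      (((S.p_smooth i).continuousOn.pow 2).mul (S.w_smooth i).continuousOn) fun x hx => ?_
    have := S.p_ne_zero i x hx
    have := S.w_pos i x hx
    positivity
  refine h.congr fun x hx => ?_
  have := S.p_ne_zero i x hx
  have := S.w_pos i x hx
  field_simp

lemma delta1Star_delta1 (hx : x ∈ S.X i) : S.delta1Star i (S.delta1 i (B.phi1 i n)) x =
    (B.ev1 i n - S.a i) * B.phi1 i n x := by
  have h1 := B.eigen i n x hx
  rw [ProductSetting.L1] at h1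
  linear_combination h1

end EigenSystem

lemma ProductSetting.continuousOn_pot {d : ℕ} (S : ProductSetting d) (b : Bool) (i : Fin d) :
    ContinuousOn (S.pot b i) (S.X i) := by
  cases b
  · exact S.continuousOn_r1.add continuousOn_const
  · exact S.continuousOn_r1.add S.continuousOn_v

/-! ### Limits and integrability at the end of an interval -/

/-- The neighbourhoods of the right end of an interval, within the real line. -/
def endFilter (hi : EReal) : Filter ℝ := comap ((↑) : ℝ → EReal) (𝓝[<] hi)

section endFilter

variable {lo hi : EReal} {c : ℝ}

lemma mem_openInterval {x : ℝ} : x ∈ openInterval lo hi ↔ lo < x ∧ x < hi := Iff.rfl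

lemma openInterval_subset (hc : c ∈ openInterval lo hi) :
    openInterval (c : EReal) hi ⊆ openInterval lo hi :=
  fun _ hx => ⟨hc.1.trans hx.1, hx.2⟩

lemma measurableSet_openInterval : MeasurableSet (openInterval lo hi) :=
  (isOpen_openInterval lo hi).measurableSet

lemma ordConnected_openInterval : (openInterval lo hi).OrdConnected :=
  ⟨fun _ hx _ hy _ hz => ⟨hx.1.trans_le (EReal.coe_le_coe_iff.2 hz.1),
    (EReal.coe_le_coe_iff.2 hz.2).trans_lt hy.2⟩⟩

lemma eventually_lt_endFilter {y : ℝ} (hy : (y : EReal) < hi) : ∀ᶠ x in endFilter hi, y < x := by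
  have : ∀ᶠ x : EReal in 𝓝[<] hi, (y : EReal) < x :=
    nhdsWithin_le_nhds (Ioi_mem_nhds hy)
  filter_upwards [this.comap ((↑) : ℝ → EReal)] with x hx using EReal.coe_lt_coe_iff.1 hx

lemma exists_seq_endFilter (hc : (c : EReal) < hi) : ∃ u : ℕ → ℝ, StrictMono u ∧
    (∀ n, u n ∈ openInterval c hi) ∧ Tendsto u atTop (endFilter hi) := by
  obtain ⟨u, hu, hmem, hlim⟩ := exists_seq_strictMono_tendsto' hc
  have hcoe : ∀ n, ((u n).toReal : EReal) = u n := fun n =>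
    EReal.coe_toReal (ne_top_of_lt (hmem n).2) (ne_bot_of_gt (hmem n).1)
  refine ⟨fun n => (u n).toReal, fun a b hab => ?_, fun n => ?_, ?_⟩
  · rw [← EReal.coe_lt_coe_iff, hcoe, hcoe]; exact hu hab
  · rw [mem_openInterval, hcoe]; exact hmem n
  · rw [endFilter, tendsto_comap_iff]
    have : ((↑) : ℝ → EReal) ∘ (fun n => (u n).toReal) = u := funext hcoe
    rw [this]
    exact tendsto_nhdsWithin_iff.2 ⟨hlim, Eventually.of_forall fun n => (hmem n).2⟩

lemma aecover_endFilter {x : ℕ → ℝ} (hlim : Tendsto x atTop (endFilter hi)) :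
    AECover (volume.restrict (openInterval c hi)) atTop (fun n => Set.Ioc c (x n)) := by
  refine ⟨?_, fun n => measurableSet_Ioc⟩
  filter_upwards [ae_restrict_mem measurableSet_openInterval] with y hy
  filter_upwards [hlim.eventually (eventually_lt_endFilter hy.2)] with n hn
  exact ⟨EReal.coe_lt_coe_iff.1 hy.1, hn.le⟩

lemma Icc_subset_openInterval (hc : c ∈ openInterval lo hi) {y : ℝ}
    (hy : y ∈ openInterval c hi) : Set.uIcc c y ⊆ openInterval lo hi :=
  ordConnected_openInterval.uIcc_subset hc (openInterval_subset hc hy)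

lemma Ioc_subset_openInterval {y : ℝ} (hy : y ∈ openInterval c hi) :
    Set.Ioc c y ⊆ openInterval c hi :=
  fun _ ht => ⟨EReal.coe_lt_coe_iff.2 ht.1, (EReal.coe_le_coe_iff.2 ht.2).trans_lt hy.2⟩

lemma integral_Ioc_eq_sub {z z' : ℝ → ℝ} (hc : c ∈ openInterval lo hi) {y : ℝ}
    (hz : ∀ x ∈ openInterval lo hi, HasDerivAt z (z' x) x) (hy : y ∈ openInterval c hi)
    (hi : IntegrableOn z' (Set.Ioc c y)) : ∫ t in Set.Ioc c y, z' t = z y - z c := by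
  have hcy : c ≤ y := (EReal.coe_lt_coe_iff.1 hy.1).le
  rw [← intervalIntegral.integral_of_le hcy]
  exact intervalIntegral.integral_eq_sub_of_hasDerivAt
    (fun t ht => hz t (Icc_subset_openInterval hc hy ht))
    ((intervalIntegrable_iff_integrableOn_Ioc_of_le hcy).2 hi)

/-- A function with integrable derivative has a limit at the end of the interval. -/
lemma tendsto_of_integrableOn_deriv {z z' : ℝ → ℝ} (hc : c ∈ openInterval lo hi)
    (hz : ∀ x ∈ openInterval lo hi, HasDerivAt z (z' x) x)
    (hint : IntegrableOn z' (openInterval c hi)) {x : ℕ → ℝ} (hx : ∀ n, x n ∈ openInterval c hi)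
    (hlim : Tendsto x atTop (endFilter hi)) : ∃ ℓ, Tendsto (fun n => z (x n)) atTop (𝓝 ℓ) := by
  have h1 := (aecover_endFilter (c := c) hlim).integral_tendsto_of_countably_generated hint
  refine ⟨(∫ t in openInterval c hi, z' t) + z c, ?_⟩
  refine (h1.add_const (z c)).congr fun n => ?_
  rw [Measure.restrict_restrict measurableSet_Ioc,
    Set.inter_eq_left.2 (Ioc_subset_openInterval (hx n)),
    integral_Ioc_eq_sub hc hz (hx n) (hint.mono_set (Ioc_subset_openInterval (hx n)))]
  ring

/-- If `z' = N + M` with `N ≥ 0` and `M` integrable, and if `z → 0` at the end of the interval,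
then `N` is integrable. -/
lemma integrableOn_of_tendsto_zero {z N M : ℝ → ℝ} (hc : c ∈ openInterval lo hi)
    (hz : ∀ x ∈ openInterval lo hi, HasDerivAt z (N x + M x) x)
    (hN : ContinuousOn N (openInterval lo hi)) (hN0 : ∀ x ∈ openInterval lo hi, 0 ≤ N x)
    (hM : IntegrableOn M (openInterval c hi)) (hlim : Tendsto z (endFilter hi) (𝓝 0)) :
    IntegrableOn N (openInterval c hi) := by
  obtain ⟨x, -, hx, hxlim⟩ := exists_seq_endFilter hc.2
  have hcov := aecover_endFilter (c := c) hxlim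
  have hNint : ∀ n, IntegrableOn N (Set.Ioc c (x n)) := fun n =>
    ((hN.mono (Icc_subset_openInterval hc (hx n))).integrableOn_compact isCompact_uIcc).mono_set
      (Set.Ioc_subset_Icc_self.trans Set.Icc_subset_uIcc)
  have hMint : ∀ n, IntegrableOn M (Set.Ioc c (x n)) := fun n =>
    hM.mono_set (Ioc_subset_openInterval (hx n))
  refine hcov.integrable_of_integral_bounded_of_nonneg_ae
    (1 - z c + ∫ t in openInterval c hi, |M t|) (fun n => ?_) ?_ ?_
  · rw [IntegrableOn, Measure.restrict_restrict measurableSet_Ioc,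
      Set.inter_eq_left.2 (Ioc_subset_openInterval (hx n))]
    exact hNint n
  · filter_upwards [ae_restrict_mem measurableSet_openInterval] with y hy
    exact hN0 y (openInterval_subset hc hy)
  -- `∫ N = z(x_n) - z(c) - ∫ M` over `(c, x_n]`, and `z(x_n)` is eventually below `1`; this is the
  -- `1` in the bound.
  · have h1 : ∀ᶠ n in atTop, z (x n) < 1 := (hlim.comp hxlim).eventually (gt_mem_nhds one_pos)
    filter_upwards [h1] with n hn
    rw [Measure.restrict_restrict measurableSet_Ioc,
      Set.inter_eq_left.2 (Ioc_subset_openInterval (hx n))]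
    have h2 := integral_Ioc_eq_sub hc hz (hx n) ((hNint n).add (hMint n))
    rw [integral_add (hNint n) (hMint n)] at h2
    have h3 : -∫ t in Set.Ioc c (x n), M t ≤ ∫ t in openInterval c hi, |M t| := by
      rw [← integral_neg]
      calc ∫ t in Set.Ioc c (x n), -M t ≤ ∫ t in Set.Ioc c (x n), |M t| :=
            integral_mono (hMint n).neg (hMint n).abs fun t => neg_le_abs _
        _ ≤ _ := setIntegral_mono_set hM.abs (Eventually.of_forall fun t => abs_nonneg _)
            (Ioc_subset_openInterval (hx n)).eventuallyLE
    linarith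

end endFilter

/-! ### Gronwall estimates for the first-order system -/

/-- A Gronwall argument for `φ' = επ g`, `g' = επ (σ g - Λ φ)` on `[c, hi)`, with `π` integrable and
`εσ` bounded below: the size of a solution does not decay to `0`. -/
lemma gronwall_lower_bound {π σ φ g T : ℝ → ℝ} {s : Set ℝ} (hs : Convex ℝ s) {ε Λ C L : ℝ}
    (hε : ε = 1 ∨ ε = -1) (hπ : ∀ x ∈ s, 0 ≤ π x) (hC : ∀ x ∈ s, -C ≤ ε * σ x)
    (hφ : ∀ x ∈ s, HasDerivAt φ (ε * π x * g x) x)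
    (hg : ∀ x ∈ s, HasDerivAt g (ε * π x * (σ x * g x - Λ * φ x)) x)
    (hT : ∀ x ∈ s, HasDerivAt T (π x) x) (hL : ∀ x ∈ s, ∀ y ∈ s, T x - T y ≤ L) (hC0 : 0 ≤ C)
    {y x : ℝ} (hy : y ∈ s) (hx : x ∈ s) (hyx : y ≤ x) :
    (φ y ^ 2 + g y ^ 2) * Real.exp (-((1 + |Λ| + 2 * C) * L)) ≤ φ x ^ 2 + g x ^ 2 := by
  -- The logarithmic derivative of `φ² + g²` is at least `-K π`: the two cross terms cost `1` and
  -- `|Λ|`, and the lower bound for `εσ` costs `2C`. As `εσ` has no upper bound, only decay can be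
  -- limited in this way, not growth.
  set K := 1 + |Λ| + 2 * C
  have hK : 0 ≤ K := by positivity
  have hε2 : |ε| = 1 := by rcases hε with rfl | rfl <;> simp
  have hd : ∀ t ∈ s, HasDerivAt (fun t => (φ t ^ 2 + g t ^ 2) * Real.exp (K * T t))
      ((2 * φ t * (ε * π t * g t) + 2 * g t * (ε * π t * (σ t * g t - Λ * φ t))) *
        Real.exp (K * T t) + (φ t ^ 2 + g t ^ 2) * (Real.exp (K * T t) * (K * π t))) t := by
    intro t ht
    have := ((((hφ t ht).pow 2).add ((hg t ht).pow 2)).mul (((hT t ht).const_mul K).exp))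
    refine this.congr_deriv ?_
    simp
  have hmono : MonotoneOn (fun t => (φ t ^ 2 + g t ^ 2) * Real.exp (K * T t)) s := by
    refine monotoneOn_of_deriv_nonneg hs (fun t ht => (hd t ht).continuousAt.continuousWithinAt)
      (fun t ht => (hd t (interior_subset ht)).differentiableAt.differentiableWithinAt)
      fun t ht => ?_
    have ht := interior_subset ht
    rw [(hd t ht).deriv]
    have h1 : 0 ≤ π t * ((φ t ^ 2 + g t ^ 2) * K + 2 * (ε * (φ t * g t)) +
        2 * (ε * σ t) * g t ^ 2 - 2 * (ε * Λ * (φ t * g t))) := by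
      refine mul_nonneg (hπ t ht) ?_
      have h2 : |ε * (φ t * g t)| ≤ (φ t ^ 2 + g t ^ 2) / 2 := by
        rw [abs_mul, hε2, one_mul, abs_le]; constructor <;> nlinarith [sq_nonneg (φ t + g t),
          sq_nonneg (φ t - g t)]
      have h3 : |ε * Λ * (φ t * g t)| ≤ |Λ| * ((φ t ^ 2 + g t ^ 2) / 2) := by
        rw [mul_comm ε, mul_assoc, abs_mul]; gcongr
      have h4 : -C * g t ^ 2 ≤ ε * σ t * g t ^ 2 := by gcongr; exact hC t ht
      have := abs_le.1 h2
      have := abs_le.1 h3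
      have : C * g t ^ 2 ≤ C * (φ t ^ 2 + g t ^ 2) := by gcongr; nlinarith [sq_nonneg (φ t)]
      simp only [K]
      nlinarith
    have h5 := mul_nonneg h1 (Real.exp_pos (K * T t)).le
    linarith
  have h1 := hmono hy hx hyx
  have h2 : Real.exp (K * T y) * Real.exp (-(K * T x)) ≥ Real.exp (-(K * L)) := by
    rw [← Real.exp_add]
    apply Real.exp_le_exp.2
    nlinarith [hL x hx y hy]
  calc (φ y ^ 2 + g y ^ 2) * Real.exp (-(K * L))
      ≤ (φ y ^ 2 + g y ^ 2) * (Real.exp (K * T y) * Real.exp (-(K * T x))) := by gcongr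
    _ = (φ y ^ 2 + g y ^ 2) * Real.exp (K * T y) * Real.exp (-(K * T x)) := by ring
    _ ≤ (φ x ^ 2 + g x ^ 2) * Real.exp (K * T x) * Real.exp (-(K * T x)) := by gcongr
    _ = _ := by rw [mul_assoc, ← Real.exp_add]; simp

/-- In the same situation, on an interval where `∫ π` is small, `φ` is controlled by `g`. -/
lemma gronwall_upper_bound {π σ φ g T : ℝ → ℝ} {s : Set ℝ} (hs : s.OrdConnected) {ε Λ C L : ℝ}
    (hε : ε = 1 ∨ ε = -1) (hπ : ∀ x ∈ s, 0 ≤ π x) (hC : ∀ x ∈ s, -C ≤ ε * σ x)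
    (hφ : ∀ x ∈ s, HasDerivAt φ (ε * π x * g x) x)
    (hg : ∀ x ∈ s, HasDerivAt g (ε * π x * (σ x * g x - Λ * φ x)) x)
    (hT : ∀ x ∈ s, HasDerivAt T (π x) x) (hL : ∀ x ∈ s, ∀ y ∈ s, T x - T y ≤ L) (hC0 : 0 ≤ C)
    (hL0 : 0 ≤ L) (hL1 : L ≤ 1) (hL2 : 4 * L * (C + |Λ|) ≤ 1)
    {y x : ℝ} (hy : y ∈ s) (hx : x ∈ s) (hyx : y ≤ x) :
    |φ x| ≤ 3 * |φ y| + 2 * |g x| := by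
  have hε2 : |ε| = 1 := by rcases hε with rfl | rfl <;> simp
  have hsub : Set.Icc y x ⊆ s := hs.out hy hx
  -- Let `G = |g m|` be the maximum of `|g|`. Then `φ` moves by at most `G L`. Since `εσ ≥ -C`, `g²`
  -- may rise quickly to the right but cannot fall by much between `m` and `x`, so `G` is controlled
  -- by the final value `g x`.
  obtain ⟨m, hm, hmax⟩ := isCompact_Icc.exists_isMaxOn (Set.nonempty_Icc.2 hyx)
    (f := fun t => |g t|)
    (fun t ht => (hg t (hsub ht)).continuousAt.abs.continuousWithinAt)
  set G := |g m| with hG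
  have hG0 : 0 ≤ G := abs_nonneg _
  have hgG : ∀ t ∈ Set.Icc y x, |g t| ≤ G := fun t ht => hmax ht
  -- Comparison principle: `f + K T` is monotone when `f' ≥ -K π`, and `T` varies by at most `L`.
  have key : ∀ {f f' : ℝ → ℝ} {a K : ℝ}, a ∈ Set.Icc y x → 0 ≤ K →
      (∀ t ∈ Set.Icc a x, HasDerivAt f (f' t) t) → (∀ t ∈ Set.Icc a x, -(K * π t) ≤ f' t) →
      ∀ b ∈ Set.Icc a x, f a - K * L ≤ f b := by
    intro f f' a K ha hK hf hf' b hb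
    have hsub' : Set.Icc a x ⊆ s := (Set.Icc_subset_Icc_left ha.1).trans hsub
    have hd : ∀ t ∈ Set.Icc a x, HasDerivAt (fun t => f t + K * T t) (f' t + K * π t) t :=
      fun t ht => (hf t ht).add ((hT t (hsub' ht)).const_mul K)
    have hmono : MonotoneOn (fun t => f t + K * T t) (Set.Icc a x) := by
      refine monotoneOn_of_deriv_nonneg (convex_Icc _ _)
        (fun t ht => (hd t ht).continuousAt.continuousWithinAt)
        (fun t ht => (hd t (interior_subset ht)).differentiableAt.differentiableWithinAt)
        fun t ht => ?_
      rw [(hd t (interior_subset ht)).deriv]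
      linarith [hf' t (interior_subset ht)]
    have h1 := hmono (Set.left_mem_Icc.2 (hb.1.trans hb.2)) hb hb.1
    have h2 := hL b (hsub' hb) a (hsub' (Set.left_mem_Icc.2 (hb.1.trans hb.2)))
    simp only at h1
    nlinarith
  have hφb : ∀ t ∈ Set.Icc y x, |φ t| ≤ |φ y| + G * L := by
    intro t ht
    have hbd : ∀ u ∈ Set.Icc y x, |ε * π u * g u| ≤ G * π u := by
      intro u hu
      rw [abs_mul, abs_mul, hε2, one_mul, abs_of_nonneg (hπ u (hsub hu)), mul_comm]
      exact mul_le_mul_of_nonneg_right (hgG u hu) (hπ u (hsub hu))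
    have h1 := key (Set.left_mem_Icc.2 hyx) hG0 (fun u hu => hφ u (hsub hu))
      (fun u hu => (abs_le.1 (hbd u hu)).1) t ht
    have h2 := key (f := fun u => -φ u) (Set.left_mem_Icc.2 hyx) hG0
      (fun u hu => (hφ u (hsub hu)).neg)
      (fun u hu => neg_le_neg (abs_le.1 (hbd u hu)).2) t ht
    rw [abs_le]
    constructor <;> linarith [neg_abs_le (φ y), le_abs_self (φ y)]
  set Φ := |φ y| + G * L with hΦ
  have hΦ0 : 0 ≤ Φ := by positivity
  have hg2 : ∀ t ∈ Set.Icc m x, -((2 * (C * G ^ 2 + |Λ| * (Φ * G))) * π t) ≤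
      2 * g t * (ε * π t * (σ t * g t - Λ * φ t)) := by
    intro t ht
    have ht' : t ∈ Set.Icc y x := ⟨hm.1.trans ht.1, ht.2⟩
    have h1 : -(C * G ^ 2) ≤ ε * σ t * g t ^ 2 := by
      have h3 : -C * g t ^ 2 ≤ ε * σ t * g t ^ 2 := by gcongr; exact hC t (hsub ht')
      have h4 : g t ^ 2 ≤ G ^ 2 := by rw [← sq_abs]; gcongr; exact hgG t ht'
      nlinarith
    have h2 : |ε * Λ * (φ t * g t)| ≤ |Λ| * (Φ * G) := by
      rw [abs_mul, abs_mul, abs_mul, hε2, one_mul]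
      gcongr
      · exact hφb t ht'
      · exact hgG t ht'
    have h5 := mul_nonneg (hπ t (hsub ht'))
      (by linarith [(abs_le.1 h2).2] : 0 ≤ 2 * (ε * σ t * g t ^ 2 - ε * Λ * (φ t * g t)) +
        2 * (C * G ^ 2 + |Λ| * (Φ * G)))
    linarith
  have h1 := key (f := fun t => g t ^ 2) hm (by positivity)
    (fun t ht => ((hg t (hsub ⟨hm.1.trans ht.1, ht.2⟩)).pow 2).congr_deriv (by simp))
    hg2 x (Set.right_mem_Icc.2 hm.2)
  have h2 : G ^ 2 = g m ^ 2 := sq_abs _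
  have h3 : 2 * (C * G ^ 2 + |Λ| * (Φ * G)) * L ≤ G ^ 2 / 2 + |φ y| * G := by
    have e : 2 * (C * G ^ 2 + |Λ| * (Φ * G)) * L =
      G ^ 2 * (2 * L * C + 2 * L * |Λ| * L) + |φ y| * G * (2 * L * |Λ|) := by rw [hΦ]; ring
    have b1 : 2 * L * C + 2 * L * |Λ| * L ≤ 1 / 2 := by
      have : 2 * L * |Λ| * L ≤ 2 * L * |Λ| * 1 := by gcongr
      linarith
    have b2 : 2 * L * |Λ| ≤ 1 := by nlinarith [mul_nonneg hL0 hC0, mul_nonneg hL0 (abs_nonneg Λ)]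
    rw [e]
    have b3 : G ^ 2 * (2 * L * C + 2 * L * |Λ| * L) ≤ G ^ 2 * (1 / 2) := by gcongr
    have b4 : |φ y| * G * (2 * L * |Λ|) ≤ |φ y| * G * 1 := by gcongr
    linarith
  have h4 : G ≤ 2 * |g x| + 2 * |φ y| := by
    by_contra hcon
    push Not at hcon
    have h5 : (2 * |g x|) * (2 * |g x|) < G * (G - 2 * |φ y|) := by
      apply mul_lt_mul'' _ _ (by positivity) (by positivity)
      · linarith [abs_nonneg (φ y)]
      · linarith
    nlinarith [sq_abs (g x), sq_nonneg (g x)]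
  have h5 := hφb x (Set.right_mem_Icc.2 hyx)
  have h6 : G * L ≤ G * 1 := by gcongr
  linarith

/-! ### Boundary decay of products with mixed indices -/

/-- Two families of solutions `Y false n`, `Y true n` of Sturm-Liouville equations on an interval,
which are intertwined by a first order operator `p ∂ + q` and its adjoint. -/
structure SLSystem (lo hi : EReal) where
  (p q w σ V v : ℝ → ℝ)
  (Y dY : Bool → ℕ → ℝ → ℝ)
  (ev a : ℕ → ℝ)
  C : ℝ
  p_ne_zero : ∀ x ∈ openInterval lo hi, p x ≠ 0
  w_pos : ∀ x ∈ openInterval lo hi, 0 < w x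
  v_nonneg : ∀ x ∈ openInterval lo hi, 0 ≤ v x
  V_ge : ∀ x ∈ openInterval lo hi, 0 ≤ V x + C
  continuousOn_p : ContinuousOn p (openInterval lo hi)
  continuousOn_q : ContinuousOn q (openInterval lo hi)
  continuousOn_w : ContinuousOn w (openInterval lo hi)
  continuousOn_V : ContinuousOn V (openInterval lo hi)
  continuousOn_v : ContinuousOn v (openInterval lo hi)
  continuousOn_dY : ∀ b n, ContinuousOn (dY b n) (openInterval lo hi)
  hasDerivAt_σ : ∀ x ∈ openInterval lo hi, HasDerivAt σ (v x / p x) x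
  hasDerivAt_Y : ∀ b n, ∀ x ∈ openInterval lo hi, HasDerivAt (Y b n) (dY b n x) x
  hasDerivAt_dY : ∀ b n, ∀ x ∈ openInterval lo hi,
    HasDerivAt (fun y => p y ^ 2 * w y * dY b n y)
      (w x * ((V x + (bif b then v x else 0) - ev n) * Y b n x)) x
  p_mul_dY_false : ∀ n, ∀ x ∈ openInterval lo hi,
    p x * dY false n x = Y true n x - q x * Y false n x
  p_mul_dY_true : ∀ n, ∀ x ∈ openInterval lo hi,
    p x * dY true n x = (σ x - q x) * Y true n x - a n * Y false n x
  integrableOn_pow : ∀ b n m, 1 ≤ m → IntegrableOn (fun x => w x * |Y b n x| ^ m)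
    (openInterval lo hi)

namespace SLSystem

variable {lo hi : EReal} (A : SLSystem lo hi)

/-- The coefficient `p² w` of the leading term. -/
def W (x : ℝ) : ℝ := A.p x ^ 2 * A.w x

/-- The potential. -/
def pot (b : Bool) (x : ℝ) : ℝ := A.V x + (bif b then A.v x else 0)

/-- Decay of the boundary terms that involve a single index. -/
def EndDecay : Prop := ∀ b n (m : ℕ), 1 ≤ m → Tendsto (fun x =>
  (1 + |A.Y false n x| ^ m + |A.Y true n x| ^ m) * (A.W x * A.dY b n x)) (endFilter hi) (𝓝 0)

variable {A} {c : ℝ}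

lemma W_pos {x : ℝ} (hx : x ∈ openInterval lo hi) : 0 < A.W x := by
  have := A.p_ne_zero x hx
  have := A.w_pos x hx
  unfold W; positivity

lemma pot_nonneg (b : Bool) {x : ℝ} (hx : x ∈ openInterval lo hi) : 0 ≤ A.pot b x + A.C := by
  have := A.V_ge x hx
  have := A.v_nonneg x hx
  cases b <;> simp [pot] <;> linarith

variable (A) in
lemma continuousOn_pot (b : Bool) : ContinuousOn (A.pot b) (openInterval lo hi) := by
  cases b
  · exact A.continuousOn_V.add continuousOn_const
  · exact A.continuousOn_V.add A.continuousOn_v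

variable (A) in
lemma continuousOn_W : ContinuousOn A.W (openInterval lo hi) :=
  (A.continuousOn_p.pow 2).mul A.continuousOn_w

variable (A) in
lemma continuousOn_Y (b : Bool) (n : ℕ) : ContinuousOn (A.Y b n) (openInterval lo hi) :=
  fun x hx => (A.hasDerivAt_Y b n x hx).continuousAt.continuousWithinAt

lemma hasDerivAt_W_mul_dY (b : Bool) (n : ℕ) {x : ℝ} (hx : x ∈ openInterval lo hi) :
    HasDerivAt (fun y => A.W y * A.dY b n y) (A.w x * ((A.pot b x - A.ev n) * A.Y b n x)) x :=
  A.hasDerivAt_dY b n x hx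

lemma aestronglyMeasurable (hc : c ∈ openInterval lo hi) {f : ℝ → ℝ}
    (hf : ContinuousOn f (openInterval lo hi)) :
    AEStronglyMeasurable f (volume.restrict (openInterval c hi)) :=
  (hf.mono (openInterval_subset hc)).aestronglyMeasurable measurableSet_openInterval

lemma integrableOn_of_le (hc : c ∈ openInterval lo hi) {f g : ℝ → ℝ}
    (hf : ContinuousOn f (openInterval lo hi)) (hg : IntegrableOn g (openInterval c hi))
    (h : ∀ x ∈ openInterval lo hi, |f x| ≤ g x) : IntegrableOn f (openInterval c hi) := by
  refine hg.mono' (aestronglyMeasurable hc hf) ?_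
  filter_upwards [ae_restrict_mem measurableSet_openInterval] with x hx
  exact h x (openInterval_subset hc hx)

/-- The exponent `0` and the case `b ≠ e` are covered because the bracket in `EndDecay` contains `1`
and both functions of index `n`. -/
lemma EndDecay.tendsto_pow (hA : A.EndDecay) (b e : Bool) (n m : ℕ) :
    Tendsto (fun x => |A.Y b n x| ^ m * |A.W x * A.dY e n x|) (endFilter hi) (𝓝 0) := by
  have h := (hA e n (max m 1) (le_max_right _ _)).abs
  rw [abs_zero] at h
  have h' := h.const_mul 2
  rw [mul_zero] at h'
  refine squeeze_zero (fun x => by positivity) (fun x => ?_) h'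
  have hz : ∀ t : ℝ, 0 ≤ t → t ^ m ≤ 1 + t ^ (max m 1) := by
    intro t ht
    rcases le_total t 1 with h1 | h1
    · linarith [pow_le_one₀ (n := m) ht h1, pow_nonneg ht (max m 1)]
    · linarith [pow_le_pow_right₀ h1 (le_max_left m 1)]
  rw [abs_mul (1 + _ + _), ← mul_assoc, abs_of_nonneg (by positivity : (0 : ℝ) ≤
    1 + |A.Y false n x| ^ max m 1 + |A.Y true n x| ^ max m 1)]
  gcongr
  have h0 : 0 ≤ |A.Y false n x| ^ max m 1 := by positivity
  have h1 : 0 ≤ |A.Y true n x| ^ max m 1 := by positivity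
  cases b <;> linarith [hz _ (abs_nonneg (A.Y false n x)), hz _ (abs_nonneg (A.Y true n x))]

/-- The energy integrals are finite. -/
lemma EndDecay.integrableOn_energy (hA : A.EndDecay) (hc : c ∈ openInterval lo hi) (b : Bool)
    (n j : ℕ) : IntegrableOn (fun x => A.Y b n x ^ (2 * j) * (A.W x * A.dY b n x ^ 2))
      (openInterval c hi) ∧
    IntegrableOn (fun x => A.w x * (A.pot b x + A.C) * A.Y b n x ^ (2 * j + 2))
      (openInterval c hi) := by
  have hY := A.continuousOn_Y b n
  have hdY := A.continuousOn_dY b n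
  have hW := A.continuousOn_W
  have hw := A.continuousOn_w
  have hpot := A.continuousOn_pot b
  have hN : IntegrableOn (fun x => (2 * j + 1) * (A.Y b n x ^ (2 * j) * (A.W x * A.dY b n x ^ 2)) +
      A.w x * (A.pot b x + A.C) * A.Y b n x ^ (2 * j + 2)) (openInterval c hi) := by
    -- The equation `(W Y')' = w (pot - ev) Y` makes the derivative of `Y^(2j+1) W Y'` equal to the
    -- energy density plus a multiple of the integrable function `w |Y|^(2j+2)`. Adding `C` to the
    -- potential makes the energy density nonnegative.
    refine integrableOn_of_tendsto_zero (z := fun x => A.Y b n x ^ (2 * j + 1) *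
      (A.W x * A.dY b n x)) (M := fun x => -(A.C + A.ev n) * (A.w x * |A.Y b n x| ^ (2 * j + 2)))
      hc (fun x hx => ?_) (by fun_prop) (fun x hx => ?_) ?_ ?_
    · refine (((A.hasDerivAt_Y b n x hx).pow (2 * j + 1)).mul
        (hasDerivAt_W_mul_dY b n hx)).congr_deriv ?_
      have : |A.Y b n x| ^ (2 * j + 2) = A.Y b n x ^ (2 * j + 2) := by
        rw [show 2 * j + 2 = 2 * (j + 1) by ring, pow_mul, pow_mul, sq_abs]
      rw [this]
      push_cast
      simp only [Pi.pow_apply]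
      ring
    · have := (W_pos (A := A) hx).le
      have := (A.w_pos x hx).le
      have := pot_nonneg (A := A) b hx
      have h1 : 0 ≤ A.Y b n x ^ (2 * j) := by rw [pow_mul]; positivity
      have h2 : 0 ≤ A.Y b n x ^ (2 * j + 2) := by
        rw [show 2 * j + 2 = 2 * (j + 1) by ring, pow_mul]; positivity
      positivity
    · exact ((A.integrableOn_pow b n _ (by omega)).mono_set (openInterval_subset hc)).const_mul _
    · refine (tendsto_zero_iff_abs_tendsto_zero _).2
        ((hA.tendsto_pow b b n (2 * j + 1)).congr fun x => ?_)
      simp only [Function.comp_apply]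
      rw [abs_mul (_ ^ _), abs_pow]
  have hpos : ∀ x ∈ openInterval lo hi, 0 ≤ A.Y b n x ^ (2 * j) * (A.W x * A.dY b n x ^ 2) ∧
      0 ≤ A.w x * (A.pot b x + A.C) * A.Y b n x ^ (2 * j + 2) := by
    intro x hx
    have := (W_pos (A := A) hx).le
    have := (A.w_pos x hx).le
    have := pot_nonneg (A := A) b hx
    have h1 : 0 ≤ A.Y b n x ^ (2 * j) := by rw [pow_mul]; positivity
    have h2 : 0 ≤ A.Y b n x ^ (2 * j + 2) := by
      rw [show 2 * j + 2 = 2 * (j + 1) by ring, pow_mul]; positivity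
    constructor <;> positivity
  refine ⟨integrableOn_of_le hc (by fun_prop) hN fun x hx => ?_,
    integrableOn_of_le hc (by fun_prop) hN fun x hx => ?_⟩
  · obtain ⟨h1, h2⟩ := hpos x hx
    rw [abs_of_nonneg h1]
    have : 0 ≤ (2 * (j : ℝ)) * (A.Y b n x ^ (2 * j) * (A.W x * A.dY b n x ^ 2)) := by positivity
    linarith
  · obtain ⟨h1, h2⟩ := hpos x hx
    rw [abs_of_nonneg h2]
    have : 0 ≤ (2 * (j : ℝ) + 1) * (A.Y b n x ^ (2 * j) * (A.W x * A.dY b n x ^ 2)) := by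
      positivity
    linarith

lemma pow_mul_le_pow_add_pow {s t : ℝ} (hs : 0 ≤ s) (ht : 0 ≤ t) (n : ℕ) :
    s ^ n * t ≤ s ^ (n + 1) + t ^ (n + 1) := by
  rcases le_total s t with h | h
  · calc s ^ n * t ≤ t ^ n * t := by gcongr
      _ ≤ _ := by rw [pow_succ t]; linarith [pow_nonneg hs (n + 1)]
  · calc s ^ n * t ≤ s ^ n * s := by gcongr
      _ ≤ _ := by rw [pow_succ s]; linarith [pow_nonneg ht (n + 1)]

/-- The functions `Y true k ^ s * W * dY e m` have limits at the end of the interval. -/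
lemma EndDecay.exists_tendsto (hA : A.EndDecay) (hc : c ∈ openInterval lo hi) (e : Bool)
    (k m j : ℕ) {x : ℕ → ℝ} (hx : ∀ n, x n ∈ openInterval c hi)
    (hlim : Tendsto x atTop (endFilter hi)) :
    ∃ ℓ, Tendsto (fun n => A.Y true k (x n) ^ (2 * j + 1) * (A.W (x n) * A.dY e m (x n))) atTop
      (𝓝 ℓ) := by
  have hY := A.continuousOn_Y
  have hdY := A.continuousOn_dY
  have hW := A.continuousOn_W
  have hw := A.continuousOn_w
  have hpot := A.continuousOn_pot
  have hYk := hY true k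
  have hYm := hY e m
  have hdYk := hdY true k
  have hdYm := hdY e m
  have hpe := hpot e
  have hpt := hpot true
  refine tendsto_of_integrableOn_deriv hc (z := fun x => A.Y true k x ^ (2 * j + 1) *
    (A.W x * A.dY e m x)) (z' := fun x => (2 * j + 1) * (A.Y true k x ^ (2 * j) * A.dY true k x *
      (A.W x * A.dY e m x)) + (A.Y true k x ^ (2 * j + 1) * (A.w x * ((A.pot e x + A.C) * A.Y e m x)) +
      -(A.C + A.ev m) * (A.w x * (A.Y true k x ^ (2 * j + 1) * A.Y e m x))))
    (fun x hx => ?_) ?_ hx hlim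
  · refine (((A.hasDerivAt_Y true k x hx).pow (2 * j + 1)).mul
        (hasDerivAt_W_mul_dY e m hx)).congr_deriv ?_
    push_cast
    simp only [Pi.pow_apply]
    ring
  · refine IntegrableOn.add (Integrable.const_mul ?_ _) (IntegrableOn.add ?_
      (Integrable.const_mul ?_ _))
    · refine integrableOn_of_le hc (by fun_prop) ((hA.integrableOn_energy hc true k (2 * j)).1.add
        (hA.integrableOn_energy hc e m 0).1) fun x hx => ?_
      have h0 := (W_pos (A := A) hx).le
      have e1 : A.Y true k x ^ (2 * j) * A.dY true k x * (A.W x * A.dY e m x) =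
        A.W x * ((A.Y true k x ^ (2 * j) * A.dY true k x) * A.dY e m x) := by ring
      have e2 : A.Y true k x ^ (2 * (2 * j)) = (A.Y true k x ^ (2 * j)) ^ 2 := by
        rw [← pow_mul]; congr 1; ring
      simp only [Pi.add_apply]
      rw [e1, abs_mul, abs_of_nonneg h0, e2]
      generalize A.Y true k x ^ (2 * j) = Z
      have e3 : |Z * A.dY true k x * A.dY e m x| ≤
          (Z * A.dY true k x) ^ 2 + A.dY e m x ^ 2 := by
        rw [abs_le]; constructor <;> nlinarith [sq_nonneg (Z * A.dY true k x + A.dY e m x),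
          sq_nonneg (Z * A.dY true k x - A.dY e m x), sq_nonneg (Z * A.dY true k x),
          sq_nonneg (A.dY e m x)]
      have := mul_le_mul_of_nonneg_left e3 h0
      calc _ ≤ _ := this
        _ = _ := by ring
    · refine integrableOn_of_le hc (by fun_prop) ((hA.integrableOn_energy hc true k j).2.add
        (hA.integrableOn_energy hc e m j).2) fun x hx => ?_
      have h0 := (A.w_pos x hx).le
      have h1 := pot_nonneg (A := A) e hx
      -- This is why the power is one of `Y true`: its energy carries the larger potential `V + v`
      -- and so controls terms with either potential. For a power of `Y false` times `dY true`, the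
      -- summand `v` would not be controlled.
      have h2 : A.pot e x + A.C ≤ A.pot true x + A.C := by
        have := A.v_nonneg x hx
        cases e <;> simp [pot]; linarith
      have e0 : ∀ t : ℝ, t ^ (2 * j + 2) = |t| ^ (2 * j + 2) := fun t => by
        rw [show 2 * j + 2 = 2 * (j + 1) by ring, pow_mul, pow_mul, sq_abs]
      have e1 := pow_mul_le_pow_add_pow (abs_nonneg (A.Y true k x)) (abs_nonneg (A.Y e m x))
        (2 * j + 1)
      simp only [Pi.add_apply]
      rw [e0, e0 (A.Y e m x), abs_mul, abs_mul, abs_mul, abs_pow, abs_of_nonneg h0,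
        abs_of_nonneg h1]
      calc |A.Y true k x| ^ (2 * j + 1) * (A.w x * ((A.pot e x + A.C) * |A.Y e m x|))
          = A.w x * (A.pot e x + A.C) * (|A.Y true k x| ^ (2 * j + 1) * |A.Y e m x|) := by ring
        _ ≤ A.w x * (A.pot e x + A.C) * (|A.Y true k x| ^ (2 * j + 2) +
            |A.Y e m x| ^ (2 * j + 2)) := by gcongr
        _ = A.w x * (A.pot e x + A.C) * |A.Y true k x| ^ (2 * j + 2) +
            A.w x * (A.pot e x + A.C) * |A.Y e m x| ^ (2 * j + 2) := by ring
        _ ≤ _ := by gcongr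
    · refine integrableOn_of_le hc (by fun_prop)
        (((A.integrableOn_pow true k (2 * j + 2) (by omega)).mono_set (openInterval_subset hc)).add
        ((A.integrableOn_pow e m (2 * j + 2) (by omega)).mono_set (openInterval_subset hc)))
        fun x hx => ?_
      have h0 := (A.w_pos x hx).le
      simp only [Pi.add_apply]
      rw [abs_mul, abs_mul, abs_pow, abs_of_nonneg h0, ← mul_add]
      gcongr
      exact pow_mul_le_pow_add_pow (abs_nonneg _) (abs_nonneg _) _

/-- The limits in `exists_tendsto` are `0`. -/
lemma EndDecay.tendsto_Y_true (hA : A.EndDecay) (hc : c ∈ openInterval lo hi) (e : Bool)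
    (k m N : ℕ) {x : ℕ → ℝ} (hx : ∀ n, x n ∈ openInterval c hi)
    (hlim : Tendsto x atTop (endFilter hi)) :
    Tendsto (fun n => |A.Y true k (x n)| ^ N * |A.W (x n) * A.dY e m (x n)|) atTop (𝓝 0) := by
  have h0 : Tendsto (fun n => A.W (x n) * A.dY e m (x n)) atTop (𝓝 0) := by
    refine (tendsto_zero_iff_abs_tendsto_zero _).2
      (((hA.tendsto_pow true e m 0).comp hlim).congr fun n => ?_)
    simp
  obtain ⟨ℓ, hℓ⟩ := hA.exists_tendsto hc e k m N hx hlim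
  obtain ⟨ℓ', hℓ'⟩ := hA.exists_tendsto hc e k m (N + 1) hx hlim
  have hzero : ℓ = 0 := by
    -- The quotient of the products with exponents `2N + 3` and `2N + 1` is `Y²`. If `ℓ ≠ 0`, then
    -- `Y²` converges, and the flux factor, which tends to `0`, forces `ℓ = 0`.
    by_contra hne
    have h1 : Tendsto (fun n => A.Y true k (x n) ^ 2) atTop (𝓝 (ℓ' / ℓ)) := by
      refine (hℓ'.div hℓ hne).congr' ?_
      filter_upwards [hℓ.eventually_ne hne] with n hn
      rw [Pi.div_apply, div_eq_iff hn]
      ring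
    have h2 : Tendsto (fun n => (A.Y true k (x n) ^ 2) ^ (2 * N + 1) *
        (A.W (x n) * A.dY e m (x n)) ^ 2) atTop (𝓝 ((ℓ' / ℓ) ^ (2 * N + 1) * 0 ^ 2)) :=
      (h1.pow _).mul (h0.pow 2)
    have h3 := (hℓ.pow 2).congr fun n => (show _ = (A.Y true k (x n) ^ 2) ^ (2 * N + 1) *
        (A.W (x n) * A.dY e m (x n)) ^ 2 by rw [mul_pow, ← pow_mul, ← pow_mul, mul_comm 2 (2 * N + 1)])
    have := tendsto_nhds_unique h3 h2
    simp [hne] at this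
  rw [hzero] at hℓ
  have h4 := hℓ.abs.add h0.abs
  rw [abs_zero, add_zero] at h4
  refine squeeze_zero (fun n => by positivity) (fun n => ?_) h4
  rw [abs_mul (_ ^ _), abs_pow]
  have hz : ∀ t : ℝ, 0 ≤ t → t ^ N ≤ 1 + t ^ (2 * N + 1) := by
    intro t ht
    rcases le_total t 1 with h1 | h1
    · linarith [pow_le_one₀ (n := N) ht h1, pow_nonneg ht (2 * N + 1)]
    · linarith [pow_le_pow_right₀ h1 (by omega : N ≤ 2 * N + 1)]
  nlinarith [hz _ (abs_nonneg (A.Y true k (x n))), abs_nonneg (A.W (x n) * A.dY e m (x n))]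

end SLSystem

lemma hasDerivAt_integral_of_continuousOn {lo hi : EReal} {c x : ℝ} {f : ℝ → ℝ}
    (hf : ContinuousOn f (openInterval lo hi)) (hc : c ∈ openInterval lo hi)
    (hx : x ∈ openInterval lo hi) : HasDerivAt (fun u => ∫ t in c..u, f t) (f x) x :=
  intervalIntegral.integral_hasDerivAt_right
    ((hf.mono (ordConnected_openInterval.uIcc_subset hc hx)).intervalIntegrable)
    (hf.stronglyMeasurableAtFilter (isOpen_openInterval lo hi) x hx)
    (hf.continuousAt ((isOpen_openInterval lo hi).mem_nhds hx))

namespace SLSystem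

variable {lo hi : EReal} {A : SLSystem lo hi} {c : ℝ}

/-- A continuous `p` without zeros has constant sign `ε` on the interval. Factoring it out leaves
the positive density `|p|⁻¹` required by the Gronwall lemmas. -/
lemma exists_sign (A : SLSystem lo hi) : ∃ ε : ℝ, (ε = 1 ∨ ε = -1) ∧ ∀ x ∈ openInterval lo hi,
    (A.p x)⁻¹ = ε * |A.p x|⁻¹ := by
  by_cases h : ∃ c ∈ openInterval lo hi, 0 < A.p c
  · obtain ⟨c, hc, hpc⟩ := h
    refine ⟨1, Or.inl rfl, fun x hx => ?_⟩
    have : 0 < A.p x := by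
      by_contra hneg
      obtain ⟨t, ht, hpt⟩ := (ordConnected_openInterval (lo := lo) (hi := hi)).isPreconnected.intermediate_value
        hx hc A.continuousOn_p ⟨not_lt.1 hneg, hpc.le⟩
      exact A.p_ne_zero t ht hpt
    rw [abs_of_pos this, one_mul]
  · push Not at h
    refine ⟨-1, Or.inr rfl, fun x hx => ?_⟩
    rw [abs_of_nonpos (h x hx), inv_neg]
    ring

/-- If the end of the interval is at infinite distance for the metric `|dx / p|`, then the boundary
terms tend to `0` along some sequence. -/
lemma EndDecay.exists_seq_of_not_integrable (hA : A.EndDecay) (hc : c ∈ openInterval lo hi)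
    (hp : ¬ IntegrableOn (fun x => |A.p x|⁻¹) (openInterval c hi)) (M N : ℕ) (hN : 1 ≤ N) :
    ∃ x : ℕ → ℝ, (∀ n, x n ∈ openInterval c hi) ∧ Tendsto x atTop (endFilter hi) ∧
      ∀ a b, ∀ k < M, ∀ m < M,
        Tendsto (fun n => |A.Y a k (x n)| ^ N * |A.W (x n) * A.dY b m (x n)|) atTop (𝓝 0) := by
  set Z : ℝ → ℝ := fun x => ∑ a, ∑ b, ∑ k ∈ Finset.range M, ∑ m ∈ Finset.range M,
    |A.Y a k x| ^ N * |A.W x * A.dY b m x| with hZ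
  have hpc : ContinuousOn (fun x => |A.p x|⁻¹) (openInterval lo hi) :=
    A.continuousOn_p.abs.inv₀ fun x hx => abs_ne_zero.2 (A.p_ne_zero x hx)
  -- `|Y|^N |W dY| / |p| = w |Y|^N |p dY| ≤ w |Y|^(2N) + W dY²`, a moment plus an energy density. No
  -- relation between the indices is needed.
  have hterm : ∀ a b k m, IntegrableOn (fun x => |A.Y a k x| ^ N * |A.W x * A.dY b m x| *
      |A.p x|⁻¹) (openInterval c hi) := by
    intro a b k m
    have h1 := A.continuousOn_Y a k
    have h2 := A.continuousOn_dY b m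
    have h3 := A.continuousOn_W
    refine integrableOn_of_le hc (by fun_prop) (((A.integrableOn_pow a k (2 * N)
      (by omega)).mono_set (openInterval_subset hc)).add
      (hA.integrableOn_energy hc b m 0).1) fun x hx => ?_
    have hw := (A.w_pos x hx).le
    have hp0 : |A.p x| ≠ 0 := abs_ne_zero.2 (A.p_ne_zero x hx)
    simp only [Pi.add_apply]
    rw [abs_of_nonneg (by positivity), W, abs_mul (_ * _), abs_mul (_ ^ 2), abs_pow,
      abs_of_nonneg hw, ← sq_abs (A.p x), ← sq_abs (A.dY b m x), mul_comm 2 N, pow_mul]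
    have e : |A.Y a k x| ^ N * (|A.p x| ^ 2 * A.w x * |A.dY b m x|) * |A.p x|⁻¹ =
        A.w x * (|A.Y a k x| ^ N * (|A.p x| * |A.dY b m x|)) := by field_simp
    rw [e, mul_zero, pow_zero, one_mul, show |A.p x| ^ 2 * A.w x * |A.dY b m x| ^ 2 =
      A.w x * (|A.p x| * |A.dY b m x|) ^ 2 by ring, ← mul_add]
    gcongr
    nlinarith [sq_nonneg (|A.Y a k x| ^ N - |A.p x| * |A.dY b m x|),
      sq_nonneg (|A.Y a k x| ^ N), sq_nonneg (|A.p x| * |A.dY b m x|)]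
  have hZint : IntegrableOn (fun x => Z x * |A.p x|⁻¹) (openInterval c hi) := by
    simp only [hZ, Finset.sum_mul]
    exact integrable_finsetSum _ fun a _ => integrable_finsetSum _ fun b _ =>
      integrable_finsetSum _ fun k _ => integrable_finsetSum _ fun m _ => hterm a b k m
  -- If `Z ≥ ε` held all the way to the end, then `|p|⁻¹ ≤ ε⁻¹ Z |p|⁻¹` would be integrable there.
  have key : ∀ ε > 0, ∀ y ∈ openInterval c hi, ∃ x ∈ openInterval c hi, y < x ∧ Z x < ε := by
    intro ε hε y hy
    by_contra hcon
    push Not at hcon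
    apply hp
    have hcy := EReal.coe_lt_coe_iff.1 hy.1
    have hsub : openInterval c hi ⊆ Set.Icc c y ∪ openInterval y hi := by
      intro t ht
      rcases le_or_gt t y with h | h
      · exact Or.inl ⟨(EReal.coe_lt_coe_iff.1 ht.1).le, h⟩
      · exact Or.inr ⟨EReal.coe_lt_coe_iff.2 h, ht.2⟩
    refine IntegrableOn.mono_set (IntegrableOn.union ?_ ?_) hsub
    · refine (hpc.mono ?_).integrableOn_compact isCompact_Icc
      exact ordConnected_openInterval.out hc (openInterval_subset hc hy)
    · have hg : IntegrableOn (fun x => ε⁻¹ * (Z x * |A.p x|⁻¹)) (openInterval y hi) :=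
        (hZint.mono_set (openInterval_subset hy)).const_mul ε⁻¹
      refine hg.mono' (aestronglyMeasurable (openInterval_subset hc hy) hpc) ?_
      filter_upwards [ae_restrict_mem measurableSet_openInterval] with t ht
      have h1 := hcon t (openInterval_subset hy ht) (EReal.coe_lt_coe_iff.1 ht.1)
      rw [Real.norm_of_nonneg (by positivity), ← mul_assoc]
      refine le_mul_of_one_le_left (by positivity) ?_
      rw [inv_mul_eq_div, one_le_div hε]
      exact h1
  obtain ⟨u, -, hu, hulim⟩ := exists_seq_endFilter hc.2
  choose x hxmem hux hZx using fun n : ℕ => key (1 / ((n : ℝ) + 1)) (by positivity) (u n) (hu n)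
  refine ⟨x, hxmem, ?_, fun a b k hk m hm => ?_⟩
  · rw [endFilter, tendsto_comap_iff] at hulim ⊢
    refine tendsto_nhdsWithin_iff.2 ⟨?_, Eventually.of_forall fun n => (hxmem n).2⟩
    exact tendsto_of_tendsto_of_tendsto_of_le_of_le (tendsto_nhdsWithin_iff.1 hulim).1
      tendsto_const_nhds (fun n => EReal.coe_le_coe_iff.2 (hux n).le) (fun n => (hxmem n).2.le)
  · refine squeeze_zero (fun n => by positivity) (fun n => ?_) tendsto_one_div_add_atTop_nhds_zero_nat
    refine le_trans ?_ (hZx n).le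
    simp only [hZ]
    have hnn : ∀ a b k m, 0 ≤ |A.Y a k (x n)| ^ N * |A.W (x n) * A.dY b m (x n)| :=
      fun a b k m => by positivity
    calc |A.Y a k (x n)| ^ N * |A.W (x n) * A.dY b m (x n)|
        ≤ ∑ m ∈ Finset.range M, |A.Y a k (x n)| ^ N * |A.W (x n) * A.dY b m (x n)| :=
          Finset.single_le_sum (f := fun m => |A.Y a k (x n)| ^ N * |A.W (x n) * A.dY b m (x n)|)
            (fun m _ => hnn a b k m) (Finset.mem_range.2 hm)
      _ ≤ ∑ k ∈ Finset.range M, ∑ m ∈ Finset.range M,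
            |A.Y a k (x n)| ^ N * |A.W (x n) * A.dY b m (x n)| :=
          Finset.single_le_sum (f := fun k => ∑ m ∈ Finset.range M,
            |A.Y a k (x n)| ^ N * |A.W (x n) * A.dY b m (x n)|)
            (fun k _ => Finset.sum_nonneg fun m _ => hnn a b k m) (Finset.mem_range.2 hk)
      _ ≤ ∑ b, ∑ k ∈ Finset.range M, ∑ m ∈ Finset.range M,
            |A.Y a k (x n)| ^ N * |A.W (x n) * A.dY b m (x n)| :=
          Finset.single_le_sum (f := fun b => ∑ k ∈ Finset.range M, ∑ m ∈ Finset.range M,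
            |A.Y a k (x n)| ^ N * |A.W (x n) * A.dY b m (x n)|)
            (fun b _ => Finset.sum_nonneg fun k _ => Finset.sum_nonneg fun m _ => hnn a b k m)
            (Finset.mem_univ b)
      _ ≤ _ := Finset.single_le_sum (f := fun a => ∑ b, ∑ k ∈ Finset.range M,
            ∑ m ∈ Finset.range M, |A.Y a k (x n)| ^ N * |A.W (x n) * A.dY b m (x n)|)
            (fun a _ => Finset.sum_nonneg fun b _ => Finset.sum_nonneg fun k _ =>
              Finset.sum_nonneg fun m _ => hnn a b k m) (Finset.mem_univ a)

/-- If the end of the interval is at finite distance for the metric `|dx / p|`, then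
`Y false k` is controlled near the end by `Y true k` and any nontrivial pair of solutions. -/
lemma exists_bound_of_integrable (hc : c ∈ openInterval lo hi)
    (hp : IntegrableOn (fun x => |A.p x|⁻¹) (openInterval c hi)) (k m : ℕ) :
    (∀ b, ∀ x ∈ openInterval c hi, A.dY b m x = 0) ∨ ∃ K, 0 ≤ K ∧ ∃ y ∈ openInterval c hi,
      ∀ x ∈ openInterval y hi,
        |A.Y false k x| ≤ K * (|A.Y false m x| + |A.Y true m x| + |A.Y true k x|) := by
  obtain ⟨ε, hε, hεp⟩ := A.exists_sign
  have hεε : ε * ε = 1 := by rcases hε with rfl | rfl <;> simp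
  have hpc : ContinuousOn (fun x => |A.p x|⁻¹) (openInterval lo hi) :=
    A.continuousOn_p.abs.inv₀ fun x hx => abs_ne_zero.2 (A.p_ne_zero x hx)
  have hqc : ContinuousOn (fun x => A.q x / A.p x) (openInterval lo hi) :=
    A.continuousOn_q.div A.continuousOn_p A.p_ne_zero
  set T : ℝ → ℝ := fun u => ∫ t in c..u, |A.p t|⁻¹ with hT
  set h : ℝ → ℝ := fun u => ∫ t in c..u, A.q t / A.p t with hh
  have hT' : ∀ x ∈ openInterval lo hi, HasDerivAt T (|A.p x|⁻¹) x := fun x hx =>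
    hasDerivAt_integral_of_continuousOn hpc hc hx
  have hh' : ∀ x ∈ openInterval lo hi, HasDerivAt h (A.q x / A.p x) x := fun x hx =>
    hasDerivAt_integral_of_continuousOn hqc hc hx
  -- Multiplication by `e^h`, with `h' = q/p`, removes `q` from both first-order equations and
  -- leaves the system treated by the Gronwall lemmas.
  have hexp : ∀ n, ∀ x ∈ openInterval lo hi,
      HasDerivAt (fun t => Real.exp (h t) * A.Y false n t)
        (ε * |A.p x|⁻¹ * (Real.exp (h x) * A.Y true n x)) x ∧
      HasDerivAt (fun t => Real.exp (h t) * A.Y true n t)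
        (ε * |A.p x|⁻¹ * (A.σ x * (Real.exp (h x) * A.Y true n x) -
          A.a n * (Real.exp (h x) * A.Y false n x))) x := by
    intro n x hx
    have hp0 := A.p_ne_zero x hx
    rw [← hεp x hx]
    constructor
    · refine ((hh' x hx).exp.mul (A.hasDerivAt_Y false n x hx)).congr_deriv ?_
      have e := A.p_mul_dY_false n x hx
      field_simp
      linear_combination e
    · refine ((hh' x hx).exp.mul (A.hasDerivAt_Y true n x hx)).congr_deriv ?_
      have e := A.p_mul_dY_true n x hx
      field_simp
      linear_combination e
  have hord := ordConnected_openInterval (lo := lo) (hi := hi)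
  set s : Set ℝ := Set.Ici c ∩ openInterval lo hi with hs
  have hsord : s.OrdConnected := Set.ordConnected_Ici.inter hord
  have hJs : openInterval c hi ⊆ s := fun x hx =>
    ⟨(EReal.coe_lt_coe_iff.1 hx.1).le, openInterval_subset hc hx⟩
  have hcs : c ∈ s := ⟨Set.mem_Ici.2 le_rfl, hc⟩
  -- Here `v ≥ 0` enters: `(εσ)' = v/|p|`, so `εσ` is bounded below by its value at `c`.
  have hC : ∀ x ∈ s, -|A.σ c| ≤ ε * A.σ x := by
    have hmono : MonotoneOn (fun x => ε * A.σ x) s := by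
      have hd : ∀ x ∈ s, HasDerivAt (fun x => ε * A.σ x) (ε * (A.v x / A.p x)) x := fun x hx =>
        (A.hasDerivAt_σ x hx.2).const_mul ε
      refine monotoneOn_of_deriv_nonneg hsord.convex
        (fun t ht => (hd t ht).continuousAt.continuousWithinAt)
        (fun t ht => (hd t (interior_subset ht)).differentiableAt.differentiableWithinAt)
        fun t ht => ?_
      have ht := interior_subset ht
      rw [(hd t ht).deriv, div_eq_mul_inv, hεp t ht.2, show ε * (A.v t * (ε * |A.p t|⁻¹)) =
        (ε * ε) * (A.v t * |A.p t|⁻¹) by ring, hεε, one_mul]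
      exact mul_nonneg (A.v_nonneg t ht.2) (by positivity)
    intro x hx
    have h1 := hmono hcs hx hx.1
    refine le_trans ?_ h1
    have h2 : |ε * A.σ c| = |A.σ c| := by
      rw [abs_mul]; rcases hε with rfl | rfl <;> simp
    rw [← h2]
    exact neg_abs_le _
  set L := ∫ t in openInterval c hi, |A.p t|⁻¹ with hL
  have hTmono : MonotoneOn T s := by
    refine monotoneOn_of_deriv_nonneg hsord.convex
      (fun t ht => (hT' t ht.2).continuousAt.continuousWithinAt)
      (fun t ht => (hT' t (interior_subset ht).2).differentiableAt.differentiableWithinAt)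
      fun t ht => ?_
    rw [(hT' t (interior_subset ht).2).deriv]
    positivity
  have hTc : T c = 0 := by simp [hT]
  have hT0 : ∀ x ∈ s, 0 ≤ T x := fun x hx => hTc ▸ hTmono hcs hx hx.1
  have hTL : ∀ x ∈ s, T x ≤ L := by
    intro x hx
    simp only [hT]
    rw [intervalIntegral.integral_of_le hx.1]
    refine setIntegral_mono_set hp (Eventually.of_forall fun t => by positivity)
      (LE.le.eventuallyLE fun t ht => ?_)
    exact ⟨EReal.coe_lt_coe_iff.2 ht.1, (EReal.coe_le_coe_iff.2 ht.2).trans_lt hx.2.2⟩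
  have hTlim : ∀ ℓ > 0, ∃ y ∈ openInterval c hi, L - T y < ℓ := by
    intro ℓ hℓ
    obtain ⟨u, -, hu, hulim⟩ := exists_seq_endFilter hc.2
    have h1 := (aecover_endFilter (c := c) hulim).integral_tendsto_of_countably_generated hp
    obtain ⟨n, hn⟩ := (h1.eventually (lt_mem_nhds (sub_lt_self L hℓ))).exists
    refine ⟨u n, hu n, ?_⟩
    rw [Measure.restrict_restrict measurableSet_Ioc,
      Set.inter_eq_left.2 (Ioc_subset_openInterval (hu n)),
      ← intervalIntegral.integral_of_le (EReal.coe_lt_coe_iff.1 (hu n).1).le] at hn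
    simp only [hT]
    linarith
  by_cases hm : ∀ x ∈ openInterval c hi, A.Y false m x = 0 ∧ A.Y true m x = 0
  · left
    intro b x hx
    have h0 : A.Y b m =ᶠ[𝓝 x] fun _ => 0 := by
      filter_upwards [(isOpen_openInterval _ _).mem_nhds hx] with t ht
      cases b
      exacts [(hm t ht).1, (hm t ht).2]
    exact ((A.hasDerivAt_Y b m x (openInterval_subset hc hx)).congr_of_eventuallyEq
      h0.symm).unique (hasDerivAt_const x (0 : ℝ))
  · right
    push Not at hm
    obtain ⟨y₀, hy₀, hne⟩ := hm
    set E₀ := ((Real.exp (h y₀) * A.Y false m y₀) ^ 2 + (Real.exp (h y₀) * A.Y true m y₀) ^ 2) *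
      Real.exp (-((1 + |A.a m| + 2 * |A.σ c|) * L)) with hE₀
    have hE₀pos : 0 < E₀ := by
      have h1 := Real.exp_pos (h y₀)
      by_cases h2 : A.Y false m y₀ = 0
      · have := hne h2
        positivity
      · positivity
    -- Chosen to satisfy both smallness conditions of `gronwall_upper_bound`; the tail of the
    -- convergent integral of `|p|⁻¹` is then made shorter than `ℓ`.
    set ℓ : ℝ := 1 / (1 + 4 * (|A.σ c| + |A.a k|)) with hℓ
    have hℓ0 : 0 < ℓ := by positivity
    have hℓ1 : ℓ ≤ 1 := by
      rw [hℓ, div_le_one (by positivity)]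
      have : 0 ≤ 4 * (|A.σ c| + |A.a k|) := by positivity
      linarith
    have hℓ2 : 4 * ℓ * (|A.σ c| + |A.a k|) ≤ 1 := by
      rw [hℓ, mul_one_div, div_mul_eq_mul_div, div_le_one (by positivity)]
      linarith
    obtain ⟨y₁, hy₁, hy₁L⟩ := hTlim ℓ hℓ0
    refine ⟨(3 * |Real.exp (h y₁) * A.Y false k y₁|) * (Real.sqrt E₀)⁻¹ + 2, by positivity,
      max y₀ y₁, ?_, fun x hx => ?_⟩
    · rcases max_choice y₀ y₁ with h' | h' <;> rw [h'] <;> assumption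
    have hxy₀ : y₀ ≤ x := (le_max_left _ _).trans (EReal.coe_lt_coe_iff.1 hx.1).le
    have hxy₁ : y₁ ≤ x := (le_max_right _ _).trans (EReal.coe_lt_coe_iff.1 hx.1).le
    have hxJ : x ∈ openInterval c hi :=
      ⟨hy₀.1.trans_le (EReal.coe_le_coe_iff.2 hxy₀), hx.2⟩
    have lower := gronwall_lower_bound (π := fun x => |A.p x|⁻¹) (σ := A.σ) (L := L)
      hsord.convex hε (fun x _ => by positivity) hC (fun x hx => (hexp m x hx.2).1)
      (fun x hx => (hexp m x hx.2).2) (fun x hx => hT' x hx.2)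
      (fun x hx y hy => by linarith [hTL x hx, hT0 y hy]) (abs_nonneg _) (hJs hy₀) (hJs hxJ) hxy₀
    have hs₁ : Set.Ici y₁ ∩ s ⊆ s := Set.inter_subset_right
    have upper := gronwall_upper_bound (π := fun x => |A.p x|⁻¹) (σ := A.σ) (L := ℓ)
      (s := Set.Ici y₁ ∩ s) (Set.ordConnected_Ici.inter hsord) hε (fun x _ => by positivity)
      (fun x hx => hC x hx.2) (fun x hx => (hexp k x hx.2.2).1)
      (fun x hx => (hexp k x hx.2.2).2) (fun x hx => hT' x hx.2.2)
      (fun x hx y hy => by linarith [hTL x hx.2, hTmono (hJs hy₁) hy.2 hy.1]) (abs_nonneg _)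
      hℓ0.le hℓ1 hℓ2 (⟨Set.mem_Ici.2 le_rfl, hJs hy₁⟩) ⟨hxy₁, hJs hxJ⟩ hxy₁
    have hex := Real.exp_pos (h x)
    have h1 : Real.sqrt E₀ ≤ Real.exp (h x) * (|A.Y false m x| + |A.Y true m x|) := by
      rw [Real.sqrt_le_left (by positivity)]
      refine lower.trans ?_
      have : 0 ≤ Real.exp (h x) ^ 2 * (|A.Y false m x| * |A.Y true m x|) := by positivity
      calc _ = Real.exp (h x) ^ 2 * (|A.Y false m x| ^ 2 + |A.Y true m x| ^ 2) := by
            rw [sq_abs, sq_abs]; ring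
        _ ≤ _ := by nlinarith
    -- After multiplication by `e^h`, a nontrivial pair of index `m` stays away from zero. This
    -- turns the constant in the upper bound for index `k` into a multiple of the pair of index `m`,
    -- and the factor `e^h` cancels.
    have h2 : 1 ≤ (Real.sqrt E₀)⁻¹ * (Real.exp (h x) * (|A.Y false m x| + |A.Y true m x|)) := by
      rw [inv_mul_eq_div, one_le_div (Real.sqrt_pos.2 hE₀pos)]; exact h1
    simp only [abs_mul (Real.exp (h x)), abs_of_pos hex] at upper
    set G := 3 * |Real.exp (h y₁) * A.Y false k y₁| with hG
    have hG0 : 0 ≤ G := by positivity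
    set F := |A.Y false m x| + |A.Y true m x| with hF
    have hF0 : 0 ≤ F := by positivity
    have h3 : Real.exp (h x) * |A.Y false k x| ≤ Real.exp (h x) *
        (G * (Real.sqrt E₀)⁻¹ * F + 2 * |A.Y true k x|) := by
      calc _ ≤ _ := upper
        _ ≤ G * ((Real.sqrt E₀)⁻¹ * (Real.exp (h x) * F)) +
            2 * (Real.exp (h x) * |A.Y true k x|) := by
          gcongr
          exact le_mul_of_one_le_right hG0 h2
        _ = _ := by ring
    have h4 := le_of_mul_le_mul_left h3 hex
    have h5 : 0 ≤ G * (Real.sqrt E₀)⁻¹ * |A.Y true k x| := by positivity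
    calc _ ≤ _ := h4
      _ ≤ _ := by linarith

/-- The boundary terms, with mixed indices, tend to `0` along some sequence. -/
theorem EndDecay.exists_seq (hA : A.EndDecay) (hc : c ∈ openInterval lo hi) (M N : ℕ)
    (hN : 1 ≤ N) :
    ∃ x : ℕ → ℝ, (∀ n, x n ∈ openInterval c hi) ∧ Tendsto x atTop (endFilter hi) ∧
      ∀ a b, ∀ k < M, ∀ m < M,
        Tendsto (fun n => |A.Y a k (x n)| ^ N * |A.W (x n) * A.dY b m (x n)|) atTop (𝓝 0) := by
  by_cases hp : IntegrableOn (fun x => |A.p x|⁻¹) (openInterval c hi)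
  · obtain ⟨x, -, hx, hlim⟩ := exists_seq_endFilter hc.2
    refine ⟨x, hx, hlim, fun a b k _ m _ => ?_⟩
    cases a
    · rcases exists_bound_of_integrable hc hp k m with h0 | ⟨K, hK, y, hy, hbd⟩
      · simp [h0 b _ (hx _)]
      -- `Y false k` is replaced by `Y false m` and `Y true m`, which share the index of the flux,
      -- and by `Y true k`, which `tendsto_Y_true` handles.
      · have hlim' := (((hA.tendsto_pow false b m N).comp hlim).add
          ((hA.tendsto_pow true b m N).comp hlim)).add (hA.tendsto_Y_true hc b k m N hx hlim)
        have hlim'' := hlim'.const_mul ((3 * K) ^ N)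
        simp only [add_zero, mul_zero] at hlim''
        refine squeeze_zero' (Eventually.of_forall fun n => by positivity) ?_ hlim''
        filter_upwards [hlim.eventually (eventually_lt_endFilter hy.2)] with n hn
        have h1 := hbd (x n) ⟨EReal.coe_lt_coe_iff.2 hn, (hx n).2⟩
        simp only [Function.comp_apply]
        rw [← add_mul, ← add_mul, ← mul_assoc]
        gcongr
        set s := |A.Y false m (x n)|
        set t := |A.Y true m (x n)|
        set r := |A.Y true k (x n)|
        have h2 : (s + t + r) ^ N ≤ 3 ^ N * (s ^ N + t ^ N + r ^ N) := by
          have hs : 0 ≤ s := abs_nonneg _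
          have ht : 0 ≤ t := abs_nonneg _
          have hr : 0 ≤ r := abs_nonneg _
          have hmax : (max (max s t) r) ^ N ≤ s ^ N + t ^ N + r ^ N := by
            have := pow_nonneg hs N
            have := pow_nonneg ht N
            have := pow_nonneg hr N
            rcases max_choice (max s t) r with h | h <;> rw [h]
            · rcases max_choice s t with h | h <;> rw [h] <;> linarith
            · linarith
          calc (s + t + r) ^ N ≤ (3 * max (max s t) r) ^ N := by
                gcongr
                linarith [le_max_left (max s t) r, le_max_right (max s t) r,
                  le_max_left s t, le_max_right s t]
            _ = 3 ^ N * (max (max s t) r) ^ N := mul_pow _ _ _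
            _ ≤ _ := by gcongr
        calc |A.Y false k (x n)| ^ N ≤ (K * (s + t + r)) ^ N := by gcongr
          _ = K ^ N * (s + t + r) ^ N := mul_pow _ _ _
          _ ≤ K ^ N * (3 ^ N * (s ^ N + t ^ N + r ^ N)) := by gcongr
          _ = _ := by rw [mul_pow]; ring
    · exact hA.tendsto_Y_true hc b k m N hx hlim
  · exact hA.exists_seq_of_not_integrable hc hp M N hN

end SLSystem

/-! ### The product measure, lower bounds for the potentials, moments of the factors -/

namespace ProductSetting

variable {d : ℕ} (S : ProductSetting d) (i : Fin d)

lemma aemeasurable_w : AEMeasurable (fun x => ENNReal.ofReal (S.w i x))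
    (volume.restrict (S.X i)) :=
  ((S.w_smooth i).continuousOn.aemeasurable (S.isOpen_X i).measurableSet).ennreal_ofReal

instance sigmaFinite_mu1 : SigmaFinite (S.mu1 i) :=
  SigmaFinite.withDensity_of_ne_top (ae_of_all _ fun _ => ENNReal.ofReal_ne_top)

lemma ae_mem_X : ∀ᵐ x ∂(S.mu1 i), x ∈ S.X i :=
  (withDensity_absolutelyContinuous _ _).ae_le (ae_restrict_mem (S.isOpen_X i).measurableSet)

instance sigmaFinite_mu : SigmaFinite S.mu := inferInstanceAs (SigmaFinite (Measure.pi S.mu1))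

lemma ae_mem : ∀ᵐ x ∂S.mu, ∀ i, x i ∈ S.X i :=
  eventually_all.2 fun i => Measure.tendsto_eval_ae_ae.eventually (S.ae_mem_X i)

lemma integrable_mu1_iff {f : ℝ → ℝ} :
    Integrable f (S.mu1 i) ↔ IntegrableOn (fun x => S.w i x * f x) (S.X i) := by
  rw [mu1, integrable_withDensity_iff_integrable_smul₀' (S.aemeasurable_w i)
    (ae_of_all _ fun _ => ENNReal.ofReal_lt_top)]
  refine integrable_congr ?_
  filter_upwards [ae_restrict_mem (S.isOpen_X i).measurableSet] with x hx
  rw [ENNReal.toReal_ofReal (S.w_pos i x hx).le, smul_eq_mul]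

lemma integral_mu1_restrict (f : ℝ → ℝ) {s : Set ℝ} (hs : MeasurableSet s) (hsX : s ⊆ S.X i) :
    ∫ x in s, f x ∂(S.mu1 i) = ∫ x in s, S.w i x * f x := by
  rw [mu1, restrict_withDensity hs, Measure.restrict_restrict hs, Set.inter_eq_left.2 hsX,
    integral_withDensity_eq_integral_toReal_smul₀ ((S.aemeasurable_w i).mono_measure
      (Measure.restrict_mono_set _ hsX)) (ae_of_all _ fun _ => ENNReal.ofReal_lt_top)]
  refine integral_congr_ae ?_
  filter_upwards [ae_restrict_mem hs] with x hx
  rw [ENNReal.toReal_ofReal (S.w_pos i x (hsX hx)).le, smul_eq_mul]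

lemma nonempty_X : (S.X i).Nonempty := by
  obtain ⟨x, h1, h2⟩ := EReal.lt_iff_exists_real_btwn.1 (S.lo_lt_hi i)
  exact ⟨x, h1, h2⟩

variable {S}

/-- For `K > 0` this is (A2). For `K = 0`, (A2) makes every `q_i` vanish identically, and `r = ∑
a_i` remains. -/
lemma r_nonneg {K : ℝ} (hK : 0 ≤ K) (hA2 : S.A2 K) {x : Fin d → ℝ} (hx : ∀ i, x i ∈ S.X i) :
    0 ≤ S.r x := by
  rcases hK.eq_or_lt with rfl | hK
  · refine Finset.sum_nonneg fun i _ => ?_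
    have hq : ∀ y ∈ S.X i, S.q i y = 0 := by
      intro y hy
      have h1 := hA2 (Function.update x i y) fun j => by
        by_cases h : j = i
        · subst h; simpa using hy
        · simpa [h] using hx j
      rw [zero_mul] at h1
      have h2 := (Finset.sum_eq_zero_iff_of_nonneg (fun j _ => sq_nonneg _)).1
        (le_antisymm h1 (Finset.sum_nonneg fun j _ => sq_nonneg _)) i (Finset.mem_univ i)
      simpa using h2
    have hq' : deriv (S.q i) (x i) = 0 := by
      have : S.q i =ᶠ[𝓝 (x i)] fun _ => 0 := by
        filter_upwards [(S.isOpen_X i).mem_nhds (hx i)] with y hy using hq y hy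
      rw [this.deriv_eq, deriv_const]
    simp [r1, hq _ (hx i), hq', S.a_nonneg i]
  · have h1 := (Finset.sum_nonneg fun i _ => sq_nonneg (S.q i (x i))).trans (hA2 x hx)
    exact (mul_nonneg_iff_of_pos_left hK).1 h1

/-- Only the sum `r` is known to be nonnegative. Freezing all coordinates but the `i`-th bounds
`r_i` from below by a constant. -/
lemma exists_r1_ge {K : ℝ} (hK : 0 ≤ K) (hA2 : S.A2 K) (i : Fin d) :
    ∃ C, ∀ x ∈ S.X i, 0 ≤ S.r1 i x + C := by
  choose y hy using fun j => S.nonempty_X j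
  refine ⟨∑ j ∈ Finset.univ.erase i, S.r1 j (y j), fun x hx => ?_⟩
  have h1 := r_nonneg hK hA2 (x := Function.update y i x) fun j => by
    by_cases h : j = i
    · subst h; simpa using hx
    · simpa [h] using hy j
  rw [r, ← Finset.add_sum_erase _ _ (Finset.mem_univ i)] at h1
  simp only [Function.update_self] at h1
  refine h1.trans (add_le_add_right (Finset.sum_congr rfl fun j hj => ?_).le _)
  rw [Function.update_of_ne (Finset.ne_of_mem_erase hj)]

end ProductSetting

/-- A factor of an integrable product is integrable. -/
lemma integrable_of_integrable_prod {d : ℕ} {μ : Fin d → Measure ℝ} [∀ i, SigmaFinite (μ i)]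
    {y : Fin d → ℝ → ℝ} {i : Fin d} (hne : ∀ j, j ≠ i → ∫ t, y j t ^ 2 ∂(μ j) ≠ 0) {m : ℕ}
    (hint : Integrable (fun x : Fin d → ℝ => ∏ j, |y j (x j)| ^ m) (Measure.pi μ)) :
    Integrable (fun t => |y i t| ^ m) (μ i) := by
  obtain _ | n := d
  · exact i.elim0
  have hmp := (measurePreserving_piFinSuccAbove μ i).symm
  rw [← hmp.integrable_comp_emb (MeasurableEquiv.measurableEmbedding _)] at hint
  have h1 := hint.prod_left_ae
  set ν := Measure.pi (fun j => μ (i.succAbove j))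
  have h2 : ¬ ∀ᵐ z ∂ν, ∏ j, y (i.succAbove j) (z j) = 0 := by
    intro hz
    have h3 : ∫ z, ∏ j, y (i.succAbove j) (z j) ^ 2 ∂ν = 0 := by
      refine integral_eq_zero_of_ae ?_
      filter_upwards [hz] with z hz
      rw [Finset.prod_pow, hz]; simp
    rw [integral_fintype_prod_eq_prod (f := fun j t => y (i.succAbove j) t ^ 2),
      Finset.prod_eq_zero_iff] at h3
    obtain ⟨j, -, hj⟩ := h3
    exact hne _ (Fin.succAbove_ne i j) hj
  -- The remaining factors do not vanish almost everywhere, since their squares have nonzero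
  -- integrals. Some integrable Fubini slice therefore has a nonzero constant in front of `|y i|^m`.
  have h4 : ∃ z : Fin n → ℝ, ∏ j, y (i.succAbove j) (z j) ≠ 0 ∧
      Integrable (fun t => |y i t| ^ m * ∏ j, |y (i.succAbove j) (z j)| ^ m) (μ i) := by
    obtain ⟨z, hz, hz'⟩ := ((not_eventually.1 h2).and_eventually h1).exists
    refine ⟨z, hz, hz'.congr (ae_of_all _ fun t => ?_)⟩
    simp only [Function.comp_apply, MeasurableEquiv.piFinSuccAbove_symm_apply,
      Fin.insertNthEquiv_apply]
    rw [Fin.prod_univ_succAbove _ i]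
    simp
  obtain ⟨z, hz, hz'⟩ := h4
  have h5 : ∏ j, |y (i.succAbove j) (z j)| ^ m ≠ 0 := by
    rw [Finset.prod_ne_zero_iff] at hz ⊢
    exact fun j hj => pow_ne_zero _ (abs_ne_zero.2 (hz j hj))
  refine (hz'.mul_const (∏ j, |y (i.succAbove j) (z j)| ^ m)⁻¹).congr (ae_of_all _ fun t => ?_)
  simp only
  rw [mul_assoc, mul_inv_cancel₀ h5, mul_one]

namespace EigenSystem

variable {d : ℕ} {S : ProductSetting d} (B : EigenSystem S)

/-- `φₖ` for `α = none`, and `δⱼ φₖ` for `α = some j`. -/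
def mode (α : Option (Fin d)) (k : Fin d → ℕ) (x : Fin d → ℝ) : ℝ :=
  ∏ i, B.Y (decide (α = some i)) i (k i) (x i)

lemma mode_none : B.mode none = B.phi := by
  ext k x; simp [mode, phi, Y]

lemma mode_some (j : Fin d) (k : Fin d → ℕ) : B.mode (some j) k = S.delta j (B.phi k) := by
  ext x
  have h : (fun t => B.phi k (Function.update x j t)) = fun t =>
      B.phi1 j (k j) t * ∏ i ∈ Finset.univ.erase j, B.phi1 i (k i) (x i) := by
    ext t
    rw [phi, ← Finset.mul_prod_erase _ _ (Finset.mem_univ j), Function.update_self]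
    congr 1
    refine Finset.prod_congr rfl fun i hi => ?_
    rw [Function.update_of_ne (Finset.ne_of_mem_erase hi)]
  have h2 : ∀ i ∈ Finset.univ.erase j, B.Y (decide (some j = some i)) i (k i) (x i) =
      B.phi1 i (k i) (x i) := by
    intro i hi
    simp [(Finset.ne_of_mem_erase hi).symm, Y]
  rw [mode, ← Finset.mul_prod_erase _ _ (Finset.mem_univ j), Finset.prod_congr rfl h2,
    ProductSetting.delta, h, ProductSetting.delta1, deriv_mul_const_field]
  simp [Y, ProductSetting.delta1]
  ring

variable {B}

lemma T3.memLp_mode (hT3 : B.T3) (α : Option (Fin d)) (k : Fin d → ℕ) {p : ℝ≥0∞} (hp1 : 1 ≤ p)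
    (hp : p ≠ ∞) : MemLp (B.mode α k) p S.mu := by
  obtain ⟨h1, h2⟩ := hT3 p hp1 hp
  cases α with
  | none => rw [mode_none]; exact h1.1 _ (Submodule.subset_span ⟨k, rfl⟩)
  | some j => rw [mode_some]; exact (h2 j).1 _ (Submodule.subset_span ⟨k, rfl⟩)

/-- (T3) concerns functions on `X`. All indices other than the `i`-th are set to `0`, so the other
factors are normalised eigenfunctions and can be split off. -/
lemma T3.integrable_pow_Y (hT3 : B.T3) (b : Bool) (i : Fin d) (n m : ℕ) (hm : 1 ≤ m) :
    Integrable (fun t => |B.Y b i n t| ^ m) (S.mu1 i) := by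
  set α : Option (Fin d) := bif b then some i else none with hα
  set k : Fin d → ℕ := Function.update 0 i n with hk
  have h1 := (hT3.memLp_mode α k (p := m) (by exact_mod_cast hm)
    (ENNReal.natCast_ne_top m)).integrable_norm_pow (by omega)
  have hb : decide (α = some i) = b := by cases b <;> simp [hα]
  have h2 : Integrable (fun t => |B.Y (decide (α = some i)) i (k i) t| ^ m) (S.mu1 i) := by
    refine integrable_of_integrable_prod (y := fun j => B.Y (decide (α = some j)) j (k j))
      (fun j hj => ?_) (h1.congr (ae_of_all _ fun x => ?_))
    · have hf : decide (α = some j) = false := by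
        cases b <;> simp [hα, hj.symm]
      have := B.orthonormal j (k j) (k j)
      simp only [hf, Y, cond_false, sq]
      rw [this]; simp
    · simp only [mode, Real.norm_eq_abs]
      rw [Finset.abs_prod, Finset.prod_pow]
  rw [hb] at h2
  simpa [hk] using h2

end EigenSystem

/-! ### Reflection, and boundary sequences at both endpoints -/

lemma neg_mem_openInterval {lo hi : EReal} {x : ℝ} (hx : x ∈ openInterval (-hi) (-lo)) :
    -x ∈ openInterval lo hi :=
  ⟨by rw [EReal.coe_neg]; exact EReal.lt_neg_comm.1 hx.2,
    by rw [EReal.coe_neg]; exact EReal.neg_lt_comm.1 hx.1⟩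

lemma neg_mem_openInterval' {lo hi : EReal} {x : ℝ} (hx : x ∈ openInterval lo hi) :
    -x ∈ openInterval (-hi) (-lo) :=
  ⟨by rw [EReal.coe_neg, EReal.neg_lt_neg_iff]; exact hx.2,
    by rw [EReal.coe_neg, EReal.neg_lt_neg_iff]; exact hx.1⟩

/-- The reflection of a Sturm-Liouville system. -/
def SLSystem.reflect {lo hi : EReal} (A : SLSystem lo hi) : SLSystem (-hi) (-lo) where
  -- Both `p` and `dY` change sign, so `p dY`, and with it the first-order system, is preserved.
  p x := - A.p (-x)
  q x := A.q (-x)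
  w x := A.w (-x)
  σ x := A.σ (-x)
  V x := A.V (-x)
  v x := A.v (-x)
  Y b n x := A.Y b n (-x)
  dY b n x := - A.dY b n (-x)
  ev := A.ev
  a := A.a
  C := A.C
  p_ne_zero x hx := neg_ne_zero.2 (A.p_ne_zero _ (neg_mem_openInterval hx))
  w_pos x hx := A.w_pos _ (neg_mem_openInterval hx)
  v_nonneg x hx := A.v_nonneg _ (neg_mem_openInterval hx)
  V_ge x hx := A.V_ge _ (neg_mem_openInterval hx)
  continuousOn_p := (A.continuousOn_p.comp continuousOn_neg fun _ => neg_mem_openInterval).neg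
  continuousOn_q := A.continuousOn_q.comp continuousOn_neg fun _ => neg_mem_openInterval
  continuousOn_w := A.continuousOn_w.comp continuousOn_neg fun _ => neg_mem_openInterval
  continuousOn_V := A.continuousOn_V.comp continuousOn_neg fun _ => neg_mem_openInterval
  continuousOn_v := A.continuousOn_v.comp continuousOn_neg fun _ => neg_mem_openInterval
  continuousOn_dY b n :=
    ((A.continuousOn_dY b n).comp continuousOn_neg fun _ => neg_mem_openInterval).neg
  hasDerivAt_σ x hx := by
    refine ((A.hasDerivAt_σ _ (neg_mem_openInterval hx)).comp x (hasDerivAt_neg x)).congr_deriv ?_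
    rw [div_neg]; ring
  hasDerivAt_Y b n x hx := by
    refine ((A.hasDerivAt_Y b n _ (neg_mem_openInterval hx)).comp x
      (hasDerivAt_neg x)).congr_deriv ?_
    ring
  hasDerivAt_dY b n x hx := by
    have h := ((A.hasDerivAt_dY b n _ (neg_mem_openInterval hx)).comp x (hasDerivAt_neg x)).neg
    refine (h.congr_of_eventuallyEq (Eventually.of_forall fun y => ?_)).congr_deriv ?_
    · simp
    · ring
  p_mul_dY_false n x hx := by
    rw [neg_mul_neg]; exact A.p_mul_dY_false n _ (neg_mem_openInterval hx)
  p_mul_dY_true n x hx := by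
    rw [neg_mul_neg]; exact A.p_mul_dY_true n _ (neg_mem_openInterval hx)
  integrableOn_pow b n m hm := by
    have h := A.integrableOn_pow b n m hm
    rw [← (Measure.measurePreserving_neg (volume : Measure ℝ)).integrableOn_comp_preimage
      (MeasurableEquiv.neg ℝ).measurableEmbedding] at h
    refine h.mono_set fun x hx => neg_mem_openInterval hx

namespace EigenSystem

variable {d : ℕ} {S : ProductSetting d} (B : EigenSystem S)

/-- The Sturm-Liouville system in the `i`-th variable. -/
def system (hA1 : S.A1) (hT3 : B.T3) (i : Fin d) {C : ℝ} (hC : ∀ x ∈ S.X i, 0 ≤ S.r1 i x + C) :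
    SLSystem (S.lo i) (S.hi i) where
  p := S.p i
  q := S.q i
  w := S.w i
  σ := S.sigma i
  V := S.r1 i
  v := S.v i
  Y b n := B.Y b i n
  dY b n := deriv (B.Y b i n)
  ev := B.ev1 i
  a n := B.ev1 i n - S.a i
  C := C
  p_ne_zero := S.p_ne_zero i
  w_pos := S.w_pos i
  v_nonneg := hA1 i
  V_ge := hC
  continuousOn_p := (S.p_smooth i).continuousOn
  continuousOn_q := (S.q_smooth i).continuousOn
  continuousOn_w := (S.w_smooth i).continuousOn
  continuousOn_V := S.continuousOn_r1
  continuousOn_v := S.continuousOn_v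
  continuousOn_dY b _ := B.continuousOn_deriv_Y b
  hasDerivAt_σ _ hx := S.hasDerivAt_sigma hx
  hasDerivAt_Y b _ _ hx := B.hasDerivAt_Y b hx
  hasDerivAt_dY b _ _ hx := B.hasDerivAt_mul_deriv_Y b hx
  p_mul_dY_false _ _ _ := B.p_mul_deriv_Y_false
  p_mul_dY_true _ _ hx := B.p_mul_deriv_Y_true hx
  integrableOn_pow b n m hm := (S.integrable_mu1_iff i).1 (hT3.integrable_pow_Y b i n m hm)

variable {B}

lemma T2.tendsto (hT2 : B.T2) (i : Fin d) (b : Bool) (n m : ℕ) (hm : 1 ≤ m) {l : Filter ℝ}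
    (hl : l = S.leftEnd i ∨ l = S.rightEnd i) :
    Tendsto (fun x => (1 + |B.Y false i n x| ^ m + |B.Y true i n x| ^ m) *
      (S.p i x ^ 2 * S.w i x * deriv (B.Y b i n) x)) l (𝓝 0) := by
  have h := hT2 i n m m (by exact_mod_cast hm) (by exact_mod_cast hm) l hl
  simp only [Real.rpow_natCast] at h
  cases b
  · exact h.1
  · exact h.2

/-- The boundary terms tend to `0` along suitable sequences. -/
theorem exists_seqs (hA1 : S.A1) {K : ℝ} (hK : 0 ≤ K) (hA2 : S.A2 K) (hT2 : B.T2) (hT3 : B.T3)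
    (i : Fin d) (M N : ℕ) (hN : 1 ≤ N) :
    ∃ x : Bool → ℕ → ℝ, (∀ e n, x e n ∈ S.X i) ∧ (∀ n, x false n < x true n) ∧
      (∀ y ∈ S.X i, ∀ᶠ n in atTop, x false n < y ∧ y < x true n) ∧
      (∀ e b m, Tendsto (fun n =>
        |S.p i (x e n) ^ 2 * S.w i (x e n) * deriv (B.Y b i m) (x e n)|) atTop (𝓝 0)) ∧
      ∀ e a b, ∀ k < M, ∀ m < M, Tendsto (fun n => |B.Y a i k (x e n)| ^ N *
        |S.p i (x e n) ^ 2 * S.w i (x e n) * deriv (B.Y b i m) (x e n)|) atTop (𝓝 0) := by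
  obtain ⟨C, hC⟩ := ProductSetting.exists_r1_ge hK hA2 i
  obtain ⟨c, hc⟩ := S.nonempty_X i
  set A := B.system hA1 hT3 i hC with hAdef
  have hR : A.EndDecay := fun b n m hm => hT2.tendsto i b n m hm (Or.inr rfl)
  have hneg : Tendsto (fun x : ℝ => -x) (endFilter (-S.lo i)) (S.leftEnd i) := by
    rw [ProductSetting.leftEnd, tendsto_comap_iff]
    have h1 : Tendsto (fun y : EReal => -y) (𝓝[<] (-S.lo i)) (𝓝[>] (S.lo i)) := by
      refine tendsto_nhdsWithin_iff.2 ⟨?_, ?_⟩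
      · have := (continuous_neg (G := EReal)).tendsto (-S.lo i)
        rw [neg_neg] at this
        exact this.mono_left nhdsWithin_le_nhds
      · filter_upwards [self_mem_nhdsWithin] with y hy
        exact EReal.lt_neg_comm.1 hy
    refine (h1.comp tendsto_comap).congr fun x => ?_
    simp
  -- The left endpoint is the right endpoint of the reflected system, so the one-sided theory
  -- applies to both.
  have hL : A.reflect.EndDecay := by
    intro b n m hm
    have h := ((hT2.tendsto i b n m hm (Or.inl rfl)).comp hneg).neg
    rw [neg_zero] at h
    refine h.congr fun x => ?_
    simp only [Function.comp_apply, SLSystem.reflect, SLSystem.W, hAdef, system]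
    ring
  obtain ⟨u, hu, hulim, hu0⟩ := hR.exists_seq hc M N hN
  obtain ⟨l, hl, hllim, hl0⟩ := hL.exists_seq (neg_mem_openInterval' hc) M N hN
  refine ⟨fun e n => bif e then u n else -l n, fun e n => ?_, fun n => ?_, fun y hy => ?_,
    fun e b m => ?_, fun e a b k hk m hm => ?_⟩
  · cases e
    · exact neg_mem_openInterval (openInterval_subset (neg_mem_openInterval' hc) (hl n))
    · exact openInterval_subset hc (hu n)
  · have h1 := EReal.coe_lt_coe_iff.1 (hu n).1
    have h2 := EReal.coe_lt_coe_iff.1 (hl n).1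
    simp only [cond_true, cond_false]
    linarith
  · filter_upwards [hulim.eventually (eventually_lt_endFilter hy.2),
      hllim.eventually (eventually_lt_endFilter (neg_mem_openInterval' hy).2)] with n h1 h2
    simp only [cond_true, cond_false]
    exact ⟨by linarith, h1⟩
  · have h0 : ∀ l, (l = S.leftEnd i ∨ l = S.rightEnd i) → Tendsto (fun x =>
        |S.p i x ^ 2 * S.w i x * deriv (B.Y b i m) x|) l (𝓝 0) := by
      intro l hl
      have h := (hT2.tendsto i b m 1 le_rfl hl).abs
      rw [abs_zero] at h
      refine squeeze_zero (fun _ => abs_nonneg _) (fun x => ?_) h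
      rw [abs_mul (1 + _ + _)]
      refine le_mul_of_one_le_left (abs_nonneg _) (le_trans ?_ (le_abs_self (1 +
        |B.Y false i m x| ^ 1 + |B.Y true i m x| ^ 1)))
      linarith [pow_nonneg (abs_nonneg (B.Y false i m x)) 1,
        pow_nonneg (abs_nonneg (B.Y true i m x)) 1]
    cases e
    · exact (h0 _ (Or.inl rfl)).comp (hneg.comp hllim)
    · exact (h0 _ (Or.inr rfl)).comp hulim
  · cases e
    · refine (hl0 a b k hk m hm).congr fun n => ?_
      simp [SLSystem.reflect, SLSystem.W, hAdef, system]
    · exact hu0 a b k hk m hm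

end EigenSystem

/-! ### The regularised Bellman function of two finite vectors -/

namespace Bellman

variable {ι : Type*} (P ε : ℝ) (Z H : Finset ι)

/-- `ε²` plus the square of the length of a vector. -/
def sqLen (Z : Finset ι) (U : ι → ℝ) : ℝ := ε ^ 2 + ∑ α ∈ Z, U α ^ 2

/-- The Bellman function of the two vectors `(U α)_{α ∈ Z}` and `(U α)_{α ∈ H}`. -/
def bell (U : ι → ℝ) : ℝ := psi P (sqLen ε Z U) (sqLen ε H U)

/-- The derivative of `bell` in the direction `m`. -/
def pair (U m : ι → ℝ) : ℝ :=
  2 * psiA P (sqLen ε Z U) (sqLen ε H U) * ∑ α ∈ Z, U α * m α +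
    2 * psiB P (sqLen ε Z U) (sqLen ε H U) * ∑ α ∈ H, U α * m α

/-- The second derivative of `bell` in the direction `m`. -/
def hessU (U m : ι → ℝ) : ℝ :=
  hess P (sqLen ε Z U) (sqLen ε H U) (2 * ∑ α ∈ Z, U α * m α) (2 * ∑ α ∈ H, U α * m α)
    (∑ α ∈ Z, m α ^ 2) (∑ α ∈ H, m α ^ 2)

variable {P ε Z H}

lemma sqLen_pos (hε : 0 < ε) (U : ι → ℝ) : 0 < sqLen ε Z U :=
  add_pos_of_pos_of_nonneg (by positivity) (Finset.sum_nonneg fun _ _ => sq_nonneg _)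

lemma hasDerivAt_sqLen {U : ℝ → ι → ℝ} {m : ι → ℝ} {y : ℝ}
    (hU : ∀ α, HasDerivAt (fun y => U y α) (m α) y) :
    HasDerivAt (fun y => sqLen ε Z (U y)) (2 * ∑ α ∈ Z, U y α * m α) y := by
  have h := (HasDerivAt.fun_sum (u := Z) fun α _ => (hU α).fun_pow 2).const_add (ε ^ 2)
  refine h.congr_deriv ?_
  rw [Finset.mul_sum]
  refine Finset.sum_congr rfl fun α _ => ?_
  simp only [Nat.cast_ofNat, Nat.add_one_sub_one, pow_one]
  ring

lemma hasDerivAt_bell (hP : 1 ≤ P) (hε : 0 < ε) {U : ℝ → ι → ℝ} {m : ι → ℝ} {y : ℝ}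
    (hU : ∀ α, HasDerivAt (fun y => U y α) (m α) y) :
    HasDerivAt (fun y => bell P ε Z H (U y)) (pair P ε Z H (U y) m) y := by
  refine (hasDerivAt_psi hP (hasDerivAt_sqLen hU) (hasDerivAt_sqLen hU) (sqLen_pos hε _)
    (sqLen_pos hε _)).congr_deriv ?_
  unfold pair
  ring

/-- The weight `W` covers both uses: `W = 1` for the second time derivative, and `W = p² w` in
space, where the Sturm–Liouville equation provides the derivative of `W U₁`. -/
lemma hasDerivAt_pair (hP : 1 ≤ P) (hε : 0 < ε) {U U₁ : ℝ → ι → ℝ} {W : ℝ → ℝ} {m : ι → ℝ} {y : ℝ}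
    (hU : ∀ α, HasDerivAt (fun y => U y α) (U₁ y α) y)
    (hU₁ : ∀ α, HasDerivAt (fun y => W y * U₁ y α) (m α) y) :
    HasDerivAt (fun y => W y * pair P ε Z H (U y) (U₁ y))
      (W y * hessU P ε Z H (U y) (U₁ y) + pair P ε Z H (U y) m) y := by
  have hA := hasDerivAt_sqLen (ε := ε) (Z := Z) hU
  have hB := hasDerivAt_sqLen (ε := ε) (Z := H) hU
  have h0A := sqLen_pos (Z := Z) hε (U y)
  have h0B := sqLen_pos (Z := H) hε (U y)
  have hs : ∀ Z : Finset ι, HasDerivAt (fun y => ∑ α ∈ Z, U y α * (W y * U₁ y α))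
      (W y * ∑ α ∈ Z, U₁ y α ^ 2 + ∑ α ∈ Z, U y α * m α) y := by
    intro Z
    refine (HasDerivAt.fun_sum (u := Z) fun α _ => (hU α).mul (hU₁ α)).congr_deriv ?_
    rw [Finset.mul_sum, ← Finset.sum_add_distrib]
    exact Finset.sum_congr rfl fun α _ => by ring
  have h := ((hasDerivAt_psiA hP hA hB h0A h0B).const_mul 2 |>.mul (hs Z)).add
    ((hasDerivAt_psiB hP hA hB h0A h0B).const_mul 2 |>.mul (hs H))
  have e : (fun y => W y * pair P ε Z H (U y) (U₁ y)) = fun y =>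
      2 * psiA P (sqLen ε Z (U y)) (sqLen ε H (U y)) * (∑ α ∈ Z, U y α * (W y * U₁ y α)) +
      2 * psiB P (sqLen ε Z (U y)) (sqLen ε H (U y)) * (∑ α ∈ H, U y α * (W y * U₁ y α)) := by
    ext y
    have e1 : ∀ Z : Finset ι, ∑ α ∈ Z, U y α * (W y * U₁ y α) = W y * ∑ α ∈ Z, U y α * U₁ y α := by
      intro Z
      rw [Finset.mul_sum]
      exact Finset.sum_congr rfl fun α _ => by ring
    rw [e1, e1, pair]
    ring
  rw [e]
  refine h.congr_deriv ?_
  have e1 : ∀ Z : Finset ι, ∑ α ∈ Z, U y α * (W y * U₁ y α) = W y * ∑ α ∈ Z, U y α * U₁ y α := by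
    intro Z
    rw [Finset.mul_sum]
    exact Finset.sum_congr rfl fun α _ => by ring
  rw [e1, e1, hessU, hess, pair]
  ring

lemma pair_add (U m n : ι → ℝ) :
    pair P ε Z H U (fun α => m α + n α) = pair P ε Z H U m + pair P ε Z H U n := by
  simp only [pair, mul_add, Finset.sum_add_distrib]
  ring

lemma pair_sum {κ : Type*} (s : Finset κ) (U : ι → ℝ) (m : κ → ι → ℝ) :
    pair P ε Z H U (fun α => ∑ k ∈ s, m k α) = ∑ k ∈ s, pair P ε Z H U (m k) := by
  simp only [pair, Finset.mul_sum, Finset.sum_add_distrib]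
  congr 1 <;> rw [Finset.sum_comm]

lemma pair_const_mul (c : ℝ) (U m : ι → ℝ) :
    pair P ε Z H U (fun α => c * m α) = c * pair P ε Z H U m := by
  have e1 : ∀ Z : Finset ι, ∑ α ∈ Z, U α * (c * m α) = c * ∑ α ∈ Z, U α * m α := by
    intro Z
    rw [Finset.mul_sum]
    exact Finset.sum_congr rfl fun α _ => by ring
  simp only [pair, e1]
  ring

lemma sq_two_mul_sum_le (Z : Finset ι) (U m : ι → ℝ) :
    (2 * ∑ α ∈ Z, U α * m α) ^ 2 ≤ 4 * sqLen ε Z U * ∑ α ∈ Z, m α ^ 2 := by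
  have h1 := Finset.sum_mul_sq_le_sq_mul_sq Z U m
  have h2 : 0 ≤ ∑ α ∈ Z, m α ^ 2 := Finset.sum_nonneg fun _ _ => sq_nonneg _
  unfold sqLen
  nlinarith [mul_nonneg (sq_nonneg ε) h2]

/-- The weight in the convexity estimate. -/
def tau (P ε : ℝ) (H : Finset ι) (U : ι → ℝ) : ℝ := sqLen ε H U ^ (1 - conj P)

lemma tau_pos (hε : 0 < ε) (U : ι → ℝ) : 0 < tau P ε H U :=
  Real.rpow_pos_of_pos (sqLen_pos hε U) _

lemma le_hessU (hP : 1 ≤ P) (hε : 0 < ε) (U m : ι → ℝ) :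
    tau P ε H U * ∑ α ∈ Z, m α ^ 2 + (tau P ε H U)⁻¹ * ∑ α ∈ H, m α ^ 2 ≤ hessU P ε Z H U m :=
  le_hess hP (sqLen_pos hε U) (sqLen_pos hε U) (Finset.sum_nonneg fun _ _ => sq_nonneg _)
    (Finset.sum_nonneg fun _ _ => sq_nonneg _) (sq_two_mul_sum_le Z U m)
    (sq_two_mul_sum_le H U m)

/-- The components may carry different potentials `ρ α`. Only the common lower bound `r` is needed,
because `psiA` and `psiB` are positive. -/
lemma le_pair (hP : 1 ≤ P) (hε : 0 < ε) (U ρ : ι → ℝ) {r : ℝ} (hr : 0 ≤ r) (hρ : ∀ α, r ≤ ρ α) :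
    tau P ε H U * (r * ∑ α ∈ Z, U α ^ 2) + (tau P ε H U)⁻¹ * (r * ∑ α ∈ H, U α ^ 2) ≤
      pair P ε Z H U (fun α => ρ α * U α) := by
  have h1 := rpow_le_psiA hP (sqLen_pos (Z := Z) hε U) (sqLen_pos (Z := H) hε U)
  have h2 := inv_rpow_le_psiB hP (sqLen_pos (Z := Z) hε U) (sqLen_pos (Z := H) hε U)
  have h3 := tau_pos (P := P) (H := H) hε U
  have hs : ∀ Z : Finset ι, r * ∑ α ∈ Z, U α ^ 2 ≤ ∑ α ∈ Z, U α * (ρ α * U α) := by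
    intro Z
    rw [Finset.mul_sum]
    refine Finset.sum_le_sum fun α _ => ?_
    nlinarith [hρ α, mul_le_mul_of_nonneg_right (hρ α) (sq_nonneg (U α))]
  have h0 : ∀ Z : Finset ι, 0 ≤ r * ∑ α ∈ Z, U α ^ 2 := fun Z =>
    mul_nonneg hr (Finset.sum_nonneg fun _ _ => sq_nonneg _)
  change tau P ε H U ≤ _ at h1
  change (tau P ε H U)⁻¹ ≤ _ at h2
  have h4 : 0 ≤ (tau P ε H U)⁻¹ := by positivity
  unfold pair
  exact add_le_add (mul_le_mul (by linarith) (hs Z) (h0 Z) (by linarith))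
    (mul_le_mul (by linarith) (hs H) (h0 H) (by linarith))

section continuity

variable {X : Type*} [TopologicalSpace X] {s : Set X} {U m : X → ι → ℝ}

lemma continuousOn_sqLen (hU : ∀ α, ContinuousOn (fun z => U z α) s) :
    ContinuousOn (fun z => sqLen ε Z (U z)) s :=
  continuousOn_const.add (continuousOn_finsetSum _ fun α _ => (hU α).pow 2)

lemma continuousOn_sum_mul (hU : ∀ α, ContinuousOn (fun z => U z α) s)
    (hm : ∀ α, ContinuousOn (fun z => m z α) s) :
    ContinuousOn (fun z => ∑ α ∈ Z, U z α * m z α) s :=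
  continuousOn_finsetSum _ fun α _ => (hU α).mul (hm α)

lemma continuousOn_sqLen_rpow (hε : 0 < ε) (hU : ∀ α, ContinuousOn (fun z => U z α) s) (x : ℝ) :
    ContinuousOn (fun z => sqLen ε Z (U z) ^ x) s :=
  (continuousOn_sqLen hU).rpow_const fun z _ => Or.inl (sqLen_pos hε (U z)).ne'

lemma continuousOn_S_rpow (hε : 0 < ε) (hU : ∀ α, ContinuousOn (fun z => U z α) s) (x : ℝ) :
    ContinuousOn (fun z => S P (sqLen ε Z (U z)) (sqLen ε H (U z)) ^ x) s :=
  ((continuousOn_sqLen_rpow hε hU P).add (continuousOn_sqLen_rpow hε hU (conj P))).rpow_const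
    fun z _ => Or.inl (S_pos (sqLen_pos hε (U z)) (sqLen_pos hε (U z))).ne'

lemma continuousOn_bell (hε : 0 < ε) (hU : ∀ α, ContinuousOn (fun z => U z α) s) :
    ContinuousOn (fun z => bell P ε Z H (U z)) s := by
  have h1 := continuousOn_sqLen (ε := ε) (Z := Z) hU
  have h2 := continuousOn_S_rpow (P := P) (Z := Z) (H := H) hε hU
  have h3 := continuousOn_sqLen_rpow (Z := H) hε hU
  have h2a := h2 (1 - 1 / P)
  have h3a := h3 (conj P)
  unfold bell psi
  fun_prop

lemma continuousOn_pair (hε : 0 < ε) (hU : ∀ α, ContinuousOn (fun z => U z α) s)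
    (hm : ∀ α, ContinuousOn (fun z => m z α) s) :
    ContinuousOn (fun z => pair P ε Z H (U z) (m z)) s := by
  have h1 := continuousOn_sqLen (ε := ε) (Z := Z) hU
  have h2 := continuousOn_S_rpow (P := P) (Z := Z) (H := H) hε hU (-1 / P)
  have h3 := continuousOn_sqLen_rpow (Z := H) hε hU
  have h3a := h3 (conj P)
  have h3b := h3 (conj P - 1)
  have h4 := continuousOn_sqLen_rpow (Z := Z) hε hU P
  have h5 := continuousOn_sum_mul (Z := Z) hU hm
  have h6 := continuousOn_sum_mul (Z := H) hU hm
  unfold pair psiA psiB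
  fun_prop

lemma continuousOn_hessU (hε : 0 < ε) (hU : ∀ α, ContinuousOn (fun z => U z α) s)
    (hm : ∀ α, ContinuousOn (fun z => m z α) s) :
    ContinuousOn (fun z => hessU P ε Z H (U z) (m z)) s := by
  have h1 := continuousOn_sqLen (ε := ε) (Z := Z) hU
  have h2 := continuousOn_S_rpow (P := P) (Z := Z) (H := H) hε hU
  have h2a := h2 (-1 / P)
  have h2b := h2 (-1 / P - 1)
  have h3 := continuousOn_sqLen_rpow (Z := H) hε hU
  have h3a := h3 (conj P)
  have h3b := h3 (conj P - 1)
  have h3c := h3 (conj P - 2)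
  have h3d := h3 (2 * conj P - 1)
  have h3e := h3 (2 * conj P - 2)
  have h4 := continuousOn_sqLen_rpow (Z := Z) hε hU P
  have h4a := continuousOn_sqLen_rpow (Z := Z) hε hU (P - 1)
  have h5 := continuousOn_sum_mul (Z := Z) hU hm
  have h6 := continuousOn_sum_mul (Z := H) hU hm
  have h7 : ∀ Z : Finset ι, ContinuousOn (fun z => ∑ α ∈ Z, m z α ^ 2) s := fun Z =>
    continuousOn_finsetSum _ fun α _ => (hm α).pow 2
  have h8 := h7 Z
  have h9 := h7 H
  unfold hessU hess psiA psiB psiAA psiAB psiBB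
  fun_prop

end continuity

/-- Polynomial growth of the gradient of the Bellman function, uniformly in `ε ≤ 1`. -/
lemma exists_abs_pair_le (hP : 1 ≤ P) (Z H : Finset ι) : ∃ C : ℝ, 0 ≤ C ∧ ∃ N : ℕ,
    ∀ ε, 0 < ε → ε ≤ 1 → ∀ (U m : ι → ℝ) (R M : ℝ), 1 ≤ R → (∀ α, |U α| ≤ R) → 0 ≤ M →
      (∀ α, |m α| ≤ M) → |pair P ε Z H U m| ≤ C * R ^ N * M := by
  set κ : ℝ := Z.card + H.card with hκ
  have hκ0 : 0 ≤ κ := by positivity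
  have hZκ : (Z.card : ℝ) ≤ κ := by simp [hκ]
  have hHκ : (H.card : ℝ) ≤ κ := by simp [hκ]
  set c : ℝ := 3 + κ with hc
  set N := ⌈P⌉₊ with hN
  have hD := twelve_le_D hP
  have hQ := half_lt_conj hP
  have hQ1 := conj_le_one hP
  refine ⟨4 * P * c ^ N * κ + 2 * D P * c * (κ + 1), by positivity, 2 * N + 2, ?_⟩
  intro ε hε hε1 U m R M hR hU hM hm
  have hsq : ∀ Z : Finset ι, (Z.card : ℝ) ≤ κ → sqLen ε Z U ≤ (1 + Z.card) * R ^ 2 := by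
    intro Z hZ
    have h1 : ∑ α ∈ Z, U α ^ 2 ≤ Z.card * R ^ 2 := by
      rw [← nsmul_eq_mul]
      refine Finset.sum_le_card_nsmul _ _ _ fun α _ => ?_
      rw [← sq_abs]
      exact pow_le_pow_left₀ (abs_nonneg _) (hU α) 2
    have h2 : ε ^ 2 ≤ R ^ 2 := pow_le_pow_left₀ hε.le (hε1.trans hR) 2
    unfold sqLen
    linarith
  have hA := sqLen_pos (Z := Z) hε U
  have hB := sqLen_pos (Z := H) hε U
  have hR2 : 1 ≤ R ^ 2 := one_le_pow₀ hR
  have hABc : sqLen ε Z U + sqLen ε H U + 1 ≤ c * R ^ 2 := by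
    have := hsq Z hZκ
    have := hsq H hHκ
    rw [hc, hκ]
    nlinarith
  have hc1 : 1 ≤ c * R ^ 2 := by linarith
  have hpA : psiA P (sqLen ε Z U) (sqLen ε H U) ≤ 2 * P * (c * R ^ 2) ^ N := by
    refine (psiA_le hP hA hB).trans ?_
    gcongr
    calc _ ≤ (c * R ^ 2) ^ P := by gcongr
      _ ≤ (c * R ^ 2) ^ (N : ℝ) := Real.rpow_le_rpow_of_exponent_le hc1 (Nat.le_ceil P)
      _ = _ := Real.rpow_natCast _ _
  have hsA : |∑ α ∈ Z, U α * m α| ≤ κ * (R * M) := by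
    calc |∑ α ∈ Z, U α * m α| ≤ ∑ α ∈ Z, |U α * m α| := Finset.abs_sum_le_sum_abs _ _
      _ ≤ Z.card • (R * M) := Finset.sum_le_card_nsmul _ _ _ fun α _ => by
          rw [abs_mul]; exact mul_le_mul (hU α) (hm α) (abs_nonneg _) (by linarith)
      _ ≤ _ := by rw [nsmul_eq_mul]; gcongr
  -- `psiB` is of order `B^(Q - 1)`, which may blow up as `B → 0`. A factor `√B` is therefore
  -- extracted from this sum; the product is of order `B^(Q - 1/2)`, with `Q > 1/2`, hence
  -- controlled uniformly in `ε`.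
  have hsB : |∑ α ∈ H, U α * m α| ≤ Real.sqrt (sqLen ε H U) * ((κ + 1) * M) := by
    have h1 := Finset.sum_mul_sq_le_sq_mul_sq H U m
    have h2 : ∑ α ∈ H, m α ^ 2 ≤ κ * M ^ 2 := by
      calc ∑ α ∈ H, m α ^ 2 ≤ H.card • M ^ 2 := Finset.sum_le_card_nsmul _ _ _ fun α _ => by
            rw [← sq_abs]; exact pow_le_pow_left₀ (abs_nonneg _) (hm α) 2
        _ ≤ _ := by rw [nsmul_eq_mul]; gcongr
    have h3 : ∑ α ∈ H, U α ^ 2 ≤ sqLen ε H U := by unfold sqLen; linarith [sq_nonneg ε]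
    refine abs_le_of_sq_le_sq (b := √(sqLen ε H U) * ((κ + 1) * M)) ?_ (by positivity)
    rw [mul_pow, Real.sq_sqrt hB.le]
    have h4 : κ * M ^ 2 ≤ ((κ + 1) * M) ^ 2 := by nlinarith [sq_nonneg M, mul_nonneg hκ0 (sq_nonneg M)]
    calc _ ≤ _ := h1
      _ ≤ sqLen ε H U * ((κ + 1) * M) ^ 2 := by
        gcongr
        exact h2.trans h4
  have hpB : psiB P (sqLen ε Z U) (sqLen ε H U) * Real.sqrt (sqLen ε H U) ≤ D P * (c * R ^ 2) := by
    calc _ ≤ D P * sqLen ε H U ^ (conj P - 1) * Real.sqrt (sqLen ε H U) := by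
          gcongr; exact psiB_le hP hA hB
      _ = D P * sqLen ε H U ^ (conj P - 1 / 2) := by
          rw [mul_assoc, Real.sqrt_eq_rpow, ← Real.rpow_add hB]; congr 2; ring
      _ ≤ D P * (c * R ^ 2) ^ (conj P - 1 / 2) := by
          gcongr
          linarith
      _ ≤ D P * (c * R ^ 2) ^ (1 : ℝ) := by
          gcongr
          linarith
      _ = _ := by rw [Real.rpow_one]
  have h0A := psiA_pos hP hA hB
  have h0B := psiB_pos hP hA hB
  have t1 : |2 * psiA P (sqLen ε Z U) (sqLen ε H U) * ∑ α ∈ Z, U α * m α| ≤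
      4 * P * c ^ N * κ * R ^ (2 * N + 2) * M := by
    rw [abs_mul, abs_of_pos (by positivity)]
    have hRp : R ^ (2 * N + 1) ≤ R ^ (2 * N + 2) := pow_le_pow_right₀ hR (by omega)
    calc _ ≤ 2 * (2 * P * (c * R ^ 2) ^ N) * (κ * (R * M)) := by gcongr
      _ = 4 * P * c ^ N * κ * R ^ (2 * N + 1) * M := by rw [mul_pow, ← pow_mul]; ring
      _ ≤ _ := by gcongr
  have t2 : |2 * psiB P (sqLen ε Z U) (sqLen ε H U) * ∑ α ∈ H, U α * m α| ≤
      2 * D P * c * (κ + 1) * R ^ (2 * N + 2) * M := by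
    rw [abs_mul, abs_of_pos (by positivity)]
    have hRp : R ^ 2 ≤ R ^ (2 * N + 2) := pow_le_pow_right₀ hR (by omega)
    calc _ ≤ 2 * psiB P (sqLen ε Z U) (sqLen ε H U) *
          (Real.sqrt (sqLen ε H U) * ((κ + 1) * M)) := by gcongr
      _ = 2 * (psiB P (sqLen ε Z U) (sqLen ε H U) * Real.sqrt (sqLen ε H U)) * ((κ + 1) * M) := by
          ring
      _ ≤ 2 * (D P * (c * R ^ 2)) * ((κ + 1) * M) := by gcongr
      _ = 2 * D P * c * (κ + 1) * R ^ 2 * M := by ring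
      _ ≤ _ := by gcongr
  unfold pair
  calc _ ≤ _ := abs_add_le _ _
    _ ≤ _ := add_le_add t1 t2
    _ = _ := by ring

lemma bell_nonneg (hP : 1 ≤ P) (hε : 0 < ε) (U : ι → ℝ) : 0 ≤ bell P ε Z H U :=
  psi_nonneg hP (sqLen_pos hε U) (sqLen_pos hε U)

lemma bell_le (hP : 1 ≤ P) (hε : 0 < ε) (U : ι → ℝ) : bell P ε Z H U ≤
    D P * (sqLen ε Z U ^ P / (2 * P) + sqLen ε H U ^ conj P / (2 * conj P)) :=
  psi_le hP (sqLen_pos hε U) (sqLen_pos hε U)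

end Bellman

namespace Bellman

/-- The Cauchy–Schwarz estimate of the bilinear integrand. -/
lemma two_mul_abs_sum_le {ι : Type*} {s : Finset ι} {a q g : ι → ℝ} {f r K τ : ℝ} (hK : 0 ≤ K)
    (hr : 0 ≤ r) (hq : ∑ j ∈ s, q j ^ 2 ≤ K * r) (hτ : 0 < τ) :
    2 * |∑ j ∈ s, (a j + q j * f) * g j| ≤
      (1 + √K) * (τ * (∑ j ∈ s, a j ^ 2 + r * f ^ 2) + τ⁻¹ * ∑ j ∈ s, g j ^ 2) := by
  set n2 := ∑ j ∈ s, a j ^ 2 + r * f ^ 2 with hn2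
  set g2 := ∑ j ∈ s, g j ^ 2 with hg2
  have ha0 : 0 ≤ ∑ j ∈ s, a j ^ 2 := Finset.sum_nonneg fun _ _ => sq_nonneg _
  have hf0 : 0 ≤ r * f ^ 2 := by positivity
  have hn0 : 0 ≤ n2 := add_nonneg ha0 hf0
  have hg0 : 0 ≤ g2 := Finset.sum_nonneg fun _ _ => sq_nonneg _
  have h1 : |∑ j ∈ s, a j * g j| ≤ √n2 * √g2 := by
    refine abs_le_of_sq_le_sq ?_ (by positivity)
    rw [mul_pow, Real.sq_sqrt hn0, Real.sq_sqrt hg0]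
    refine (Finset.sum_mul_sq_le_sq_mul_sq s a g).trans ?_
    gcongr
    linarith
  -- (A2) pays for the zero-order part `q_j f` of `δ_j f` with the potential term `r f²`. This part
  -- accounts for `√K`, the derivative part for `1`.
  have h2 : |f * ∑ j ∈ s, q j * g j| ≤ √K * (√n2 * √g2) := by
    refine abs_le_of_sq_le_sq ?_ (by positivity)
    rw [mul_pow, mul_pow, mul_pow, Real.sq_sqrt hn0, Real.sq_sqrt hg0, Real.sq_sqrt hK]
    calc _ ≤ f ^ 2 * ((∑ j ∈ s, q j ^ 2) * g2) := by
          gcongr; exact Finset.sum_mul_sq_le_sq_mul_sq s q g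
      _ ≤ f ^ 2 * ((K * r) * g2) := by gcongr
      _ = K * ((r * f ^ 2) * g2) := by ring
      _ ≤ _ := by gcongr; linarith
  have h3 : ∑ j ∈ s, (a j + q j * f) * g j = ∑ j ∈ s, a j * g j + f * ∑ j ∈ s, q j * g j := by
    rw [Finset.mul_sum, ← Finset.sum_add_distrib]
    exact Finset.sum_congr rfl fun j _ => by ring
  have h4 : 2 * (√n2 * √g2) ≤ τ * n2 + τ⁻¹ * g2 := by
    have h5 : 0 ≤ τ⁻¹ * (τ * √n2 - √g2) ^ 2 := by positivity
    have h6 : τ⁻¹ * (τ * √n2 - √g2) ^ 2 = τ * √n2 ^ 2 + τ⁻¹ * √g2 ^ 2 - 2 * (√n2 * √g2) := by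
      field_simp; ring
    rw [h6, Real.sq_sqrt hn0, Real.sq_sqrt hg0] at h5
    linarith
  have hK1 : 0 ≤ 1 + √K := by positivity
  calc _ ≤ 2 * ((1 + √K) * (√n2 * √g2)) := by
        rw [h3]
        have := abs_add_le (∑ j ∈ s, a j * g j) (f * ∑ j ∈ s, q j * g j)
        linarith
    _ = (1 + √K) * (2 * (√n2 * √g2)) := by ring
    _ ≤ _ := by gcongr

end Bellman

/-! ### Poisson extensions and the pointwise differential inequality -/

/-- The product `X`. -/
def ProductSetting.dom {d : ℕ} (S : ProductSetting d) : Set (Fin d → ℝ) := {x | ∀ i, x i ∈ S.X i}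

namespace EigenSystem

variable {d : ℕ} {S : ProductSetting d} (B : EigenSystem S)

/-- The derivative of `mode α k` in the `i`-th variable. -/
def dmode (i : Fin d) (α : Option (Fin d)) (k : Fin d → ℕ) (x : Fin d → ℝ) : ℝ :=
  deriv (B.Y (decide (α = some i)) i (k i)) (x i) *
    ∏ j ∈ Finset.univ.erase i, B.Y (decide (α = some j)) j (k j) (x j)

/-- The frequency `√λₖ`. -/
def freq (k : Fin d → ℕ) : ℝ := √(B.ev k)

lemma mode_update (i : Fin d) (α : Option (Fin d)) (k : Fin d → ℕ) (x : Fin d → ℝ) (y : ℝ) :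
    B.mode α k (Function.update x i y) = B.Y (decide (α = some i)) i (k i) y *
      ∏ j ∈ Finset.univ.erase i, B.Y (decide (α = some j)) j (k j) (x j) := by
  rw [mode, ← Finset.mul_prod_erase _ _ (Finset.mem_univ i), Function.update_self]
  congr 1
  refine Finset.prod_congr rfl fun j hj => ?_
  rw [Function.update_of_ne (Finset.ne_of_mem_erase hj)]

lemma dmode_update (i : Fin d) (α : Option (Fin d)) (k : Fin d → ℕ) (x : Fin d → ℝ) (y : ℝ) :
    B.dmode i α k (Function.update x i y) = deriv (B.Y (decide (α = some i)) i (k i)) y *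
      ∏ j ∈ Finset.univ.erase i, B.Y (decide (α = some j)) j (k j) (x j) := by
  rw [dmode, Function.update_self]
  congr 1
  refine Finset.prod_congr rfl fun j hj => ?_
  rw [Function.update_of_ne (Finset.ne_of_mem_erase hj)]

lemma hasDerivAt_mode (i : Fin d) (α : Option (Fin d)) (k : Fin d → ℕ) {x : Fin d → ℝ}
    (hx : x i ∈ S.X i) :
    HasDerivAt (fun y => B.mode α k (Function.update x i y)) (B.dmode i α k x) (x i) := by
  simp only [mode_update]
  exact (B.hasDerivAt_Y _ hx).mul_const _

lemma hasDerivAt_mul_dmode (i : Fin d) (α : Option (Fin d)) (k : Fin d → ℕ) {x : Fin d → ℝ}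
    (hx : x i ∈ S.X i) :
    HasDerivAt (fun y => S.p i y ^ 2 * S.w i y * B.dmode i α k (Function.update x i y))
      (S.w i (x i) * ((S.pot (decide (α = some i)) i (x i) - B.ev1 i (k i)) * B.mode α k x))
      (x i) := by
  simp only [dmode_update, ← mul_assoc]
  refine ((B.hasDerivAt_mul_deriv_Y _ hx).mul_const _).congr_deriv ?_
  rw [mode, ← Finset.mul_prod_erase _ _ (Finset.mem_univ i)]
  ring

lemma continuousOn_mode (α : Option (Fin d)) (k : Fin d → ℕ) :
    ContinuousOn (B.mode α k) S.dom :=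
  continuousOn_finsetProd _ fun i _ =>
    (B.continuousOn_Y _).comp (continuous_apply i).continuousOn fun _ hx => hx i

lemma continuousOn_dmode (i : Fin d) (α : Option (Fin d)) (k : Fin d → ℕ) :
    ContinuousOn (B.dmode i α k) S.dom :=
  ((B.continuousOn_deriv_Y _).comp (continuous_apply i).continuousOn
    fun _ (hx : _ ∈ S.dom) => hx i).mul
    (continuousOn_finsetProd _ fun j _ =>
      (B.continuousOn_Y _).comp (continuous_apply j).continuousOn fun _ (hx : _ ∈ S.dom) => hx j)

variable (s : Finset (Fin d → ℕ)) (C : Option (Fin d) → (Fin d → ℕ) → ℝ)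

/-- The `n`-th derivative in `t` of the Poisson extensions of `∑ₖ C α k mode α k`. -/
def wave (n : ℕ) (t : ℝ) (x : Fin d → ℝ) (α : Option (Fin d)) : ℝ :=
  ∑ k ∈ s, C α k * ((-B.freq k) ^ n * Real.exp (-B.freq k * t)) * B.mode α k x

/-- The derivative of the Poisson extensions in the `i`-th variable. -/
def dwave (i : Fin d) (t : ℝ) (x : Fin d → ℝ) (α : Option (Fin d)) : ℝ :=
  ∑ k ∈ s, C α k * Real.exp (-B.freq k * t) * B.dmode i α k x

/-- The Sturm–Liouville operator in the `i`-th variable, applied to the Poisson extensions. -/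
def lwave (i : Fin d) (t : ℝ) (x : Fin d → ℝ) (α : Option (Fin d)) : ℝ :=
  ∑ k ∈ s, C α k * Real.exp (-B.freq k * t) *
    ((S.pot (decide (α = some i)) i (x i) - B.ev1 i (k i)) * B.mode α k x)

lemma hasDerivAt_wave_time (n : ℕ) (t : ℝ) (x : Fin d → ℝ) (α : Option (Fin d)) :
    HasDerivAt (fun t => B.wave s C n t x α) (B.wave s C (n + 1) t x α) t := by
  unfold wave
  refine HasDerivAt.fun_sum fun k _ => ?_
  have h := ((((hasDerivAt_id t).const_mul (-B.freq k)).exp.const_mul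
    ((-B.freq k) ^ n)).const_mul (C α k)).mul_const (B.mode α k x)
  refine h.congr_deriv ?_
  simp only [id]
  ring

lemma hasDerivAt_wave_space (i : Fin d) (t : ℝ) {x : Fin d → ℝ} (hx : x i ∈ S.X i)
    (α : Option (Fin d)) :
    HasDerivAt (fun y => B.wave s C 0 t (Function.update x i y) α) (B.dwave s C i t x α) (x i) := by
  unfold wave dwave
  refine HasDerivAt.fun_sum fun k _ => ?_
  simp only [pow_zero, one_mul]
  exact (B.hasDerivAt_mode i α k hx).const_mul _

lemma hasDerivAt_mul_dwave (i : Fin d) (t : ℝ) {x : Fin d → ℝ} (hx : x i ∈ S.X i)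
    (α : Option (Fin d)) :
    HasDerivAt (fun y => S.p i y ^ 2 * S.w i y * B.dwave s C i t (Function.update x i y) α)
      (S.w i (x i) * B.lwave s C i t x α) (x i) := by
  unfold dwave lwave
  simp only [Finset.mul_sum]
  refine HasDerivAt.fun_sum fun k _ => ?_
  have h := (B.hasDerivAt_mul_dmode i α k hx).const_mul (C α k * Real.exp (-B.freq k * t))
  refine (h.congr_deriv (by ring)).congr_of_eventuallyEq (Eventually.of_forall fun y => ?_)
  simp only
  ring

/-- The Poisson extensions solve the equations with the potentials `r` and `r + vⱼ`. -/
lemma wave_two_add_sum_lwave (t : ℝ) (x : Fin d → ℝ) (α : Option (Fin d)) :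
    B.wave s C 2 t x α + ∑ i, B.lwave s C i t x α =
      (∑ i, S.pot (decide (α = some i)) i (x i)) * B.wave s C 0 t x α := by
  unfold wave lwave
  rw [Finset.sum_comm, ← Finset.sum_add_distrib, Finset.mul_sum]
  refine Finset.sum_congr rfl fun k _ => ?_
  have h : (-B.freq k) ^ 2 = ∑ i, B.ev1 i (k i) := by
    rw [neg_sq, freq, ev, Real.sq_sqrt (Finset.sum_nonneg fun i _ => B.ev1_nonneg i _)]
  have h2 : ∑ i, C α k * Real.exp (-B.freq k * t) *
      ((S.pot (decide (α = some i)) i (x i) - B.ev1 i (k i)) * B.mode α k x) =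
      C α k * Real.exp (-B.freq k * t) * ((∑ i, S.pot (decide (α = some i)) i (x i) -
        ∑ i, B.ev1 i (k i)) * B.mode α k x) := by
    rw [← Finset.sum_sub_distrib, Finset.sum_mul, Finset.mul_sum]
  rw [h2, h, pow_zero]
  ring

/-- (A1) makes the potential `r + v_j` of the equation for `G_j` at least the potential `r` of the
equation for `F`. -/
lemma r_le_sum_pot (hA1 : S.A1) {x : Fin d → ℝ} (hx : x ∈ S.dom) (α : Option (Fin d)) :
    S.r x ≤ ∑ i, S.pot (decide (α = some i)) i (x i) := by
  refine Finset.sum_le_sum fun i _ => ?_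
  unfold ProductSetting.pot
  cases decide (α = some i)
  · simp
  · simpa using hA1 i _ (hx i)

lemma continuousOn_wave (n : ℕ) (α : Option (Fin d)) :
    ContinuousOn (fun z : (Fin d → ℝ) × ℝ => B.wave s C n z.2 z.1 α) (S.dom ×ˢ Set.univ) := by
  unfold wave
  refine continuousOn_finsetSum _ fun k _ => ContinuousOn.mul (by fun_prop) ?_
  exact (B.continuousOn_mode α k).comp continuousOn_fst fun z hz => hz.1

lemma continuousOn_dwave (i : Fin d) (α : Option (Fin d)) :
    ContinuousOn (fun z : (Fin d → ℝ) × ℝ => B.dwave s C i z.2 z.1 α) (S.dom ×ˢ Set.univ) := by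
  unfold dwave
  refine continuousOn_finsetSum _ fun k _ => ContinuousOn.mul (by fun_prop) ?_
  exact (B.continuousOn_dmode i α k).comp continuousOn_fst fun z hz => hz.1

lemma continuousOn_lwave (i : Fin d) (α : Option (Fin d)) :
    ContinuousOn (fun z : (Fin d → ℝ) × ℝ => B.lwave s C i z.2 z.1 α) (S.dom ×ˢ Set.univ) := by
  unfold lwave
  refine continuousOn_finsetSum _ fun k _ => ContinuousOn.mul (by fun_prop) (.mul ?_ ?_)
  · refine ContinuousOn.sub ?_ continuousOn_const
    exact (S.continuousOn_pot _ i).comp (by fun_prop : Continuous fun z : (Fin d → ℝ) × ℝ =>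
      z.1 i).continuousOn fun z hz => hz.1 i
  · exact (B.continuousOn_mode α k).comp continuousOn_fst fun z hz => hz.1

/-- The bilinear integrand `-∑ⱼ δⱼF ∂ₜGⱼ`. -/
def theta (t : ℝ) (x : Fin d → ℝ) : ℝ :=
  -∑ j, (S.p j (x j) * B.dwave s C j t x none + S.q j (x j) * B.wave s C 0 t x none) *
    B.wave s C 1 t x (some j)

variable (P ε : ℝ) (Z H : Finset (Option (Fin d)))

/-- The second derivative in `t` of the Bellman function of the Poisson extensions. -/
def accel (t : ℝ) (x : Fin d → ℝ) : ℝ :=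
  Bellman.hessU P ε Z H (B.wave s C 0 t x) (B.wave s C 1 t x) +
    Bellman.pair P ε Z H (B.wave s C 0 t x) (B.wave s C 2 t x)

/-- The divergence `wᵢ⁻¹ ∂ᵢ (pᵢ² wᵢ ∂ᵢ ·)` of the Bellman function of the Poisson extensions. -/
def diverg (i : Fin d) (t : ℝ) (x : Fin d → ℝ) : ℝ :=
  S.p i (x i) ^ 2 * Bellman.hessU P ε Z H (B.wave s C 0 t x) (B.dwave s C i t x) +
    Bellman.pair P ε Z H (B.wave s C 0 t x) (B.lwave s C i t x)

variable {P ε Z H}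

lemma le_accel_add_diverg (hP : 1 ≤ P) (hε : 0 < ε) (hA1 : S.A1) {x : Fin d → ℝ} (hx : x ∈ S.dom)
    (hr : 0 ≤ S.r x) (t : ℝ) : ∃ τ > 0, τ * (∑ α ∈ Z, (B.wave s C 1 t x α ^ 2 +
      ∑ i, (S.p i (x i) * B.dwave s C i t x α) ^ 2 + S.r x * B.wave s C 0 t x α ^ 2)) +
      τ⁻¹ * (∑ α ∈ H, (B.wave s C 1 t x α ^ 2 +
      ∑ i, (S.p i (x i) * B.dwave s C i t x α) ^ 2 + S.r x * B.wave s C 0 t x α ^ 2)) ≤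
      B.accel s C P ε Z H t x + ∑ i, B.diverg s C P ε Z H i t x := by
  set U := B.wave s C 0 t x with hU
  refine ⟨Bellman.tau P ε H U, Bellman.tau_pos hε U, ?_⟩
  have h1 := Bellman.le_hessU (Z := Z) (H := H) hP hε U (B.wave s C 1 t x)
  have h2 : ∀ i, S.p i (x i) ^ 2 * (Bellman.tau P ε H U * ∑ α ∈ Z, B.dwave s C i t x α ^ 2 +
      (Bellman.tau P ε H U)⁻¹ * ∑ α ∈ H, B.dwave s C i t x α ^ 2) ≤
      S.p i (x i) ^ 2 * Bellman.hessU P ε Z H U (B.dwave s C i t x) := fun i =>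
    mul_le_mul_of_nonneg_left (Bellman.le_hessU hP hε U _) (sq_nonneg _)
  have h3 := Bellman.le_pair (Z := Z) (H := H) hP hε U
    (fun α => ∑ i, S.pot (decide (α = some i)) i (x i)) hr (r_le_sum_pot hA1 hx)
  have h4 := Finset.sum_le_sum fun i (_ : i ∈ Finset.univ) => h2 i
  -- Second derivatives of the extensions enter only through `pair`, which is linear in the
  -- direction; by the equations they add up to the potentials times `U`.
  have h5 : Bellman.pair P ε Z H U (fun α => (∑ i, S.pot (decide (α = some i)) i (x i)) * U α) =
      Bellman.pair P ε Z H U (B.wave s C 2 t x) +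
        ∑ i, Bellman.pair P ε Z H U (B.lwave s C i t x) := by
    rw [← Bellman.pair_sum, ← Bellman.pair_add]
    congr 1
    ext α
    exact (B.wave_two_add_sum_lwave s C t x α).symm
  have h6 : ∀ Z : Finset (Option (Fin d)), ∑ α ∈ Z, (B.wave s C 1 t x α ^ 2 +
      ∑ i, (S.p i (x i) * B.dwave s C i t x α) ^ 2 + S.r x * U α ^ 2) =
      ∑ α ∈ Z, B.wave s C 1 t x α ^ 2 +
      ∑ i, S.p i (x i) ^ 2 * ∑ α ∈ Z, B.dwave s C i t x α ^ 2 + S.r x * ∑ α ∈ Z, U α ^ 2 := by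
    intro Z
    simp only [Finset.sum_add_distrib, Finset.mul_sum, mul_pow]
    rw [Finset.sum_comm]
  have h7 : ∑ i, S.p i (x i) ^ 2 * (Bellman.tau P ε H U * ∑ α ∈ Z, B.dwave s C i t x α ^ 2 +
      (Bellman.tau P ε H U)⁻¹ * ∑ α ∈ H, B.dwave s C i t x α ^ 2) =
      Bellman.tau P ε H U * ∑ i, S.p i (x i) ^ 2 * ∑ α ∈ Z, B.dwave s C i t x α ^ 2 +
      (Bellman.tau P ε H U)⁻¹ * ∑ i, S.p i (x i) ^ 2 * ∑ α ∈ H, B.dwave s C i t x α ^ 2 := by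
    rw [Finset.mul_sum, Finset.mul_sum, ← Finset.sum_add_distrib]
    exact Finset.sum_congr rfl fun i _ => by ring
  rw [h6, h6]
  unfold accel diverg
  rw [Finset.sum_add_distrib, ← hU]
  rw [h5] at h3
  rw [h7] at h4
  linarith

/-- The assignments of the two vectors to the two groups of variables of the Bellman function. -/
def Roles (Z H : Finset (Option (Fin d))) : Prop :=
  (Z = {none} ∧ H = Finset.univ.map Function.Embedding.some) ∨
    (H = {none} ∧ Z = Finset.univ.map Function.Embedding.some)

lemma two_mul_abs_theta_le (hP : 1 ≤ P) (hε : 0 < ε) (hZH : Roles Z H) (hA1 : S.A1) {K : ℝ}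
    (hK : 0 ≤ K) (hA2 : S.A2 K) {x : Fin d → ℝ} (hx : x ∈ S.dom) (t : ℝ) :
    2 * |B.theta s C t x| ≤
      (1 + √K) * (B.accel s C P ε Z H t x + ∑ i, B.diverg s C P ε Z H i t x) := by
  have hr := S.r_nonneg hK hA2 hx
  obtain ⟨τ, hτ, h⟩ := B.le_accel_add_diverg s C (Z := Z) (H := H) hP hε hA1 hx hr t
  refine le_trans ?_ (mul_le_mul_of_nonneg_left h (by positivity))
  have hn : ∀ α, 0 ≤ ∑ i, (S.p i (x i) * B.dwave s C i t x α) ^ 2 := fun α =>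
    Finset.sum_nonneg fun _ _ => sq_nonneg _
  have hm : ∀ α, 0 ≤ S.r x * B.wave s C 0 t x α ^ 2 := fun α => by positivity
  have h1 : ∑ j, (S.p j (x j) * B.dwave s C j t x none) ^ 2 + S.r x * B.wave s C 0 t x none ^ 2 ≤
      ∑ α ∈ ({none} : Finset (Option (Fin d))), (B.wave s C 1 t x α ^ 2 +
      ∑ i, (S.p i (x i) * B.dwave s C i t x α) ^ 2 + S.r x * B.wave s C 0 t x α ^ 2) := by
    rw [Finset.sum_singleton]
    linarith [sq_nonneg (B.wave s C 1 t x none)]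
  have h2 : ∑ j, B.wave s C 1 t x (some j) ^ 2 ≤
      ∑ α ∈ Finset.univ.map Function.Embedding.some, (B.wave s C 1 t x α ^ 2 +
      ∑ i, (S.p i (x i) * B.dwave s C i t x α) ^ 2 + S.r x * B.wave s C 0 t x α ^ 2) := by
    rw [Finset.sum_map]
    exact Finset.sum_le_sum fun j _ => by
      have := hn (some j); have := hm (some j); simp only [Function.Embedding.some_apply]; linarith
  rw [theta, abs_neg]
  rcases hZH with ⟨rfl, rfl⟩ | ⟨rfl, rfl⟩
  · refine (Bellman.two_mul_abs_sum_le hK hr (hA2 x hx) hτ).trans ?_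
    gcongr
  -- With the groups of variables exchanged, `τ` and `τ⁻¹` change places.
  · refine (Bellman.two_mul_abs_sum_le hK hr (hA2 x hx) (inv_pos.2 hτ)).trans ?_
    rw [inv_inv, add_comm (τ⁻¹ * _)]
    gcongr

lemma hasDerivAt_bell_wave (hP : 1 ≤ P) (hε : 0 < ε) (t : ℝ) (x : Fin d → ℝ) :
    HasDerivAt (fun t => Bellman.bell P ε Z H (B.wave s C 0 t x))
      (Bellman.pair P ε Z H (B.wave s C 0 t x) (B.wave s C 1 t x)) t :=
  Bellman.hasDerivAt_bell hP hε fun α => B.hasDerivAt_wave_time s C 0 t x α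

lemma hasDerivAt_pair_wave (hP : 1 ≤ P) (hε : 0 < ε) (t : ℝ) (x : Fin d → ℝ) :
    HasDerivAt (fun t => Bellman.pair P ε Z H (B.wave s C 0 t x) (B.wave s C 1 t x))
      (B.accel s C P ε Z H t x) t := by
  have h := Bellman.hasDerivAt_pair (Z := Z) (H := H) (W := fun _ => 1) hP hε
    (fun α => B.hasDerivAt_wave_time s C 0 t x α)
    (fun α => (B.hasDerivAt_wave_time s C 1 t x α).congr_of_eventuallyEq
      (Eventually.of_forall fun y => one_mul _))
  simp only [one_mul] at h
  exact h

lemma hasDerivAt_flux (hP : 1 ≤ P) (hε : 0 < ε) (i : Fin d) (t : ℝ) {x : Fin d → ℝ}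
    (hx : x i ∈ S.X i) :
    HasDerivAt (fun y => S.p i y ^ 2 * S.w i y * Bellman.pair P ε Z H
      (B.wave s C 0 t (Function.update x i y)) (B.dwave s C i t (Function.update x i y)))
      (S.w i (x i) * B.diverg s C P ε Z H i t x) (x i) := by
  have h := Bellman.hasDerivAt_pair (Z := Z) (H := H) (W := fun y => S.p i y ^ 2 * S.w i y)
    (U := fun y => B.wave s C 0 t (Function.update x i y))
    (U₁ := fun y => B.dwave s C i t (Function.update x i y))
    (m := fun α => S.w i (x i) * B.lwave s C i t x α) (y := x i) hP hε
    (fun α => by simpa using B.hasDerivAt_wave_space s C i t hx α)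
    (fun α => B.hasDerivAt_mul_dwave s C i t hx α)
  refine h.congr_deriv ?_
  simp only [Function.update_eq_self]
  rw [Bellman.pair_const_mul, diverg]
  ring

lemma continuousOn_pair_wave (hε : 0 < ε) : ContinuousOn (fun z : (Fin d → ℝ) × ℝ =>
    Bellman.pair P ε Z H (B.wave s C 0 z.2 z.1) (B.wave s C 1 z.2 z.1)) (S.dom ×ˢ Set.univ) :=
  Bellman.continuousOn_pair hε (B.continuousOn_wave s C 0) (B.continuousOn_wave s C 1)

lemma continuousOn_bell_wave (hε : 0 < ε) : ContinuousOn (fun z : (Fin d → ℝ) × ℝ =>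
    Bellman.bell P ε Z H (B.wave s C 0 z.2 z.1)) (S.dom ×ˢ Set.univ) :=
  Bellman.continuousOn_bell hε (B.continuousOn_wave s C 0)

lemma continuousOn_accel (hε : 0 < ε) : ContinuousOn (fun z : (Fin d → ℝ) × ℝ =>
    B.accel s C P ε Z H z.2 z.1) (S.dom ×ˢ Set.univ) :=
  (Bellman.continuousOn_hessU hε (B.continuousOn_wave s C 0) (B.continuousOn_wave s C 1)).add
    (Bellman.continuousOn_pair hε (B.continuousOn_wave s C 0) (B.continuousOn_wave s C 2))

lemma continuousOn_diverg (hε : 0 < ε) (i : Fin d) : ContinuousOn (fun z : (Fin d → ℝ) × ℝ =>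
    B.diverg s C P ε Z H i z.2 z.1) (S.dom ×ˢ Set.univ) := by
  refine ContinuousOn.add (.mul (.pow ?_ 2) ?_) ?_
  · exact (S.p_smooth i).continuousOn.comp (by fun_prop : Continuous fun z : (Fin d → ℝ) × ℝ =>
      z.1 i).continuousOn fun z hz => hz.1 i
  · exact Bellman.continuousOn_hessU hε (B.continuousOn_wave s C 0) (B.continuousOn_dwave s C i)
  · exact Bellman.continuousOn_pair hε (B.continuousOn_wave s C 0) (B.continuousOn_lwave s C i)

end EigenSystem

/-! ### Majorants of product form -/

namespace EigenSystem

variable {d : ℕ} {S : ProductSetting d} (B : EigenSystem S)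

/-- A common majorant of the first `M` functions `Y b i k`. -/
def maj (M : ℕ) (i : Fin d) (y : ℝ) : ℝ :=
  ∑ z ∈ Finset.range M ×ˢ (Finset.univ : Finset Bool), |B.Y z.2 i z.1 y|

/-- A common majorant of the first `M` functions `pᵢ² wᵢ ∂ (Y b i k)`. -/
def vmaj (M : ℕ) (i : Fin d) (y : ℝ) : ℝ :=
  ∑ z ∈ Finset.range M ×ˢ (Finset.univ : Finset Bool),
    |S.p i y ^ 2 * S.w i y * deriv (B.Y z.2 i z.1) y|

variable {M : ℕ}

lemma maj_nonneg (i : Fin d) (y : ℝ) : 0 ≤ B.maj M i y :=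
  Finset.sum_nonneg fun _ _ => abs_nonneg _

lemma vmaj_nonneg (i : Fin d) (y : ℝ) : 0 ≤ B.vmaj M i y :=
  Finset.sum_nonneg fun _ _ => abs_nonneg _

lemma abs_Y_le_maj (b : Bool) (i : Fin d) {n : ℕ} (hn : n < M) (y : ℝ) :
    |B.Y b i n y| ≤ B.maj M i y :=
  Finset.single_le_sum (f := fun z : ℕ × Bool => |B.Y z.2 i z.1 y|) (fun _ _ => abs_nonneg _)
    (a := (n, b)) (by simpa using hn)

lemma abs_mul_deriv_Y_le_vmaj (b : Bool) (i : Fin d) {n : ℕ} (hn : n < M) (y : ℝ) :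
    |S.p i y ^ 2 * S.w i y * deriv (B.Y b i n) y| ≤ B.vmaj M i y :=
  Finset.single_le_sum (f := fun z : ℕ × Bool =>
    |S.p i y ^ 2 * S.w i y * deriv (B.Y z.2 i z.1) y|) (fun _ _ => abs_nonneg _)
    (a := (n, b)) (by simpa using hn)

lemma maj_pow_le (i : Fin d) (N : ℕ) (y : ℝ) : B.maj M i y ^ (N + 1) ≤
    ((Finset.range M ×ˢ (Finset.univ : Finset Bool)).card : ℝ) ^ N *
      ∑ z ∈ Finset.range M ×ˢ (Finset.univ : Finset Bool), |B.Y z.2 i z.1 y| ^ (N + 1) := by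
  rcases Nat.eq_zero_or_pos M with rfl | hM
  · simp [maj]
  · have h := pow_sum_div_card_le_sum_pow (s := Finset.range M ×ˢ (Finset.univ : Finset Bool))
      (f := fun z => |B.Y z.2 i z.1 y|) (fun _ _ => abs_nonneg _) N
    rwa [div_le_iff₀' (by
      have : 0 < (Finset.range M ×ˢ (Finset.univ : Finset Bool)).card := by simp [hM]
      positivity)] at h

lemma abs_mode_le {k : Fin d → ℕ} (hk : ∀ i, k i < M) (α : Option (Fin d)) (x : Fin d → ℝ) :
    |B.mode α k x| ≤ ∏ i, B.maj M i (x i) := by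
  rw [mode, Finset.abs_prod]
  exact Finset.prod_le_prod (fun _ _ => abs_nonneg _) fun i _ => B.abs_Y_le_maj _ i (hk i) _

lemma abs_mul_dmode_le {k : Fin d → ℕ} (hk : ∀ i, k i < M) (i : Fin d) (α : Option (Fin d))
    (x : Fin d → ℝ) : |S.p i (x i) ^ 2 * S.w i (x i) * B.dmode i α k x| ≤
      B.vmaj M i (x i) * ∏ j ∈ Finset.univ.erase i, B.maj M j (x j) := by
  rw [dmode, ← mul_assoc, abs_mul, Finset.abs_prod]
  exact mul_le_mul (B.abs_mul_deriv_Y_le_vmaj _ i (hk i) _)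
    (Finset.prod_le_prod (fun _ _ => abs_nonneg _) fun j _ => B.abs_Y_le_maj _ j (hk j) _)
    (Finset.prod_nonneg fun _ _ => abs_nonneg _) (B.vmaj_nonneg _ _)

variable (s : Finset (Fin d → ℕ)) (C : Option (Fin d) → (Fin d → ℕ) → ℝ)

/-- The constant in the bounds of the Poisson extensions. -/
def coeffBound : ℝ := ∑ α, ∑ k ∈ s, |C α k| * (1 + B.freq k)

lemma freq_nonneg (k : Fin d → ℕ) : 0 ≤ B.freq k := Real.sqrt_nonneg _

lemma coeffBound_nonneg : 0 ≤ B.coeffBound s C :=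
  Finset.sum_nonneg fun _ _ => Finset.sum_nonneg fun k _ =>
    mul_nonneg (abs_nonneg _) (add_nonneg zero_le_one (B.freq_nonneg k))

lemma sum_le_coeffBound (α : Option (Fin d)) :
    ∑ k ∈ s, |C α k| * (1 + B.freq k) ≤ B.coeffBound s C :=
  Finset.single_le_sum (f := fun α => ∑ k ∈ s, |C α k| * (1 + B.freq k))
    (fun _ _ => Finset.sum_nonneg fun k _ =>
      mul_nonneg (abs_nonneg _) (add_nonneg zero_le_one (B.freq_nonneg k))) (Finset.mem_univ α)

variable {s}

lemma abs_sum_le_coeffBound {α : Option (Fin d)} {c m : (Fin d → ℕ) → ℝ} {η A : ℝ} (hA : 0 ≤ A)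
    (hη : 0 ≤ η) (hc : ∀ k ∈ s, |c k| ≤ |C α k| * (1 + B.freq k) * η) (hm : ∀ k ∈ s, |m k| ≤ A) :
    |∑ k ∈ s, c k * m k| ≤ B.coeffBound s C * η * A := by
  calc |∑ k ∈ s, c k * m k| ≤ ∑ k ∈ s, |c k * m k| := Finset.abs_sum_le_sum_abs _ _
    _ ≤ ∑ k ∈ s, |C α k| * (1 + B.freq k) * η * A := Finset.sum_le_sum fun k hk => by
        rw [abs_mul]
        exact mul_le_mul (hc k hk) (hm k hk) (abs_nonneg _) ((abs_nonneg _).trans (hc k hk))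
    _ = (∑ k ∈ s, |C α k| * (1 + B.freq k)) * η * A := by rw [Finset.sum_mul, Finset.sum_mul]
    _ ≤ _ := by gcongr; exact B.sum_le_coeffBound s C α

lemma exp_neg_freq_le_one (k : Fin d → ℕ) {t : ℝ} (ht : 0 ≤ t) :
    Real.exp (-B.freq k * t) ≤ 1 := by
  rw [Real.exp_le_one_iff]
  nlinarith [B.freq_nonneg k, mul_nonneg (B.freq_nonneg k) ht]

/-- Turns a power of a bound for the whole vector into a product of functions of one variable, so
that integrals over `X` and over faces of boxes factor. -/
lemma one_add_mul_prod_pow_le {c : ℝ} (hc : 0 ≤ c) {ι : Type*} (I : Finset ι) {u : ι → ℝ}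
    (hu : ∀ i ∈ I, 0 ≤ u i) (N : ℕ) : (1 + c * ∏ i ∈ I, u i) ^ (N + 1) ≤
      2 ^ N * (1 + c ^ (N + 1)) * ∏ i ∈ I, (1 + u i ^ (N + 1)) := by
  have h0 : 0 ≤ c * ∏ i ∈ I, u i := mul_nonneg hc (Finset.prod_nonneg hu)
  have h1 := add_pow_le zero_le_one h0 (N + 1)
  have h2 : 1 ≤ ∏ i ∈ I, (1 + u i ^ (N + 1)) :=
by
    simpa using Finset.prod_le_prod (s := I) (f := fun _ => (1 : ℝ)) (fun _ _ => zero_le_one)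
      fun i hi => le_add_of_nonneg_right (pow_nonneg (hu i hi) (N + 1))
  have h3 : (∏ i ∈ I, u i) ^ (N + 1) ≤ ∏ i ∈ I, (1 + u i ^ (N + 1)) := by
    rw [← Finset.prod_pow]
    exact Finset.prod_le_prod (fun i hi => pow_nonneg (hu i hi) _) fun i _ => by linarith
  rw [one_pow, mul_pow, Nat.add_sub_cancel] at h1
  refine h1.trans ?_
  rw [mul_assoc]
  gcongr
  rw [add_mul, one_mul]
  gcongr

/-- The integrable majorants of the one-dimensional factors. -/
def weight (B : EigenSystem S) (M N : ℕ) (i : Fin d) (y : ℝ) : ℝ :=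
  B.maj M i y * (1 + B.maj M i y ^ (N + 1))

lemma weight_nonneg (N : ℕ) (i : Fin d) (y : ℝ) : 0 ≤ B.weight M N i y :=
  mul_nonneg (B.maj_nonneg i y) (add_nonneg zero_le_one (pow_nonneg (B.maj_nonneg i y) _))

variable (hs : ∀ k ∈ s, ∀ i, k i < M)

include hs

lemma abs_wave_zero_le {t : ℝ} (ht : 0 ≤ t) (x : Fin d → ℝ) (α : Option (Fin d)) :
    |B.wave s C 0 t x α| ≤ B.coeffBound s C * ∏ i, B.maj M i (x i) := by
  have h := B.abs_sum_le_coeffBound C (α := α) (η := 1)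
    (c := fun k => C α k * ((-B.freq k) ^ 0 * Real.exp (-B.freq k * t)))
    (Finset.prod_nonneg fun _ _ => B.maj_nonneg _ _) zero_le_one (fun k _ => ?_)
    (fun k hk => B.abs_mode_le (hs k hk) α x)
  · simpa [wave] using h
  · rw [pow_zero, one_mul, abs_mul, mul_one, Real.abs_exp]
    gcongr
    linarith [B.exp_neg_freq_le_one k ht, B.freq_nonneg k]

/-- With `δ > 0` a lower bound for the frequencies in the sum, the factor `e^(-δt)` makes the
boundary term at `t = T` vanish as `T → ∞`. -/
lemma abs_wave_one_le {δ : ℝ} (hδ : ∀ k ∈ s, δ ≤ B.freq k) {t : ℝ} (ht : 0 ≤ t) (x : Fin d → ℝ)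
    (α : Option (Fin d)) :
    |B.wave s C 1 t x α| ≤ B.coeffBound s C * Real.exp (-δ * t) * ∏ i, B.maj M i (x i) := by
  refine B.abs_sum_le_coeffBound C (α := α) (Finset.prod_nonneg fun _ _ => B.maj_nonneg _ _)
    (Real.exp_pos _).le (fun k hk => ?_) (fun k hk => B.abs_mode_le (hs k hk) α x)
  have h0 := B.freq_nonneg k
  rw [pow_one, abs_mul, abs_mul, abs_neg, abs_of_nonneg h0, Real.abs_exp, mul_assoc]
  gcongr
  · linarith
  · exact hδ k hk

lemma abs_mul_dwave_le (i : Fin d) {t : ℝ} (ht : 0 ≤ t) (x : Fin d → ℝ) (α : Option (Fin d)) :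
    |S.p i (x i) ^ 2 * S.w i (x i) * B.dwave s C i t x α| ≤ B.coeffBound s C *
      (B.vmaj M i (x i) * ∏ j ∈ Finset.univ.erase i, B.maj M j (x j)) := by
  have h := B.abs_sum_le_coeffBound C (α := α) (η := 1)
    (c := fun k => C α k * Real.exp (-B.freq k * t))
    (mul_nonneg (B.vmaj_nonneg _ _) (Finset.prod_nonneg fun _ _ => B.maj_nonneg _ _)) zero_le_one
    (fun k _ => ?_) (fun k hk => B.abs_mul_dmode_le (hs k hk) i α x)
  · rw [mul_one] at h
    refine le_of_eq_of_le ?_ h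
    rw [dwave, Finset.mul_sum]
    congr 1
    exact Finset.sum_congr rfl fun k _ => by ring
  · rw [abs_mul, mul_one, Real.abs_exp]
    gcongr
    linarith [B.exp_neg_freq_le_one k ht, B.freq_nonneg k]

variable {P : ℝ}

/-- Both bounds are uniform in `ε ≤ 1`. The first is integrable over `X`. The second isolates the
`i`-th variable, whose factor tends to `0` along the boundary sequences, from an integrable product
in the other variables. -/
lemma exists_abs_pair_wave_le (hP : 1 ≤ P) (Z H : Finset (Option (Fin d))) :
    ∃ A : ℝ, 0 ≤ A ∧ ∃ N : ℕ, ∀ ε, 0 < ε → ε ≤ 1 → ∀ t, 0 ≤ t → ∀ x : Fin d → ℝ,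
      (∀ δ, (∀ k ∈ s, δ ≤ B.freq k) →
        |Bellman.pair P ε Z H (B.wave s C 0 t x) (B.wave s C 1 t x)| ≤
          A * Real.exp (-δ * t) * ∏ i, B.weight M N i (x i)) ∧
      ∀ i, |S.p i (x i) ^ 2 * S.w i (x i) *
        Bellman.pair P ε Z H (B.wave s C 0 t x) (B.dwave s C i t x)| ≤
          A * ((1 + B.maj M i (x i) ^ (N + 1)) * B.vmaj M i (x i)) *
            ∏ j ∈ Finset.univ.erase i, B.weight M N j (x j) := by
  obtain ⟨A, hA, N, h⟩ := Bellman.exists_abs_pair_le hP Z H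
  set c := B.coeffBound s C with hc
  have hc0 : 0 ≤ c := B.coeffBound_nonneg s C
  refine ⟨A * (2 ^ N * (1 + c ^ (N + 1))) * c, by positivity, N, fun ε hε hε1 t ht x => ?_⟩
  have hmaj : 0 ≤ ∏ i, B.maj M i (x i) := Finset.prod_nonneg fun _ _ => B.maj_nonneg _ _
  set R := 1 + c * ∏ i, B.maj M i (x i) with hR
  have hR1 : 1 ≤ R := le_add_of_nonneg_right (by positivity)
  have hRN : R ^ N ≤ 2 ^ N * (1 + c ^ (N + 1)) * ∏ i, (1 + B.maj M i (x i) ^ (N + 1)) :=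
    (pow_le_pow_right₀ hR1 (Nat.le_succ N)).trans
      (one_add_mul_prod_pow_le hc0 _ (fun i _ => B.maj_nonneg _ _) N)
  have hU : ∀ α, |B.wave s C 0 t x α| ≤ R := fun α =>
    (B.abs_wave_zero_le C hs ht x α).trans (by linarith)
  constructor
  · intro δ hδ
    have h1 := h ε hε hε1 _ _ R (c * Real.exp (-δ * t) * ∏ i, B.maj M i (x i)) hR1 hU
      (by positivity) (B.abs_wave_one_le C hs hδ ht x)
    refine h1.trans ?_
    calc _ ≤ A * (2 ^ N * (1 + c ^ (N + 1)) * ∏ i, (1 + B.maj M i (x i) ^ (N + 1))) *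
          (c * Real.exp (-δ * t) * ∏ i, B.maj M i (x i)) := by gcongr
      _ = A * (2 ^ N * (1 + c ^ (N + 1))) * c * Real.exp (-δ * t) *
          ((∏ i, B.maj M i (x i)) * ∏ i, (1 + B.maj M i (x i) ^ (N + 1))) := by ring
      _ = _ := by rw [← Finset.prod_mul_distrib]; rfl
  · intro i
    have hv := B.vmaj_nonneg (M := M) i (x i)
    have he : 0 ≤ ∏ j ∈ Finset.univ.erase i, B.maj M j (x j) :=
      Finset.prod_nonneg fun _ _ => B.maj_nonneg _ _
    have h1 := h ε hε hε1 _ _ R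
      (c * (B.vmaj M i (x i) * ∏ j ∈ Finset.univ.erase i, B.maj M j (x j))) hR1 hU
      (by positivity) (B.abs_mul_dwave_le C hs i ht x)
    rw [← Bellman.pair_const_mul]
    refine h1.trans ?_
    calc _ ≤ A * (2 ^ N * (1 + c ^ (N + 1)) * ∏ i, (1 + B.maj M i (x i) ^ (N + 1))) *
          (c * (B.vmaj M i (x i) * ∏ j ∈ Finset.univ.erase i, B.maj M j (x j))) := by gcongr
      _ = A * (2 ^ N * (1 + c ^ (N + 1))) * c *
          ((1 + B.maj M i (x i) ^ (N + 1)) * B.vmaj M i (x i)) *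
          ((∏ j ∈ Finset.univ.erase i, B.maj M j (x j)) *
            ∏ j ∈ Finset.univ.erase i, (1 + B.maj M j (x j) ^ (N + 1))) := by
          rw [← Finset.mul_prod_erase _ _ (Finset.mem_univ i)]; ring
      _ = _ := by rw [← Finset.prod_mul_distrib]; rfl

end EigenSystem

namespace EigenSystem

variable {d : ℕ} {S : ProductSetting d} {B : EigenSystem S}

lemma T3.integrable_maj_pow (hT3 : B.T3) (M N : ℕ) (i : Fin d) :
    Integrable (fun y => B.maj M i y ^ (N + 1)) (S.mu1 i) := by
  have h1 : Integrable (B.maj M i) (S.mu1 i) := integrable_finsetSum _ fun z _ => by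
    simpa using hT3.integrable_pow_Y z.2 i z.1 1 le_rfl
  have h2 : Integrable (fun y => ((Finset.range M ×ˢ (Finset.univ : Finset Bool)).card : ℝ) ^ N *
      ∑ z ∈ Finset.range M ×ˢ (Finset.univ : Finset Bool), |B.Y z.2 i z.1 y| ^ (N + 1))
      (S.mu1 i) :=
    (integrable_finsetSum _ fun z _ => hT3.integrable_pow_Y z.2 i z.1 (N + 1) (by omega)).const_mul _
  refine h2.mono' (h1.aestronglyMeasurable.pow _) (ae_of_all _ fun y => ?_)
  rw [Real.norm_of_nonneg (pow_nonneg (B.maj_nonneg i y) _)]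
  exact B.maj_pow_le i N y

lemma T3.integrable_weight (hT3 : B.T3) (M N : ℕ) (i : Fin d) :
    Integrable (B.weight M N i) (S.mu1 i) := by
  refine ((hT3.integrable_maj_pow M 0 i).add (hT3.integrable_maj_pow M (N + 1) i)).congr
    (ae_of_all _ fun y => ?_)
  simp only [weight, Pi.add_apply]
  ring

/-- The sequences of boxes that exhaust `X` such that the boundary terms vanish in the limit. -/
theorem exists_boxes (hA1 : S.A1) {K : ℝ} (hK : 0 ≤ K) (hA2 : S.A2 K) (hT2 : B.T2) (hT3 : B.T3)
    (M N : ℕ) : ∃ x : Bool → ℕ → Fin d → ℝ, (∀ e n i, x e n i ∈ S.X i) ∧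
      (∀ n i, x false n i < x true n i) ∧
      (∀ y ∈ S.dom, ∀ᶠ n in atTop, ∀ i, x false n i ≤ y i ∧ y i ≤ x true n i) ∧
      ∀ e i, Tendsto (fun n => (1 + B.maj M i (x e n i) ^ (N + 1)) * B.vmaj M i (x e n i))
        atTop (𝓝 0) := by
  choose x h1 h2 h3 h4 h5 using fun i => exists_seqs hA1 hK hA2 hT2 hT3 i M (N + 1) (by omega)
  refine ⟨fun e n i => x i e n, fun e n i => h1 i e n, fun n i => h2 i n, fun y hy => ?_,
    fun e i => ?_⟩
  · refine eventually_all.2 fun i => ?_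
    filter_upwards [h3 i (y i) (hy i)] with n hn
    exact ⟨hn.1.le, hn.2.le⟩
  · have hv : Tendsto (fun n => B.vmaj M i (x i e n)) atTop (𝓝 0) := by
      have := tendsto_finsetSum (Finset.range M ×ˢ (Finset.univ : Finset Bool))
        fun z _ => h4 i e z.2 z.1
      simpa [vmaj] using this
    have hm : Tendsto (fun n => ((Finset.range M ×ˢ (Finset.univ : Finset Bool)).card : ℝ) ^ N *
        ∑ z ∈ Finset.range M ×ˢ (Finset.univ : Finset Bool),
        ∑ z' ∈ Finset.range M ×ˢ (Finset.univ : Finset Bool),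
          |B.Y z.2 i z.1 (x i e n)| ^ (N + 1) *
          |S.p i (x i e n) ^ 2 * S.w i (x i e n) * deriv (B.Y z'.2 i z'.1) (x i e n)|)
        atTop (𝓝 0) := by
      have := (tendsto_finsetSum (Finset.range M ×ˢ (Finset.univ : Finset Bool)) fun z hz =>
        tendsto_finsetSum (Finset.range M ×ˢ (Finset.univ : Finset Bool)) fun z' hz' =>
          h5 i e z.2 z'.2 z.1 (by simpa using hz) z'.1 (by simpa using hz')).const_mul
            (((Finset.range M ×ˢ (Finset.univ : Finset Bool)).card : ℝ) ^ N)
      simpa using this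
    have := hv.add hm
    rw [add_zero] at this
    refine squeeze_zero (fun n => mul_nonneg (add_nonneg zero_le_one
      (pow_nonneg (B.maj_nonneg _ _) _)) (B.vmaj_nonneg _ _)) (fun n => ?_) this
    rw [add_mul, one_mul]
    refine add_le_add_right ?_ _
    rw [← Finset.sum_mul_sum, ← mul_assoc]
    exact mul_le_mul_of_nonneg_right (B.maj_pow_le i N _) (B.vmaj_nonneg _ _)

end EigenSystem

/-! ### Integration over boxes -/

namespace ProductSetting

variable {d : ℕ} (S : ProductSetting d)

lemma isFiniteMeasure_mu1_restrict {i : Fin d} {a b : ℝ} (h : Set.Icc a b ⊆ S.X i) :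
    IsFiniteMeasure ((S.mu1 i).restrict (Set.Icc a b)) := by
  have hw : IntegrableOn (S.w i) (Set.Icc a b) :=
    ((S.w_smooth i).continuousOn.mono h).integrableOn_Icc
  rw [mu1, restrict_withDensity measurableSet_Icc, Measure.restrict_restrict measurableSet_Icc,
    Set.inter_eq_left.2 h]
  exact isFiniteMeasure_withDensity_ofReal hw.2

lemma mu_restrict_Icc (a b : Fin d → ℝ) : S.mu.restrict (Set.Icc a b) =
    Measure.pi fun i => (S.mu1 i).restrict (Set.Icc (a i) (b i)) := by
  rw [← Set.pi_univ_Icc, mu, Measure.restrict_pi_pi]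

lemma Icc_subset_dom_iff {a b : Fin d → ℝ} (h : ∀ i, Set.Icc (a i) (b i) ⊆ S.X i) :
    Set.Icc a b ⊆ S.dom := fun _ hx i => h i ⟨hx.1 i, hx.2 i⟩

lemma mu_Icc_ne_top {a b : Fin d → ℝ} (h : ∀ i, Set.Icc (a i) (b i) ⊆ S.X i) :
    S.mu (Set.Icc a b) ≠ ∞ := by
  have := fun i => S.isFiniteMeasure_mu1_restrict (h i)
  have h1 : IsFiniteMeasure (S.mu.restrict (Set.Icc a b)) := by
    rw [mu_restrict_Icc]; infer_instance
  have h2 := measure_ne_top (S.mu.restrict (Set.Icc a b)) Set.univ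
  rwa [Measure.restrict_apply_univ] at h2

lemma integrableOn_mu_Icc {a b : Fin d → ℝ} (h : ∀ i, Set.Icc (a i) (b i) ⊆ S.X i)
    {g : (Fin d → ℝ) → ℝ} (hg : ContinuousOn g (Set.Icc a b)) :
    IntegrableOn g (Set.Icc a b) S.mu :=
  hg.integrableOn_of_subset_isCompact isCompact_Icc measurableSet_Icc subset_rfl
    (S.mu_Icc_ne_top h)

lemma integrableOn_prod_Icc {a b : Fin d → ℝ} (h : ∀ i, Set.Icc (a i) (b i) ⊆ S.X i) {T : ℝ}
    {g : (Fin d → ℝ) × ℝ → ℝ} (hg : ContinuousOn g (Set.Icc a b ×ˢ Set.Icc 0 T)) :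
    IntegrableOn g (Set.Icc a b ×ˢ Set.Ioc 0 T) (S.mu.prod volume) := by
  refine hg.integrableOn_of_subset_isCompact (isCompact_Icc.prod isCompact_Icc)
    (measurableSet_Icc.prod measurableSet_Ioc)
    (Set.prod_mono subset_rfl Set.Ioc_subset_Icc_self) ?_
  rw [Measure.prod_prod]
  exact ENNReal.mul_ne_top (S.mu_Icc_ne_top h) measure_Ioc_lt_top.ne

lemma prod_erase_eq_prod_succAbove {n : ℕ} (i : Fin (n + 1)) (F : Fin (n + 1) → ℝ) :
    ∏ j ∈ Finset.univ.erase i, F j = ∏ j, F (i.succAbove j) := by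
  rw [← Finset.compl_singleton, ← Fin.image_succAbove_univ,
    Finset.prod_image fun _ _ _ _ h => Fin.succAbove_right_injective h]

/-- Integrating in the `i`-th variable first, the fundamental theorem of calculus leaves the flux on
two opposite faces. Its product bound lets the remaining variables be integrated over their full
range, which makes the estimate independent of the other sides of the box. -/
lemma abs_setIntegral_succ_le {n : ℕ} (S : ProductSetting (n + 1)) (i : Fin (n + 1))
    {a b : Fin (n + 1) → ℝ} (hab : a ≤ b) (h : ∀ i, Set.Icc (a i) (b i) ⊆ S.X i)
    {f g : (Fin (n + 1) → ℝ) → ℝ} (hg : ContinuousOn g (Set.Icc a b))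
    (hf : ∀ x ∈ Set.Icc a b,
      HasDerivAt (fun y => f (Function.update x i y)) (S.w i (x i) * g x) (x i))
    {κ : Fin (n + 1) → ℝ → ℝ} {θ : ℝ → ℝ} (hκ : ∀ j y, 0 ≤ κ j y)
    (hκi : ∀ j, Integrable (κ j) (S.mu1 j)) (hθ : ∀ y, 0 ≤ θ y)
    (hfb : ∀ x ∈ Set.Icc a b, |f x| ≤ θ (x i) * ∏ j, κ (i.succAbove j) (x (i.succAbove j))) :
    |∫ x in Set.Icc a b, g x ∂S.mu| ≤
      (θ (a i) + θ (b i)) * ∏ j, ∫ y, κ (i.succAbove j) y ∂S.mu1 (i.succAbove j) := by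
  set ν := fun i => (S.mu1 i).restrict (Set.Icc (a i) (b i)) with hν
  have hmp := (measurePreserving_piFinSuccAbove ν i).symm
  have hgi := S.integrableOn_mu_Icc h hg
  rw [IntegrableOn, mu_restrict_Icc] at hgi
  have hgi' : Integrable (fun z => g ((MeasurableEquiv.piFinSuccAbove (fun _ => ℝ) i).symm z))
      ((ν i).prod (Measure.pi fun j => ν (i.succAbove j))) :=
    (hmp.integrable_comp_emb (MeasurableEquiv.measurableEmbedding _)).2 hgi
  have hmem : ∀ᵐ z ∂(Measure.pi fun j => ν (i.succAbove j)),
      ∀ j, z j ∈ Set.Icc (a (i.succAbove j)) (b (i.succAbove j)) :=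
    eventually_all.2 fun j => Measure.tendsto_eval_ae_ae.eventually
      (ae_restrict_mem measurableSet_Icc)
  have hins : ∀ z : Fin n → ℝ, (∀ j, z j ∈ Set.Icc (a (i.succAbove j)) (b (i.succAbove j))) →
      ∀ y ∈ Set.Icc (a i) (b i), i.insertNth (α := fun _ => ℝ) y z ∈ Set.Icc a b := by
    intro z hz y hy
    rw [← Set.pi_univ_Icc, Set.mem_univ_pi]
    intro k
    rcases Fin.eq_self_or_eq_succAbove i k with rfl | ⟨j, rfl⟩
    · simpa using hy
    · simpa using hz j
  have hinner : ∀ z : Fin n → ℝ, (∀ j, z j ∈ Set.Icc (a (i.succAbove j)) (b (i.succAbove j))) →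
      |∫ y, g (i.insertNth (α := fun _ => ℝ) y z) ∂ν i| ≤
        (θ (a i) + θ (b i)) * ∏ j, κ (i.succAbove j) (z j) := by
    intro z hz
    have hins' := hins z hz
    have hcont : ContinuousOn (fun y => S.w i y * g (i.insertNth (α := fun _ => ℝ) y z))
        (Set.Icc (a i) (b i)) := by
      refine ((S.w_smooth i).continuousOn.mono (h i)).mul (hg.comp ?_ hins')
      have : Continuous fun y : ℝ => i.insertNth (α := fun _ => ℝ) y z :=
        Continuous.finInsertNth i continuous_id continuous_const
      exact this.continuousOn
    have hder : ∀ y ∈ Set.uIcc (a i) (b i),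
        HasDerivAt (fun y => f (i.insertNth (α := fun _ => ℝ) y z))
          (S.w i y * g (i.insertNth (α := fun _ => ℝ) y z)) y := by
      intro y hy
      rw [Set.uIcc_of_le (hab i)] at hy
      have := hf _ (hins' y hy)
      simpa only [Fin.update_insertNth, Fin.insertNth_apply_same] using this
    have e1 : ∫ y, g (i.insertNth (α := fun _ => ℝ) y z) ∂ν i =
        f (i.insertNth (α := fun _ => ℝ) (b i) z) - f (i.insertNth (α := fun _ => ℝ) (a i) z) := by
      rw [hν, S.integral_mu1_restrict i _ measurableSet_Icc (h i), integral_Icc_eq_integral_Ioc,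
        ← intervalIntegral.integral_of_le (hab i),
        intervalIntegral.integral_eq_sub_of_hasDerivAt hder]
      rw [← Set.uIcc_of_le (hab i)] at hcont
      exact hcont.intervalIntegrable
    have ha := hfb _ (hins' (a i) (Set.left_mem_Icc.2 (hab i)))
    have hb := hfb _ (hins' (b i) (Set.right_mem_Icc.2 (hab i)))
    simp only [Fin.insertNth_apply_same, Fin.insertNth_apply_succAbove] at ha hb
    rw [e1]
    refine (abs_sub _ _).trans ?_
    linarith
  have hκν : ∀ j, Integrable (κ j) (ν j) := fun j => (hκi j).restrict
  rw [mu_restrict_Icc, ← hmp.integral_comp (MeasurableEquiv.measurableEmbedding _)]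
  rw [integral_prod_symm _ hgi']
  have hθ0 : 0 ≤ θ (a i) + θ (b i) := add_nonneg (hθ _) (hθ _)
  calc _ ≤ ∫ z, (θ (a i) + θ (b i)) * ∏ j, κ (i.succAbove j) (z j)
        ∂(Measure.pi fun j => ν (i.succAbove j)) := by
        rw [← Real.norm_eq_abs]
        refine norm_integral_le_of_norm_le
          ((Integrable.fintype_prod fun j => hκν (i.succAbove j)).const_mul _) ?_
        filter_upwards [hmem] with z hz
        exact hinner z hz
    _ = (θ (a i) + θ (b i)) * ∏ j, ∫ y, κ (i.succAbove j) y ∂ν (i.succAbove j) := by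
        rw [integral_const_mul, integral_fintype_prod_eq_prod (fun j => κ (i.succAbove j))]
    _ ≤ _ := by
        refine mul_le_mul_of_nonneg_left (Finset.prod_le_prod
          (fun j _ => integral_nonneg fun y => hκ _ _) fun j _ => ?_) hθ0
        exact setIntegral_le_integral (hκi _) (ae_of_all _ fun y => hκ _ _)

/-- The divergence theorem on a box. -/
lemma abs_setIntegral_le (i : Fin d)
    {a b : Fin d → ℝ} (hab : a ≤ b) (h : ∀ i, Set.Icc (a i) (b i) ⊆ S.X i)
    {f g : (Fin d → ℝ) → ℝ} (hg : ContinuousOn g (Set.Icc a b))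
    (hf : ∀ x ∈ Set.Icc a b,
      HasDerivAt (fun y => f (Function.update x i y)) (S.w i (x i) * g x) (x i))
    {κ : Fin d → ℝ → ℝ} {θ : ℝ → ℝ} (hκ : ∀ j y, 0 ≤ κ j y)
    (hκi : ∀ j, Integrable (κ j) (S.mu1 j)) (hθ : ∀ y, 0 ≤ θ y)
    (hfb : ∀ x ∈ Set.Icc a b, |f x| ≤ θ (x i) * ∏ j ∈ Finset.univ.erase i, κ j (x j)) :
    |∫ x in Set.Icc a b, g x ∂S.mu| ≤
      (θ (a i) + θ (b i)) * ∏ j ∈ Finset.univ.erase i, ∫ y, κ j y ∂S.mu1 j := by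
  obtain - | n := d
  · exact i.elim0
  · rw [prod_erase_eq_prod_succAbove]
    refine S.abs_setIntegral_succ_le i hab h hg hf hκ hκi hθ fun x hx => (hfb x hx).trans_eq ?_
    rw [prod_erase_eq_prod_succAbove]

end ProductSetting

/-! ### The bilinear estimate on a box, with boundary terms -/

namespace EigenSystem

variable {d : ℕ} {S : ProductSetting d} (B : EigenSystem S) (s : Finset (Fin d → ℕ))
  (C : Option (Fin d) → (Fin d → ℕ) → ℝ) {P ε : ℝ} {Z H : Finset (Option (Fin d))}

/-- `t b' - b` is a primitive of `t b''`. Because of the weight `t`, no derivative of `b` appears at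
`t = 0`. -/
lemma integral_mul_accel (hP : 1 ≤ P) (hε : 0 < ε) {x : Fin d → ℝ} (hx : x ∈ S.dom) {T : ℝ}
    (hT : 0 ≤ T) : ∫ t in Set.Ioc 0 T, t * B.accel s C P ε Z H t x =
      T * Bellman.pair P ε Z H (B.wave s C 0 T x) (B.wave s C 1 T x) -
        Bellman.bell P ε Z H (B.wave s C 0 T x) + Bellman.bell P ε Z H (B.wave s C 0 0 x) := by
  have hc : Continuous fun t => t * B.accel s C P ε Z H t x :=
    continuous_id.mul ((B.continuousOn_accel (P := P) (Z := Z) (H := H) s C hε).comp_continuous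
      (f := fun t : ℝ => (x, t)) (by fun_prop) fun t => ⟨hx, trivial⟩)
  have hd : ∀ t ∈ Set.uIcc 0 T, HasDerivAt (fun t => t * Bellman.pair P ε Z H (B.wave s C 0 t x)
      (B.wave s C 1 t x) - Bellman.bell P ε Z H (B.wave s C 0 t x))
      (t * B.accel s C P ε Z H t x) t := by
    intro t _
    have h1 := (hasDerivAt_id' t).fun_mul (B.hasDerivAt_pair_wave (Z := Z) (H := H) s C hP hε t x)
    have h2 := B.hasDerivAt_bell_wave (Z := Z) (H := H) s C hP hε t x
    refine (h1.fun_sub h2).congr_deriv ?_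
    ring
  rw [← intervalIntegral.integral_of_le hT,
    intervalIntegral.integral_eq_sub_of_hasDerivAt hd (hc.intervalIntegrable _ _)]
  ring

lemma continuousOn_theta : ContinuousOn (fun z : (Fin d → ℝ) × ℝ =>
    B.theta s C z.2 z.1) (S.dom ×ˢ Set.univ) := by
  unfold theta
  refine (continuousOn_finsetSum _ fun j _ => .mul (.add (.mul ?_ ?_) (.mul ?_ ?_)) ?_).neg
  · exact (S.p_smooth j).continuousOn.comp (by fun_prop : Continuous fun z : (Fin d → ℝ) × ℝ =>
      z.1 j).continuousOn fun z hz => hz.1 j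
  · exact B.continuousOn_dwave s C j none
  · exact (S.q_smooth j).continuousOn.comp (by fun_prop : Continuous fun z : (Fin d → ℝ) × ℝ =>
      z.1 j).continuousOn fun z hz => hz.1 j
  · exact B.continuousOn_wave s C 0 none
  · exact B.continuousOn_wave s C 1 (some j)

lemma integrableOn_prod_mul {a b : Fin d → ℝ} (h : ∀ i, Set.Icc (a i) (b i) ⊆ S.X i) {T : ℝ}
    {g : (Fin d → ℝ) × ℝ → ℝ} (hg : ContinuousOn g (S.dom ×ˢ Set.univ)) :
    IntegrableOn (fun z => z.2 * g z) (Set.Icc a b ×ˢ Set.Ioc 0 T) (S.mu.prod volume) :=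
  S.integrableOn_prod_Icc h (continuousOn_snd.mul
    (hg.mono (Set.prod_mono (S.Icc_subset_dom_iff h) (Set.subset_univ _))))

/-- The bilinear estimate on a box, with boundary terms. -/
lemma two_mul_integral_theta_le (hP : 1 ≤ P) (hε : 0 < ε) (hZH : Roles Z H) (hA1 : S.A1) {K : ℝ}
    (hK : 0 ≤ K) (hA2 : S.A2 K) {a b : Fin d → ℝ} (h : ∀ i, Set.Icc (a i) (b i) ⊆ S.X i) {T : ℝ}
    (hT : 0 ≤ T) {β : Fin d → ℝ} (hβ : ∀ i, ∀ t, 0 ≤ t →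
      |∫ x in Set.Icc a b, B.diverg s C P ε Z H i t x ∂S.mu| ≤ β i) :
    2 * ∫ z in Set.Icc a b ×ˢ Set.Ioc 0 T, z.2 * B.theta s C z.2 z.1 ∂(S.mu.prod volume) ≤
      (1 + √K) * (T * ∫ x in Set.Icc a b,
          |Bellman.pair P ε Z H (B.wave s C 0 T x) (B.wave s C 1 T x)| ∂S.mu +
        ∫ x in Set.Icc a b, Bellman.bell P ε Z H (B.wave s C 0 0 x) ∂S.mu +
        ∑ i, T ^ 2 * β i) := by
  have hd := S.Icc_subset_dom_iff h
  have hθ := integrableOn_prod_mul h (T := T) (B.continuousOn_theta s C)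
  have h0 := integrableOn_prod_mul h (T := T) (B.continuousOn_accel (Z := Z) (H := H) (P := P) s C hε)
  have h1 := fun i => integrableOn_prod_mul h (T := T)
    (B.continuousOn_diverg (Z := Z) (H := H) (P := P) s C hε i)
  have hslice : ∀ {g : (Fin d → ℝ) × ℝ → ℝ} (t : ℝ), ContinuousOn g (S.dom ×ˢ Set.univ) →
      ContinuousOn (fun x => g (x, t)) (Set.Icc a b) := fun t hg =>
    hg.comp (by fun_prop) fun x hx => ⟨hd hx, trivial⟩
  have e0 : ∫ z in Set.Icc a b ×ˢ Set.Ioc 0 T, z.2 * B.accel s C P ε Z H z.2 z.1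
      ∂(S.mu.prod volume) ≤ T * ∫ x in Set.Icc a b,
          |Bellman.pair P ε Z H (B.wave s C 0 T x) (B.wave s C 1 T x)| ∂S.mu +
        ∫ x in Set.Icc a b, Bellman.bell P ε Z H (B.wave s C 0 0 x) ∂S.mu := by
    have i1 := S.integrableOn_mu_Icc h (hslice T (B.continuousOn_pair_wave (Z := Z) (H := H)
      (P := P) s C hε))
    have i2 := fun t => S.integrableOn_mu_Icc h (hslice t (B.continuousOn_bell_wave (Z := Z)
      (H := H) (P := P) s C hε))
    rw [setIntegral_prod _ h0, ← integral_const_mul,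
      ← integral_add (i1.abs.const_mul T) (i2 0)]
    rw [setIntegral_congr_fun measurableSet_Icc fun x hx =>
      B.integral_mul_accel s C hP hε (hd hx) hT]
    refine setIntegral_mono_on (((i1.const_mul T).sub (i2 T)).add (i2 0))
      ((i1.abs.const_mul T).add (i2 0)) measurableSet_Icc fun x hx => ?_
    -- The value at time `T` enters with a favourable sign and is dropped.
    have := Bellman.bell_nonneg (Z := Z) (H := H) hP hε (B.wave s C 0 T x)
    have := mul_le_mul_of_nonneg_left
      (le_abs_self (Bellman.pair P ε Z H (B.wave s C 0 T x) (B.wave s C 1 T x))) hT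
    linarith
  have e1 : ∀ i, ∫ z in Set.Icc a b ×ˢ Set.Ioc 0 T, z.2 * B.diverg s C P ε Z H i z.2 z.1
      ∂(S.mu.prod volume) ≤ T ^ 2 * β i := by
    intro i
    have h1i := h1 i
    rw [IntegrableOn, ← Measure.prod_restrict] at h1i
    rw [← Measure.prod_restrict, integral_prod_symm _ h1i]
    refine (le_abs_self _).trans ?_
    rw [← Real.norm_eq_abs]
    have := norm_setIntegral_le_of_norm_le_const (μ := volume) (s := Set.Ioc 0 T) (C := T * β i)
      (f := fun t => ∫ x in Set.Icc a b, t * B.diverg s C P ε Z H i t x ∂S.mu)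
      measure_Ioc_lt_top fun t ht => by
        rw [integral_const_mul, norm_mul, Real.norm_eq_abs, Real.norm_eq_abs, abs_of_pos ht.1]
        exact mul_le_mul ht.2 (hβ i t ht.1.le) (abs_nonneg _) hT
    refine this.trans_eq ?_
    rw [Real.volume_real_Ioc_of_le hT]
    ring
  rw [← integral_const_mul]
  calc _ ≤ ∫ z in Set.Icc a b ×ˢ Set.Ioc 0 T, (1 + √K) * (z.2 * B.accel s C P ε Z H z.2 z.1 +
        ∑ i, z.2 * B.diverg s C P ε Z H i z.2 z.1) ∂(S.mu.prod volume) := by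
        refine setIntegral_mono_on (hθ.const_mul 2)
          ((h0.add (integrable_finsetSum _ fun i _ => h1 i)).const_mul _)
          (measurableSet_Icc.prod measurableSet_Ioc) fun z hz => ?_
        have h2 := B.two_mul_abs_theta_le s C hP hε hZH hA1 hK hA2 (hd hz.1) z.2
        have h3 : 0 ≤ z.2 := hz.2.1.le
        rw [← Finset.mul_sum, ← mul_add, mul_left_comm, mul_left_comm _ z.2]
        refine mul_le_mul_of_nonneg_left (le_trans ?_ h2) h3
        have := le_abs_self (B.theta s C z.2 z.1)
        linarith
    _ = (1 + √K) * (∫ z in Set.Icc a b ×ˢ Set.Ioc 0 T, z.2 * B.accel s C P ε Z H z.2 z.1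
          ∂(S.mu.prod volume) + ∑ i, ∫ z in Set.Icc a b ×ˢ Set.Ioc 0 T,
          z.2 * B.diverg s C P ε Z H i z.2 z.1 ∂(S.mu.prod volume)) := by
        rw [integral_const_mul, integral_add h0 (integrable_finsetSum _ fun i _ => h1 i),
          integral_finsetSum _ fun i _ => h1 i]
    _ ≤ _ := by
        gcongr with i
        exact e1 i

end EigenSystem

/-! ### Removal of the regularisation and exhaustion of `X` -/

namespace Bellman

variable {ι : Type*} {P ε : ℝ} {Z H : Finset ι}

/-- The size condition on the Bellman function. -/
def energy (P ε : ℝ) (Z H : Finset ι) (U : ι → ℝ) : ℝ :=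
  D P * (sqLen ε Z U ^ P / (2 * P) + sqLen ε H U ^ conj P / (2 * conj P))

lemma sqLen_nonneg (U : ι → ℝ) : 0 ≤ sqLen ε Z U :=
  add_nonneg (sq_nonneg _) (Finset.sum_nonneg fun _ _ => sq_nonneg _)

lemma energy_nonneg (hP : 1 ≤ P) (U : ι → ℝ) : 0 ≤ energy P ε Z H U := by
  have hQ := half_lt_conj hP
  have hD := twelve_le_D hP
  have h1 := Real.rpow_nonneg (sqLen_nonneg (ε := ε) (Z := Z) U) P
  have h2 := Real.rpow_nonneg (sqLen_nonneg (ε := ε) (Z := H) U) (conj P)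
  unfold energy
  positivity

lemma energy_mono (hP : 1 ≤ P) {η : ℝ} (hε : 0 ≤ ε) (h : ε ≤ η) (U : ι → ℝ) :
    energy P ε Z H U ≤ energy P η Z H U := by
  have hQ := half_lt_conj hP
  have hD := twelve_le_D hP
  have hs : ∀ Z : Finset ι, sqLen ε Z U ≤ sqLen η Z U := fun Z => by
    unfold sqLen; gcongr
  have h1 := hs Z
  have h2 := hs H
  have h3 := sqLen_nonneg (ε := ε) (Z := Z) U
  have h4 := sqLen_nonneg (ε := ε) (Z := H) U
  unfold energy
  gcongr

lemma tendsto_energy (hP : 1 ≤ P) (U : ι → ℝ) :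
    Tendsto (fun ε => energy P ε Z H U) (𝓝 0) (𝓝 (energy P 0 Z H U)) := by
  have hQ := half_lt_conj hP
  have hs : ∀ Z : Finset ι, Continuous fun ε => sqLen ε Z U := fun Z => by
    unfold sqLen; fun_prop
  have h1 := (hs Z).rpow_const (p := P) fun _ => Or.inr (by linarith)
  have h2 := (hs H).rpow_const (p := conj P) fun _ => Or.inr (by linarith)
  have : Continuous fun ε => energy P ε Z H U := by
    unfold energy; fun_prop
  exact this.tendsto 0

lemma continuousOn_energy (hP : 1 ≤ P) {X : Type*} [TopologicalSpace X] {s : Set X} {U : X → ι → ℝ}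
    (hU : ∀ α, ContinuousOn (fun z => U z α) s) :
    ContinuousOn (fun z => energy P ε Z H (U z)) s := by
  have hQ := half_lt_conj hP
  have h1 := (continuousOn_sqLen (ε := ε) (Z := Z) hU).rpow_const (p := P)
    fun _ _ => Or.inr (by linarith)
  have h2 := (continuousOn_sqLen (ε := ε) (Z := H) hU).rpow_const (p := conj P)
    fun _ _ => Or.inr (by linarith)
  unfold energy
  fun_prop

end Bellman

lemma integrable_sum_sq_rpow {X ι : Type*} [MeasurableSpace X] {μ : Measure X} (Z : Finset ι)
    {u : ι → X → ℝ} {r : ℝ} (hr : 0 < r) (hu : ∀ α, MemLp (u α) (ENNReal.ofReal (2 * r)) μ) :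
    Integrable (fun x => (∑ α ∈ Z, u α x ^ 2) ^ r) μ := by
  have h1 : MemLp (fun x => (WithLp.toLp 2 fun α : Z => u α x : EuclideanSpace ℝ Z))
      (ENNReal.ofReal (2 * r)) μ := by
    have : Fact (1 ≤ (2 : ℝ≥0∞)) := ⟨one_le_two⟩
    exact memLp_piLp_iff.2 fun α => hu α
  have h2 := h1.integrable_norm_rpow (by simpa using hr) ENNReal.ofReal_ne_top
  refine h2.congr (ae_of_all _ fun x => ?_)
  simp only
  rw [EuclideanSpace.norm_eq, ENNReal.toReal_ofReal (by positivity), Real.sqrt_eq_rpow,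
    ← Real.rpow_mul (Finset.sum_nonneg fun _ _ => sq_nonneg _),
    ← Finset.sum_coe_sort Z fun α => u α x ^ 2]
  simp only [Real.norm_eq_abs, sq_abs]
  congr 1
  ring

/-- `∫₀^T t e^{-ct} dt`. -/
lemma tendsto_integral_mul_exp {c : ℝ} (hc : 0 < c) :
    Tendsto (fun T => ∫ t in Set.Ioc 0 T, t * Real.exp (-c * t)) atTop (𝓝 (1 / c ^ 2)) := by
  have h1 : Tendsto (fun T : ℝ => T * Real.exp (-c * T)) atTop (𝓝 0) := by
    have := (Real.tendsto_pow_mul_exp_neg_atTop_nhds_zero 1).comp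
      (tendsto_id.const_mul_atTop hc)
    have := this.const_mul (1 / c)
    rw [mul_zero] at this
    refine this.congr fun T => ?_
    simp only [Function.comp_apply, id, pow_one]
    field_simp
  have h2 : Tendsto (fun T : ℝ => Real.exp (-c * T)) atTop (𝓝 0) := by
    refine Real.tendsto_exp_atBot.comp ?_
    exact tendsto_id.const_mul_atTop_of_neg (neg_neg_of_pos hc)
  have h3 : ∀ T : ℝ, 0 ≤ T → ∫ t in Set.Ioc 0 T, t * Real.exp (-c * t) =
      1 / c ^ 2 - (1 / c * (T * Real.exp (-c * T)) + 1 / c ^ 2 * Real.exp (-c * T)) := by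
    intro T hT
    have hd : ∀ t ∈ Set.uIcc 0 T, HasDerivAt (fun t => -(1 / c * (t * Real.exp (-c * t)) +
        1 / c ^ 2 * Real.exp (-c * t))) (t * Real.exp (-c * t)) t := by
      intro t _
      have he : HasDerivAt (fun t => Real.exp (-c * t)) (Real.exp (-c * t) * (-c * 1)) t :=
        ((hasDerivAt_id' t).const_mul (-c)).exp
      refine ((((hasDerivAt_id' t).fun_mul he).const_mul (1 / c)).fun_add
        (he.const_mul (1 / c ^ 2))).fun_neg.congr_deriv ?_
      field_simp
      ring
    rw [← intervalIntegral.integral_of_le hT, intervalIntegral.integral_eq_sub_of_hasDerivAt hd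
      ((by fun_prop : Continuous fun t => t * Real.exp (-c * t)).intervalIntegrable _ _)]
    simp only [mul_zero, Real.exp_zero, zero_mul]
    ring
  have h4 := (tendsto_const_nhds (x := 1 / c ^ 2)).sub
    ((h1.const_mul (1 / c)).add (h2.const_mul (1 / c ^ 2)))
  simp only [mul_zero, add_zero, sub_zero] at h4
  refine h4.congr' ?_
  filter_upwards [eventually_ge_atTop 0] with T hT
  exact (h3 T hT).symm

namespace EigenSystem

variable {d : ℕ} {S : ProductSetting d} (B : EigenSystem S) (s : Finset (Fin d → ℕ))
  (C : Option (Fin d) → (Fin d → ℕ) → ℝ) {P ε : ℝ} {Z H : Finset (Option (Fin d))}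

lemma mode_some_eq (j : Fin d) (k : Fin d → ℕ) (x : Fin d → ℝ) : B.mode (some j) k x =
    S.p j (x j) * B.dmode j none k x + S.q j (x j) * B.mode none k x := by
  have h : ∏ i ∈ Finset.univ.erase j, B.Y (decide (some j = some i)) i (k i) (x i) =
      ∏ i ∈ Finset.univ.erase j, B.Y (decide ((none : Option (Fin d)) = some i)) i (k i) (x i) :=
    Finset.prod_congr rfl fun i hi => by simp [(Finset.ne_of_mem_erase hi).symm]
  have h2 := B.p_mul_deriv_Y_false (i := j) (n := k j) (x := x j)
  rw [mode, dmode, mode, ← Finset.mul_prod_erase _ _ (Finset.mem_univ j), h,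
    ← Finset.mul_prod_erase Finset.univ _ (Finset.mem_univ j)]
  simp only [reduceCtorEq, decide_true, decide_false]
  linear_combination
    (-∏ i ∈ Finset.univ.erase j, B.Y false i (k i) (x i)) * h2

/-- `p_j ∂_j + q_j` turns `φ_k` into `δ_j φ_k`, so for each `j` both factors are expanded in the
same orthogonal family. -/
lemma theta_eq (t : ℝ) (x : Fin d → ℝ) : B.theta s C t x = ∑ j, ∑ k ∈ s, ∑ l ∈ s,
    C none k * (C (some j) l * B.freq l) *
      (B.mode (some j) k x * B.mode (some j) l x * Real.exp (-(B.freq k + B.freq l) * t)) := by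
  unfold theta
  rw [← Finset.sum_neg_distrib]
  refine Finset.sum_congr rfl fun j _ => ?_
  have h : S.p j (x j) * B.dwave s C j t x none + S.q j (x j) * B.wave s C 0 t x none =
      ∑ k ∈ s, C none k * Real.exp (-B.freq k * t) * B.mode (some j) k x := by
    unfold dwave wave
    rw [Finset.mul_sum, Finset.mul_sum, ← Finset.sum_add_distrib]
    refine Finset.sum_congr rfl fun k _ => ?_
    rw [mode_some_eq]
    ring
  rw [h, wave, Finset.sum_mul_sum, ← Finset.sum_neg_distrib]
  refine Finset.sum_congr rfl fun k _ => ?_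
  rw [← Finset.sum_neg_distrib]
  refine Finset.sum_congr rfl fun l _ => ?_
  rw [show -(B.freq k + B.freq l) * t = -B.freq k * t + -B.freq l * t by ring, Real.exp_add]
  ring

lemma integral_theta {a b : Fin d → ℝ} (h : ∀ i, Set.Icc (a i) (b i) ⊆ S.X i) (T : ℝ) :
    ∫ z in Set.Icc a b ×ˢ Set.Ioc 0 T, z.2 * B.theta s C z.2 z.1 ∂(S.mu.prod volume) =
      ∑ j, ∑ k ∈ s, ∑ l ∈ s, C none k * (C (some j) l * B.freq l) *
        ((∫ x in Set.Icc a b, B.mode (some j) k x * B.mode (some j) l x ∂S.mu) *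
          ∫ t in Set.Ioc 0 T, t * Real.exp (-(B.freq k + B.freq l) * t)) := by
  have e : ∀ z : (Fin d → ℝ) × ℝ, z.2 * B.theta s C z.2 z.1 = ∑ j, ∑ k ∈ s, ∑ l ∈ s,
      C none k * (C (some j) l * B.freq l) * ((B.mode (some j) k z.1 * B.mode (some j) l z.1) *
        (z.2 * Real.exp (-(B.freq k + B.freq l) * z.2))) := by
    intro z
    rw [theta_eq]
    simp only [Finset.mul_sum]
    refine Finset.sum_congr rfl fun j _ => Finset.sum_congr rfl fun k _ =>
      Finset.sum_congr rfl fun l _ => by ring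
  have hi : ∀ j k l, IntegrableOn (fun z : (Fin d → ℝ) × ℝ =>
      C none k * (C (some j) l * B.freq l) * ((B.mode (some j) k z.1 * B.mode (some j) l z.1) *
        (z.2 * Real.exp (-(B.freq k + B.freq l) * z.2)))) (Set.Icc a b ×ˢ Set.Ioc 0 T)
      (S.mu.prod volume) := by
    intro j k l
    refine S.integrableOn_prod_Icc h (continuousOn_const.mul (.mul ?_ (by fun_prop)))
    have hm := fun k => ((B.continuousOn_mode (some j) k).mono (S.Icc_subset_dom_iff h)).comp
      (continuousOn_fst (s := Set.Icc a b ×ˢ Set.Icc 0 T)) fun z hz => hz.1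
    exact (hm k).mul (hm l)
  simp only [e]
  rw [integral_finsetSum _ fun j _ => integrable_finsetSum _ fun k _ =>
    integrable_finsetSum _ fun l _ => hi j k l]
  refine Finset.sum_congr rfl fun j _ => ?_
  rw [integral_finsetSum _ fun k _ => integrable_finsetSum _ fun l _ => hi j k l]
  refine Finset.sum_congr rfl fun k _ => ?_
  rw [integral_finsetSum _ fun l _ => hi j k l]
  refine Finset.sum_congr rfl fun l _ => ?_
  rw [integral_const_mul, setIntegral_prod_mul
    (fun x => B.mode (some j) k x * B.mode (some j) l x)
    (fun t => t * Real.exp (-(B.freq k + B.freq l) * t))]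

lemma T3.memLp_wave {B : EigenSystem S} (hT3 : B.T3) (n : ℕ) (t : ℝ) (α : Option (Fin d))
    {p : ℝ≥0∞} (hp1 : 1 ≤ p) (hp : p ≠ ∞) : MemLp (fun x => B.wave s C n t x α) p S.mu :=
  memLp_finsetSum _ fun k _ => (hT3.memLp_mode α k hp1 hp).const_mul _

lemma T3.integrable_energy {B : EigenSystem S} (hT3 : B.T3) (hP : 1 ≤ P) :
    Integrable (fun x => Bellman.energy P 0 Z H (B.wave s C 0 0 x)) S.mu := by
  have hQ := Bellman.half_lt_conj hP
  have h : ∀ (r : ℝ) (Z : Finset (Option (Fin d))), 1 ≤ 2 * r → Integrable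
      (fun x => Bellman.sqLen 0 Z (B.wave s C 0 0 x) ^ r) S.mu := by
    intro r Z hr
    have := integrable_sum_sq_rpow (μ := S.mu) Z (r := r) (by linarith)
      fun α => hT3.memLp_wave s C 0 0 α (p := ENNReal.ofReal (2 * r)) (ENNReal.one_le_ofReal.2 hr)
        ENNReal.ofReal_ne_top
    refine this.congr (ae_of_all _ fun x => ?_)
    simp [Bellman.sqLen]
  exact (((h P Z (by linarith)).div_const _).add ((h _ H (by linarith)).div_const _)).const_mul _

variable {B} in
/-- The bilinear estimate on `X × (0, T)`. -/
theorem two_mul_sum_le_of_time (hA1 : S.A1) {K : ℝ} (hK : 0 ≤ K) (hA2 : S.A2 K) (hT2 : B.T2)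
    (hT3 : B.T3) (hP : 1 ≤ P) (hZH : Roles Z H) {δ : ℝ} (hδ : ∀ k ∈ s, δ ≤ B.freq k) :
    ∃ A : ℝ, ∀ T, 0 ≤ T → 2 * (∑ j, ∑ k ∈ s, ∑ l ∈ s, C none k * (C (some j) l * B.freq l) *
        ((∫ x, B.mode (some j) k x * B.mode (some j) l x ∂S.mu) *
          ∫ t in Set.Ioc 0 T, t * Real.exp (-(B.freq k + B.freq l) * t))) ≤
      (1 + √K) * (A * (T * Real.exp (-δ * T)) +
        ∫ x, Bellman.energy P 0 Z H (B.wave s C 0 0 x) ∂S.mu) := by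
  set M := ∑ k ∈ s, ∑ i, (k i + 1) with hM
  have hs : ∀ k ∈ s, ∀ i, k i < M := fun k hk i => by
    have h1 : k i + 1 ≤ ∑ i, (k i + 1) :=
      Finset.single_le_sum (f := fun i => k i + 1) (fun _ _ => Nat.zero_le _) (Finset.mem_univ i)
    have h2 : ∑ i, (k i + 1) ≤ M :=
      Finset.single_le_sum (f := fun k : Fin d → ℕ => ∑ i, (k i + 1)) (fun _ _ => Nat.zero_le _) hk
    omega
  obtain ⟨A, hA, N, hAN⟩ := B.exists_abs_pair_wave_le C hs hP Z H
  obtain ⟨x, hx, hlt, hev, hlim⟩ := exists_boxes hA1 hK hA2 hT2 hT3 M N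
  have hbox : ∀ n i, Set.Icc (x false n i) (x true n i) ⊆ S.X i := fun n i =>
    ordConnected_openInterval.out (hx _ _ _) (hx _ _ _)
  have hdom := fun n => S.Icc_subset_dom_iff (hbox n)
  have hle : ∀ n, x false n ≤ x true n := fun n i => (hlt n i).le
  have hcover : AECover S.mu atTop fun n => Set.Icc (x false n) (x true n) := by
    refine ⟨?_, fun n => measurableSet_Icc⟩
    filter_upwards [S.ae_mem] with y hy
    filter_upwards [hev y hy] with n hn
    exact ⟨fun i => (hn i).1, fun i => (hn i).2⟩
  set W := ∫ y, ∏ i, B.weight M N i (y i) ∂S.mu with hW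
  have hWint : Integrable (fun y : Fin d → ℝ => ∏ i, B.weight M N i (y i)) S.mu :=
    Integrable.fintype_prod fun i => hT3.integrable_weight M N i
  have hW0 : ∀ y : Fin d → ℝ, 0 ≤ ∏ i, B.weight M N i (y i) := fun y =>
    Finset.prod_nonneg fun _ _ => B.weight_nonneg _ _ _
  set θ : Fin d → ℝ → ℝ := fun i y => (1 + B.maj M i y ^ (N + 1)) * B.vmaj M i y with hθdef
  have hθ0 : ∀ i y, 0 ≤ θ i y := fun i y => mul_nonneg (add_nonneg zero_le_one
      (pow_nonneg (B.maj_nonneg _ _) _)) (B.vmaj_nonneg _ _)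
  set β : ℕ → Fin d → ℝ := fun n i => (A * θ i (x false n i) + A * θ i (x true n i)) *
    ∏ j ∈ Finset.univ.erase i, ∫ y, B.weight M N j y ∂S.mu1 j with hβdef
  have hβlim : ∀ i, Tendsto (fun n => β n i) atTop (𝓝 0) := by
    intro i
    have := (((hlim false i).const_mul A).add ((hlim true i).const_mul A)).mul_const
      (∏ j ∈ Finset.univ.erase i, ∫ y, B.weight M N j y ∂S.mu1 j)
    simpa using this
  have hmode : ∀ n α, ContinuousOn (fun x => B.wave s C 0 n x α) S.dom := fun n α =>
    (B.continuousOn_wave s C 0 α).comp (f := fun y => (y, n)) (by fun_prop) fun y hy => ⟨hy, trivial⟩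
  have hE := hT3.integrable_energy (Z := Z) (H := H) s C hP
  refine ⟨A * W, fun T hT => ?_⟩
  have step1 : ∀ n, ∀ ε, 0 < ε → ε ≤ 1 → 2 * (∑ j, ∑ k ∈ s, ∑ l ∈ s,
        C none k * (C (some j) l * B.freq l) *
        ((∫ y in Set.Icc (x false n) (x true n), B.mode (some j) k y * B.mode (some j) l y ∂S.mu) *
          ∫ t in Set.Ioc 0 T, t * Real.exp (-(B.freq k + B.freq l) * t))) ≤
      (1 + √K) * (T * (A * Real.exp (-δ * T) * W) +
        ∫ y in Set.Icc (x false n) (x true n), Bellman.energy P ε Z H (B.wave s C 0 0 y) ∂S.mu +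
        ∑ i, T ^ 2 * β n i) := by
    intro n ε hε hε1
    have hdiv : ∀ i, ∀ t, 0 ≤ t → |∫ y in Set.Icc (x false n) (x true n),
        B.diverg s C P ε Z H i t y ∂S.mu| ≤ β n i := by
      intro i t ht
      refine S.abs_setIntegral_le i (hle n) (hbox n) (θ := fun y => A * θ i y)
        (f := fun y => S.p i (y i) ^ 2 * S.w i (y i) *
          Bellman.pair P ε Z H (B.wave s C 0 t y) (B.dwave s C i t y))
        ?_ (fun y hy => ?_) (fun j y => B.weight_nonneg N j y)
        (fun j => hT3.integrable_weight M N j) (fun y => mul_nonneg hA (hθ0 i y)) fun y hy => ?_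
      · exact (B.continuousOn_diverg (P := P) (Z := Z) (H := H) s C hε i).comp
          (f := fun y => (y, t)) (by fun_prop) fun y hy => ⟨hdom n hy, trivial⟩
      · have := B.hasDerivAt_flux (Z := Z) (H := H) s C hP hε i t (hdom n hy i)
        simpa only [Function.update_self] using this
      · exact (hAN ε hε hε1 t ht y).2 i
    have h1 := B.two_mul_integral_theta_le s C hP hε hZH hA1 hK hA2 (hbox n) hT hdiv
    rw [B.integral_theta s C (hbox n)] at h1
    refine h1.trans ?_
    have h2 : ∫ y in Set.Icc (x false n) (x true n),
        |Bellman.pair P ε Z H (B.wave s C 0 T y) (B.wave s C 1 T y)| ∂S.mu ≤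
        A * Real.exp (-δ * T) * W := by
      rw [hW, ← integral_const_mul]
      refine (setIntegral_mono_on ?_ (hWint.const_mul _).restrict measurableSet_Icc fun y hy =>
        (hAN ε hε hε1 T hT y).1 δ hδ).trans (setIntegral_le_integral (hWint.const_mul _)
          (ae_of_all _ fun y => mul_nonneg (mul_nonneg hA (Real.exp_pos _).le) (hW0 y)))
      refine (S.integrableOn_mu_Icc (hbox n) ?_).abs
      exact (B.continuousOn_pair_wave (P := P) (Z := Z) (H := H) s C hε).comp
          (f := fun y => (y, T)) (by fun_prop) fun y hy => ⟨hdom n hy, trivial⟩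
    have h3 : ∫ y in Set.Icc (x false n) (x true n), Bellman.bell P ε Z H (B.wave s C 0 0 y) ∂S.mu ≤
        ∫ y in Set.Icc (x false n) (x true n),
          Bellman.energy P ε Z H (B.wave s C 0 0 y) ∂S.mu := by
      refine setIntegral_mono_on (S.integrableOn_mu_Icc (hbox n) ?_)
        (S.integrableOn_mu_Icc (hbox n) ?_) measurableSet_Icc fun y _ => Bellman.bell_le hP hε _
      · exact (Bellman.continuousOn_bell hε (hmode 0)).mono (hdom n)
      · exact (Bellman.continuousOn_energy hP (hmode 0)).mono (hdom n)
    gcongr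
  -- The limit `ε → 0` precedes the exhaustion of `X`: the majorant at `ε = 1` is integrable over a
  -- box, but need not be over `X`, whose measure may be infinite.
  have step2 : ∀ n, 2 * (∑ j, ∑ k ∈ s, ∑ l ∈ s,
        C none k * (C (some j) l * B.freq l) *
        ((∫ y in Set.Icc (x false n) (x true n), B.mode (some j) k y * B.mode (some j) l y ∂S.mu) *
          ∫ t in Set.Ioc 0 T, t * Real.exp (-(B.freq k + B.freq l) * t))) ≤
      (1 + √K) * (T * (A * Real.exp (-δ * T) * W) +
        ∫ y, Bellman.energy P 0 Z H (B.wave s C 0 0 y) ∂S.mu + ∑ i, T ^ 2 * β n i) := by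
    intro n
    have hlim : Tendsto (fun m : ℕ => ∫ y in Set.Icc (x false n) (x true n),
        Bellman.energy P (1 / ((m : ℝ) + 1)) Z H (B.wave s C 0 0 y) ∂S.mu) atTop
        (𝓝 (∫ y in Set.Icc (x false n) (x true n),
          Bellman.energy P 0 Z H (B.wave s C 0 0 y) ∂S.mu)) := by
      have hint := fun ε => S.integrableOn_mu_Icc (hbox n)
        ((Bellman.continuousOn_energy (ε := ε) (Z := Z) (H := H) hP (hmode 0)).mono (hdom n))
      refine tendsto_integral_of_dominated_convergence
        (fun y => Bellman.energy P 1 Z H (B.wave s C 0 0 y)) (fun m => (hint _).1) (hint 1)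
        (fun m => ae_of_all _ fun y => ?_) (ae_of_all _ fun y => ?_)
      · rw [Real.norm_of_nonneg (Bellman.energy_nonneg hP _)]
        refine Bellman.energy_mono hP (by positivity) ?_ _
        rw [div_le_one (by positivity)]
        have : (0 : ℝ) ≤ m := by positivity
        linarith
      · exact (Bellman.tendsto_energy hP _).comp tendsto_one_div_add_atTop_nhds_zero_nat
    have h1 := ge_of_tendsto' ((((tendsto_const_nhds (x := T * (A * Real.exp (-δ * T) * W))).add
      hlim).add_const (∑ i, T ^ 2 * β n i)).const_mul (1 + √K)) fun m : ℕ =>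
        step1 n (1 / ((m : ℝ) + 1)) (by positivity) (by
          rw [div_le_one (by positivity)]
          have : (0 : ℝ) ≤ m := by positivity
          linarith)
    refine h1.trans ?_
    gcongr
    · exact ae_of_all _ fun y => Bellman.energy_nonneg hP _
    · exact Measure.restrict_le_self
  have hL : Tendsto (fun n => 2 * (∑ j, ∑ k ∈ s, ∑ l ∈ s,
        C none k * (C (some j) l * B.freq l) *
        ((∫ y in Set.Icc (x false n) (x true n), B.mode (some j) k y * B.mode (some j) l y ∂S.mu) *
          ∫ t in Set.Ioc 0 T, t * Real.exp (-(B.freq k + B.freq l) * t)))) atTop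
      (𝓝 (2 * (∑ j, ∑ k ∈ s, ∑ l ∈ s, C none k * (C (some j) l * B.freq l) *
        ((∫ x, B.mode (some j) k x * B.mode (some j) l x ∂S.mu) *
          ∫ t in Set.Ioc 0 T, t * Real.exp (-(B.freq k + B.freq l) * t))))) := by
    refine Tendsto.const_mul _ (tendsto_finsetSum _ fun j _ => tendsto_finsetSum _ fun k _ =>
      tendsto_finsetSum _ fun l _ => Tendsto.const_mul _ (Tendsto.mul_const _ ?_))
    exact hcover.integral_tendsto_of_countably_generated
      ((hT3.memLp_mode (some j) k (p := 2) one_le_two ENNReal.ofNat_ne_top).integrable_mul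
        (hT3.memLp_mode (some j) l (p := 2) one_le_two ENNReal.ofNat_ne_top))
  have hR : Tendsto (fun n => (1 + √K) * (T * (A * Real.exp (-δ * T) * W) +
        ∫ y, Bellman.energy P 0 Z H (B.wave s C 0 0 y) ∂S.mu + ∑ i, T ^ 2 * β n i)) atTop
      (𝓝 ((1 + √K) * (T * (A * Real.exp (-δ * T) * W) +
        ∫ y, Bellman.energy P 0 Z H (B.wave s C 0 0 y) ∂S.mu + 0))) := by
    refine Tendsto.const_mul _ (tendsto_const_nhds.add ?_)
    simpa using tendsto_finsetSum Finset.univ fun i _ => (hβlim i).const_mul (T ^ 2)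
  refine (le_of_tendsto_of_tendsto' hL hR step2).trans_eq ?_
  ring

end EigenSystem

/-! ### Orthogonality, the limit `T → ∞`, and the bilinear estimate -/

namespace EigenSystem

variable {d : ℕ} {S : ProductSetting d} (B : EigenSystem S)

/-- For the functions `δ_i φ`, (T1) and the eigenvalue equation reduce the claim to the
orthogonality of the `φ`. -/
lemma integral_Y_mul_Y (hT1 : B.T1) (b : Bool) (i : Fin d) {k l : ℕ} (hkl : k ≠ l) :
    ∫ x, B.Y b i k x * B.Y b i l x ∂S.mu1 i = 0 := by
  cases b
  · simpa [Y, hkl] using B.orthonormal i k l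
  · have h1 := (hT1 i).2 k l
    have h2 : ∫ x, S.delta1Star i (S.delta1 i (B.phi1 i k)) x * B.phi1 i l x ∂S.mu1 i =
        ∫ x, (B.ev1 i k - S.a i) * (B.phi1 i k x * B.phi1 i l x) ∂S.mu1 i := by
      refine integral_congr_ae ?_
      filter_upwards [S.ae_mem_X i] with x hx
      rw [B.delta1Star_delta1 hx]
      ring
    rw [h2, integral_const_mul, B.orthonormal, if_neg hkl, mul_zero] at h1
    exact h1

/-- The functions `φₖ`, and the functions `δⱼφₖ` for fixed `j`, are orthogonal. -/
lemma integral_mode_mul_mode (hT1 : B.T1) (α : Option (Fin d)) {k l : Fin d → ℕ} (hkl : k ≠ l) :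
    ∫ x, B.mode α k x * B.mode α l x ∂S.mu = 0 := by
  obtain ⟨i, hi⟩ := Function.ne_iff.1 hkl
  simp only [mode, ← Finset.prod_mul_distrib]
  rw [ProductSetting.mu, integral_fintype_prod_eq_prod
    (fun i y => B.Y (decide (α = some i)) i (k i) y * B.Y (decide (α = some i)) i (l i) y)]
  exact Finset.prod_eq_zero (Finset.mem_univ i) (B.integral_Y_mul_Y hT1 _ i hi)

lemma integral_phi_sq (k : Fin d → ℕ) : ∫ x, B.mode none k x * B.mode none k x ∂S.mu = 1 := by
  simp only [mode, ← Finset.prod_mul_distrib]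
  rw [ProductSetting.mu, integral_fintype_prod_eq_prod
    (fun i y => B.Y (decide (none = some i)) i (k i) y * B.Y (decide (none = some i)) i (k i) y)]
  refine Finset.prod_eq_one fun i _ => ?_
  simpa [Y] using B.orthonormal i (k i) (k i)

/-- `‖δⱼφₖ‖²`. -/
def gram (j : Fin d) (k : Fin d → ℕ) : ℝ := ∫ x, B.mode (some j) k x * B.mode (some j) k x ∂S.mu

lemma ev_pos {k : Fin d → ℕ} (hk : k ∈ B.indexSet) : 0 < B.ev k := by
  have hle : ∀ i, B.ev1 i 0 ≤ B.ev1 i (k i) := fun i => (B.ev1_strictMono i).monotone (Nat.zero_le _)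
  rcases hk with h | h
  · exact h.trans_le (Finset.sum_le_sum fun i _ => hle i)
  · obtain ⟨i, hi⟩ := Function.ne_iff.1 h
    refine Finset.sum_pos' (fun i _ => B.ev1_nonneg i _) ⟨i, Finset.mem_univ i, ?_⟩
    exact (B.ev1_nonneg i 0).trans_lt (B.ev1_strictMono i (Nat.pos_of_ne_zero hi))

lemma freq_pos {k : Fin d → ℕ} (hk : k ∈ B.indexSet) : 0 < B.freq k :=
  Real.sqrt_pos.2 (B.ev_pos hk)

variable {B} {P : ℝ} {Z H : Finset (Option (Fin d))}

lemma sum_gram_le (hA1 : S.A1) {K : ℝ} (hK : 0 ≤ K) (hA2 : S.A2 K) (hT1 : B.T1) (hT2 : B.T2)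
    (hT3 : B.T3) (hP : 1 ≤ P) (hZH : Roles Z H) {s : Finset (Fin d → ℕ)}
    (hs : ∀ k ∈ s, k ∈ B.indexSet) (C : Option (Fin d) → (Fin d → ℕ) → ℝ) :
    ∑ j, ∑ k ∈ s, C none k * C (some j) k * ((B.freq k)⁻¹ * B.gram j k) ≤
      2 * (1 + √K) * ∫ x, Bellman.energy P 0 Z H (B.wave s C 0 0 x) ∂S.mu := by
  obtain ⟨δ, hδ0, hδ⟩ : ∃ δ > 0, ∀ k ∈ s, δ ≤ B.freq k := by
    rcases s.eq_empty_or_nonempty with rfl | hne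
    · exact ⟨1, one_pos, by simp⟩
    · obtain ⟨k, hk, hmin⟩ := s.exists_min_image B.freq hne
      exact ⟨B.freq k, B.freq_pos (hs k hk), hmin⟩
  obtain ⟨A, hA⟩ := two_mul_sum_le_of_time s C hA1 hK hA2 hT2 hT3 hP hZH hδ
  have hexp : Tendsto (fun T : ℝ => T * Real.exp (-δ * T)) atTop (𝓝 0) := by
    have := ((Real.tendsto_pow_mul_exp_neg_atTop_nhds_zero 1).comp
      (tendsto_id.const_mul_atTop hδ0)).const_mul (1 / δ)
    rw [mul_zero] at this
    refine this.congr fun T => ?_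
    simp only [Function.comp_apply, id, pow_one]
    field_simp
  have hL : Tendsto (fun T => 2 * (∑ j, ∑ k ∈ s, ∑ l ∈ s, C none k * (C (some j) l * B.freq l) *
        ((∫ x, B.mode (some j) k x * B.mode (some j) l x ∂S.mu) *
          ∫ t in Set.Ioc 0 T, t * Real.exp (-(B.freq k + B.freq l) * t)))) atTop
      (𝓝 (2 * (∑ j, ∑ k ∈ s, ∑ l ∈ s, C none k * (C (some j) l * B.freq l) *
        ((∫ x, B.mode (some j) k x * B.mode (some j) l x ∂S.mu) *
          (1 / (B.freq k + B.freq l) ^ 2))))) :=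
    Tendsto.const_mul _ (tendsto_finsetSum _ fun j _ => tendsto_finsetSum _ fun k hk =>
      tendsto_finsetSum _ fun l hl => Tendsto.const_mul _ (Tendsto.const_mul _
        (tendsto_integral_mul_exp (add_pos (B.freq_pos (hs k hk)) (B.freq_pos (hs l hl))))))
  have hR := ((hexp.const_mul A).add_const
    (∫ x, Bellman.energy P 0 Z H (B.wave s C 0 0 x) ∂S.mu)).const_mul (1 + √K)
  have h := le_of_tendsto_of_tendsto hL hR (by
    filter_upwards [eventually_ge_atTop 0] with T hT
    exact hA T hT)
  -- Only `l = k` survives, and there `freq / (2 freq)² = 1 / (4 freq)`. This `1/4`, with the `2` in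
  -- front, yields the factor `2 (1 + √K)`.
  have e : ∑ j, ∑ k ∈ s, ∑ l ∈ s, C none k * (C (some j) l * B.freq l) *
        ((∫ x, B.mode (some j) k x * B.mode (some j) l x ∂S.mu) *
          (1 / (B.freq k + B.freq l) ^ 2)) =
      1 / 4 * ∑ j, ∑ k ∈ s, C none k * C (some j) k * ((B.freq k)⁻¹ * B.gram j k) := by
    rw [Finset.mul_sum]
    refine Finset.sum_congr rfl fun j _ => ?_
    rw [Finset.mul_sum]
    refine Finset.sum_congr rfl fun k hk => ?_
    rw [Finset.sum_eq_single k (fun l _ hl => by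
      rw [B.integral_mode_mul_mode hT1 _ hl.symm]; ring) (fun h => absurd hk h), ← gram]
    have := (B.freq_pos (hs k hk)).ne'
    field_simp
    ring
  rw [e] at h
  linarith

lemma wave_zero_zero (s : Finset (Fin d → ℕ)) (C : Option (Fin d) → (Fin d → ℕ) → ℝ)
    (x : Fin d → ℝ) (α : Option (Fin d)) :
    B.wave s C 0 0 x α = ∑ k ∈ s, C α k * B.mode α k x := by
  simp [wave]

/-- The bilinear estimate, in additive form. -/
theorem sum_gram_le_add (hA1 : S.A1) {K : ℝ} (hK : 0 ≤ K) (hA2 : S.A2 K) (hT1 : B.T1) (hT2 : B.T2)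
    (hT3 : B.T3) {p q : ℝ} (hpq : p.HolderConjugate q) {s : Finset (Fin d → ℕ)}
    (hs : ∀ k ∈ s, k ∈ B.indexSet) (c : (Fin d → ℕ) → ℝ) (e : Fin d → (Fin d → ℕ) → ℝ) :
    ∑ j, ∑ k ∈ s, c k * e j k * ((B.freq k)⁻¹ * B.gram j k) ≤
      24 * (1 + √K) * (max p q - 1) *
        ((∫ x, |∑ k ∈ s, c k * B.mode none k x| ^ p ∂S.mu) / p +
          (∫ x, ‖(WithLp.toLp 2 fun j => ∑ k ∈ s, e j k * B.mode (some j) k x :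
            EuclideanSpace ℝ (Fin d))‖ ^ q ∂S.mu) / q) := by
  set C : Option (Fin d) → (Fin d → ℕ) → ℝ := fun α => α.elim c e with hC
  have hp1 := hpq.lt
  have hq1 := hpq.symm.lt
  have hmul : p * q = p + q := hpq.mul_eq_add
  have hZ : ∀ x, Bellman.sqLen 0 {none} (B.wave s C 0 0 x) = |∑ k ∈ s, c k * B.mode none k x| ^ 2 := by
    intro x
    simp [Bellman.sqLen, wave_zero_zero, hC, sq_abs]
  have hH : ∀ x, Bellman.sqLen 0 (Finset.univ.map Function.Embedding.some) (B.wave s C 0 0 x) =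
      ‖(WithLp.toLp 2 fun j => ∑ k ∈ s, e j k * B.mode (some j) k x :
            EuclideanSpace ℝ (Fin d))‖ ^ 2 := by
    intro x
    rw [EuclideanSpace.norm_sq_eq]
    simp [Bellman.sqLen, wave_zero_zero, hC]
  have hpow : ∀ {a r : ℝ}, 0 ≤ a → (a ^ 2) ^ (r / 2) = a ^ r := by
    intro a r ha
    rw [← Real.rpow_natCast, ← Real.rpow_mul ha]
    congr 1
    push_cast
    ring
  have hconj : ∀ {p q : ℝ}, 1 < p → p * q = p + q → Bellman.conj (p / 2) = q / 2 := by
    intro p q hp h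
    unfold Bellman.conj
    rw [div_eq_iff (by linarith)]
    linear_combination -h / 2
  have hint : ∀ (α : Finset (Option (Fin d))) (r : ℝ), 1 < r →
      Integrable (fun x => Bellman.sqLen 0 α (B.wave s C 0 0 x) ^ (r / 2)) S.mu := by
    intro α r hr
    refine (integrable_sum_sq_rpow α (r := r / 2) (by linarith) fun β =>
      hT3.memLp_wave s C 0 0 β (p := ENNReal.ofReal (2 * (r / 2)))
        (ENNReal.one_le_ofReal.2 (by linarith)) ENNReal.ofReal_ne_top).congr
        (ae_of_all _ fun x => ?_)
    simp [Bellman.sqLen]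
  have hI1 := hint {none} p hp1
  have hI2 := hint (Finset.univ.map Function.Embedding.some) q hq1
  simp only [hZ] at hI1
  simp only [hH] at hI2
  simp only [hpow (abs_nonneg _)] at hI1
  simp only [hpow (norm_nonneg _)] at hI2
  have key : ∀ P Z H, 1 ≤ P → Roles Z H → (∀ x, Bellman.energy P 0 Z H (B.wave s C 0 0 x) =
      12 * (max p q - 1) * (|∑ k ∈ s, c k * B.mode none k x| ^ p / p +
        ‖(WithLp.toLp 2 fun j => ∑ k ∈ s, e j k * B.mode (some j) k x :
            EuclideanSpace ℝ (Fin d))‖ ^ q / q)) →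
      ∑ j, ∑ k ∈ s, c k * e j k * ((B.freq k)⁻¹ * B.gram j k) ≤
      24 * (1 + √K) * (max p q - 1) *
        ((∫ x, |∑ k ∈ s, c k * B.mode none k x| ^ p ∂S.mu) / p +
          (∫ x, ‖(WithLp.toLp 2 fun j => ∑ k ∈ s, e j k * B.mode (some j) k x :
            EuclideanSpace ℝ (Fin d))‖ ^ q ∂S.mu) / q) := by
    intro P Z H hP hZH hen
    have h := sum_gram_le hA1 hK hA2 hT1 hT2 hT3 hP hZH hs C
    simp only [hen] at h
    rw [integral_const_mul, integral_add (hI1.div_const p) (hI2.div_const q), integral_div,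
      integral_div] at h
    refine h.trans_eq ?_
    ring
  -- The Bellman function requires the first exponent `2P` to be at least `2`, so `2P = max p q`; if
  -- `p ≤ 2`, the vector `g` takes the first group. Then `D P = 12 (max p q - 1)`, and the factor
  -- `2` from `sum_gram_le` makes it `24`.
  rcases le_total 2 p with h2 | h2
  · have hqp : q ≤ p := by nlinarith
    refine key (p / 2) {none} (Finset.univ.map Function.Embedding.some) (by linarith)
      (Or.inl ⟨rfl, rfl⟩) fun x => ?_
    rw [Bellman.energy, hconj hp1 hmul, hZ, hH, hpow (abs_nonneg _), hpow (norm_nonneg _),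
      max_eq_left hqp, Bellman.D, mul_div_cancel₀ p two_ne_zero, mul_div_cancel₀ q two_ne_zero]
  · have hqp : p ≤ q := by nlinarith
    have h2q : 2 ≤ q := by nlinarith
    refine key (q / 2) (Finset.univ.map Function.Embedding.some) {none} (by linarith)
      (Or.inr ⟨rfl, rfl⟩) fun x => ?_
    rw [Bellman.energy, hconj (q := p) hq1 (by linarith), hZ, hH, hpow (abs_nonneg _), hpow (norm_nonneg _),
      max_eq_right hqp, Bellman.D, mul_div_cancel₀ p two_ne_zero, mul_div_cancel₀ q two_ne_zero]
    ring

end EigenSystem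

/-! ### Duality, `L²` expansions and density in `L^p` -/

section duality

variable {α E : Type*} [MeasurableSpace α] {μ : Measure α} [NormedAddCommGroup E]
  [InnerProductSpace ℝ E] {p q : ℝ≥0∞} [Fact (1 ≤ p)] [Fact (1 ≤ q)] [ENNReal.HolderConjugate p q]

/-- The pairing of `L^p` with `L^q`. -/
def innerPairing : Lp E p μ →L[ℝ] Lp E q μ →L[ℝ] ℝ :=
  ContinuousLinearMap.lpPairing μ p q (innerSL ℝ)

lemma innerPairing_apply (f : Lp E p μ) (g : Lp E q μ) :
    innerPairing f g = ∫ x, inner ℝ (f x) (g x) ∂μ := by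
  rw [innerPairing, ContinuousLinearMap.lpPairing_eq_integral]; rfl

omit [InnerProductSpace ℝ E] [Fact (1 ≤ q)] [ENNReal.HolderConjugate p q] in
lemma Lp_norm_rpow (hp : p ≠ ∞) (f : Lp E p μ) :
    ‖f‖ ^ p.toReal = ∫ x, ‖f x‖ ^ p.toReal ∂μ := by
  have h0 : p ≠ 0 := (zero_lt_one.trans_le (Fact.out : 1 ≤ p)).ne'
  have hI : 0 ≤ ∫ x, ‖f x‖ ^ p.toReal ∂μ := integral_nonneg fun x => by positivity
  rw [Lp.norm_def, (Lp.memLp f).eLpNorm_eq_integral_rpow_norm h0 hp,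
    ENNReal.toReal_ofReal (by positivity), Real.rpow_inv_rpow hI (ENNReal.toReal_pos h0 hp).ne']

/-- The test function is `‖h‖^(p - 2) h`, for which Hölder's inequality is an equality. -/
lemma norm_le_of_forall_innerPairing_le (hp : p ≠ ∞) (hq : q ≠ ∞) (h : Lp E p μ) {C : ℝ}
    (hC : 0 ≤ C) (H : ∀ g : Lp E q μ, |innerPairing h g| ≤ C * ‖g‖) : ‖h‖ ≤ C := by
  have hp0 : p ≠ 0 := (zero_lt_one.trans_le (Fact.out : 1 ≤ p)).ne'
  have hq0 : q ≠ 0 := (zero_lt_one.trans_le (Fact.out : 1 ≤ q)).ne'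
  have hpr := ENNReal.toReal_pos hp0 hp
  have hqr := ENNReal.toReal_pos hq0 hq
  have hpq : p.toReal.HolderConjugate q.toReal :=
    Real.holderConjugate_iff.2 ⟨by
      rw [← ENNReal.toReal_one, ENNReal.toReal_lt_toReal ENNReal.one_ne_top hp]
      exact (ENNReal.HolderConjugate.lt_top_iff_one_lt q p).1 hq.lt_top, by
      rw [← ENNReal.toReal_inv, ← ENNReal.toReal_inv, ← ENNReal.toReal_add
        (ENNReal.inv_ne_top.2 hp0) (ENNReal.inv_ne_top.2 hq0),
        ENNReal.HolderConjugate.inv_add_inv_eq_one, ENNReal.toReal_one]⟩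
  rcases eq_or_ne h 0 with rfl | hne
  · simpa using hC
  have hnorm : ∀ x : E, ‖‖x‖ ^ (p.toReal - 2) • x‖ = ‖x‖ ^ (p.toReal - 1) := by
    intro x
    rcases eq_or_ne x 0 with rfl | hx
    · rw [smul_zero, norm_zero, Real.zero_rpow (by linarith [hpq.lt])]
    · have h0 := norm_pos_iff.2 hx
      rw [norm_smul, Real.norm_of_nonneg (by positivity), ← Real.rpow_add_one h0.ne']
      congr 1; ring
  have hpow : ∀ x : E, ‖‖x‖ ^ (p.toReal - 2) • x‖ ^ q.toReal = ‖x‖ ^ p.toReal := by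
    intro x
    rw [hnorm, ← Real.rpow_mul (norm_nonneg _)]
    congr 1
    have := hpq.mul_eq_add
    linarith
  have hmeas : AEStronglyMeasurable (fun x => ‖h x‖ ^ (p.toReal - 2) • h x) μ :=
    ((Lp.aestronglyMeasurable h).norm.aemeasurable.pow_const _).aestronglyMeasurable.smul
      (Lp.aestronglyMeasurable h)
  have hint := (integrable_norm_rpow_iff (Lp.aestronglyMeasurable h) hp0 hp).2 (Lp.memLp h)
  have hmem : MemLp (fun x => ‖h x‖ ^ (p.toReal - 2) • h x) q μ := by
    rw [← integrable_norm_rpow_iff hmeas hq0 hq]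
    simpa only [hpow] using hint
  have e1 : innerPairing h (hmem.toLp _) = ‖h‖ ^ p.toReal := by
    rw [innerPairing_apply, Lp_norm_rpow hp]
    refine integral_congr_ae ?_
    filter_upwards [hmem.coeFn_toLp] with x hx
    rw [hx, inner_smul_right, real_inner_self_eq_norm_sq]
    rcases eq_or_ne (h x) 0 with h0 | h0
    · rw [h0, norm_zero, Real.zero_rpow hpr.ne']; simp
    · rw [← Real.rpow_natCast, ← Real.rpow_add (norm_pos_iff.2 h0)]
      congr 1; push_cast; ring
  have e2 : ‖hmem.toLp _‖ ^ q.toReal = ‖h‖ ^ p.toReal := by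
    rw [Lp_norm_rpow hq, Lp_norm_rpow hp]
    refine integral_congr_ae ?_
    filter_upwards [hmem.coeFn_toLp] with x hx
    rw [hx, hpow]
  have h0 := norm_pos_iff.2 hne
  have e3 : ‖hmem.toLp _‖ = ‖h‖ ^ (p.toReal - 1) := by
    rw [← Real.rpow_rpow_inv (norm_nonneg (hmem.toLp _)) hqr.ne', e2, ← Real.rpow_mul h0.le]
    congr 1
    have := hpq.mul_eq_add
    field_simp
    linarith
  have h1 := H (hmem.toLp _)
  rw [e1, e3, abs_of_nonneg (by positivity)] at h1
  have h2 : ‖h‖ ^ p.toReal = ‖h‖ * ‖h‖ ^ (p.toReal - 1) := by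
    rw [← Real.rpow_one_add' h0.le (by linarith)]
    congr 1; ring
  rw [h2] at h1
  exact le_of_mul_le_mul_right h1 (by positivity)

lemma norm_le_of_dense (hp : p ≠ ∞) (hq : q ≠ ∞) {V : Set (Lp E q μ)} (hV : Dense V)
    (h : Lp E p μ) {C : ℝ} (hC : 0 ≤ C) (H : ∀ g ∈ V, |innerPairing h g| ≤ C * ‖g‖) : ‖h‖ ≤ C :=
  norm_le_of_forall_innerPairing_le hp hq h hC fun g =>
    (isClosed_le (innerPairing h).continuous.abs (continuous_norm.const_mul C)).closure_subset_iff.2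
      H (hV g)

lemma eq_of_innerPairing_eq (hp : p ≠ ∞) (hq : q ≠ ∞) {κ : Type*} {v : κ → Lp E q μ}
    (hv : Dense (Submodule.span ℝ (Set.range v) : Set (Lp E q μ))) {h₁ h₂ : Lp E p μ}
    (H : ∀ k, innerPairing h₁ (v k) = innerPairing h₂ (v k)) : h₁ = h₂ := by
  rw [← sub_eq_zero, ← norm_le_zero_iff]
  refine norm_le_of_dense hp hq hv _ le_rfl fun g hg => ?_
  have h0 : innerPairing (h₁ - h₂) g = 0 := by
    have := LinearMap.eqOn_span (f := (innerPairing (h₁ - h₂) : Lp E q μ →L[ℝ] ℝ).toLinearMap)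
      (g := 0) (s := Set.range v) (by
        rintro _ ⟨k, rfl⟩
        simp [H k]) hg
    simpa using this
  rw [h0]
  simp

end duality

section expansions

variable {α ι E : Type*} [MeasurableSpace α] {μ : Measure α} [NormedAddCommGroup E]
  {φ : ι → α → ℝ} {e : ι → α → E} {f : α → ℝ} {g : α → E}

lemma HasL2Expansion.hasSum [NormedSpace ℝ E] (h : HasL2Expansion μ φ e f g)
    (he : ∀ k, MemLp (e k) 2 μ) :
    HasSum (fun k => (∫ y, f y * φ k y ∂μ) • (he k).toLp (e k)) (h.1.toLp g) := by
  rw [HasSum, SummationFilter.unconditional_filter, tendsto_iff_norm_sub_tendsto_zero]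
  have h1 := (ENNReal.tendsto_toReal ENNReal.zero_ne_top).comp h.2
  rw [ENNReal.toReal_zero] at h1
  refine h1.congr fun s => ?_
  rw [Function.comp_apply, ← norm_neg, neg_sub, Lp.norm_def]
  congr 1
  refine eLpNorm_congr_ae ?_
  have h2 : ∀ᵐ x ∂μ, ∀ k ∈ s, (he k).toLp (e k) x = e k x :=
    (eventually_all_finset s).2 fun k _ => (he k).coeFn_toLp
  have h3 : ∀ᵐ x ∂μ, ∀ k ∈ s, ((∫ y, f y * φ k y ∂μ) • (he k).toLp (e k) : Lp E 2 μ) x =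
      (∫ y, f y * φ k y ∂μ) • (he k).toLp (e k) x :=
    (eventually_all_finset s).2 fun k _ => Lp.coeFn_smul _ _
  filter_upwards [h.1.coeFn_toLp, h2, h3, Lp.coeFn_sub (h.1.toLp g)
    (∑ k ∈ s, (∫ y, f y * φ k y ∂μ) • (he k).toLp (e k)),
    Lp.coeFn_finsetSum s fun k => (∫ y, f y * φ k y ∂μ) • (he k).toLp (e k)] with x h1 h2 h3 h4 h5
  rw [h4, Pi.sub_apply, h1, h5, Finset.sum_apply]
  congr 1
  exact Finset.sum_congr rfl fun k hk => by rw [h3 k hk, h2 k hk]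

/-- Reads off coefficients of a function known only through its `L²` series, by pairing with a
function orthogonal to all but finitely many terms. -/
lemma HasL2Expansion.integral_inner [InnerProductSpace ℝ E] (h : HasL2Expansion μ φ e f g)
    (he : ∀ k, MemLp (e k) 2 μ) {ψ : α → E} (hψ : MemLp ψ 2 μ) (s : Finset ι)
    (hs : ∀ k ∉ s, ∫ x, inner ℝ (e k x) (ψ x) ∂μ = 0) :
    ∫ x, inner ℝ (g x) (ψ x) ∂μ =
      ∑ k ∈ s, (∫ y, f y * φ k y ∂μ) * ∫ x, inner ℝ (e k x) (ψ x) ∂μ := by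
  have hin : ∀ {u : α → E} (hu : MemLp u 2 μ), inner ℝ (hψ.toLp ψ) (hu.toLp u) =
      ∫ x, inner ℝ (u x) (ψ x) ∂μ := by
    intro u hu
    rw [L2.inner_def]
    refine integral_congr_ae ?_
    filter_upwards [hu.coeFn_toLp, hψ.coeFn_toLp] with x h1 h2
    rw [h1, h2, real_inner_comm]
  have h1 := (h.hasSum he).mapL (innerSL ℝ (hψ.toLp ψ))
  simp only [innerSL_apply_apply, inner_smul_right, hin] at h1
  exact h1.unique (hasSum_sum_of_ne_finset_zero fun k hk => by rw [hs k hk, mul_zero])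

lemma hasL2Expansion_of_finset [NormedSpace ℝ E] (s : Finset ι) (hg : MemLp g 2 μ)
    (hs : ∀ k ∉ s, ∫ y, f y * φ k y ∂μ = 0)
    (h : g =ᵐ[μ] fun x => ∑ k ∈ s, (∫ y, f y * φ k y ∂μ) • e k x) : HasL2Expansion μ φ e f g := by
  refine ⟨hg, tendsto_const_nhds.congr' ?_⟩
  filter_upwards [eventually_ge_atTop s] with t ht
  symm
  rw [← eLpNorm_zero (μ := μ) (p := 2) (ε := E)]
  refine eLpNorm_congr_ae ?_
  filter_upwards [h] with x hx
  rw [hx, Finset.sum_subset ht fun k _ hk => by rw [hs k hk, zero_smul], sub_self]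
  rfl

end expansions

/-- With `x = 1/a` and `y = 1/b` the bracket would be `1/p + 1/q = 1`. Replacing `a`, `b` by `a +
η`, `b + η` and letting `η → 0` covers the case where one of them is `0`. -/
lemma le_mul_of_scaled_le {p q L C a b : ℝ} (hpq : p.HolderConjugate q) (hC : 0 ≤ C) (ha : 0 ≤ a)
    (hb : 0 ≤ b) (h : ∀ x y : ℝ, 0 < x → 0 < y →
      x * y * L ≤ C * ((x * a) ^ p / p + (y * b) ^ q / q)) : L ≤ C * (a * b) := by
  have key : ∀ η > 0, L ≤ C * ((a + η) * (b + η)) := by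
    intro η hη
    have ha' : 0 < a + η := by linarith
    have hb' : 0 < b + η := by linarith
    have h1 := h (a + η)⁻¹ (b + η)⁻¹ (by positivity) (by positivity)
    have hxa : ((a + η)⁻¹ * a) ^ p ≤ 1 := Real.rpow_le_one (by positivity)
      (by rw [inv_mul_le_iff₀ ha']; linarith) hpq.nonneg
    have hyb : ((b + η)⁻¹ * b) ^ q ≤ 1 := Real.rpow_le_one (by positivity)
      (by rw [inv_mul_le_iff₀ hb']; linarith) hpq.symm.nonneg
    have h2 : ((a + η)⁻¹ * a) ^ p / p + ((b + η)⁻¹ * b) ^ q / q ≤ 1 := by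
      calc _ ≤ 1 / p + 1 / q := add_le_add (div_le_div_of_nonneg_right hxa hpq.nonneg)
            (div_le_div_of_nonneg_right hyb hpq.symm.nonneg)
        _ = 1 := by simpa using hpq.inv_add_inv_eq_one
    have h3 : (a + η)⁻¹ * (b + η)⁻¹ * L ≤ C :=
      h1.trans ((mul_le_mul_of_nonneg_left h2 hC).trans_eq (mul_one C))
    calc L = (a + η)⁻¹ * (b + η)⁻¹ * L * ((a + η) * (b + η)) := by field_simp
      _ ≤ _ := by gcongr
  have hlim : Tendsto (fun η => C * ((a + η) * (b + η))) (𝓝[>] 0) (𝓝 (C * (a * b))) := by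
    have : Continuous fun η => C * ((a + η) * (b + η)) := by fun_prop
    simpa using (this.tendsto 0).mono_left nhdsWithin_le_nhds
  exact ge_of_tendsto hlim (by filter_upwards [self_mem_nhdsWithin] with η hη; exact key η hη)

section density

variable {α κ : Type*} [MeasurableSpace α] {μ : Measure α} {p : ℝ≥0∞} [Fact (1 ≤ p)]

lemma dense_span_toLp {v : κ → α → ℝ}
    (h : IsDenseSubspaceOfLp (Submodule.span ℝ (Set.range v)) p μ) (hv : ∀ k, MemLp (v k) p μ) :
    Dense (Submodule.span ℝ (Set.range fun k => (hv k).toLp (v k)) : Set (Lp ℝ p μ)) := by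
  have key : ∀ g ∈ Submodule.span ℝ (Set.range v),
      ∃ G ∈ Submodule.span ℝ (Set.range fun k => (hv k).toLp (v k)), G =ᵐ[μ] g := by
    intro g hg
    induction hg using Submodule.span_induction with
    | mem g hg =>
      obtain ⟨k, rfl⟩ := hg
      exact ⟨_, Submodule.subset_span ⟨k, rfl⟩, (hv k).coeFn_toLp⟩
    | zero => exact ⟨0, Submodule.zero_mem _, Lp.coeFn_zero _ _ _⟩
    | add g₁ g₂ _ _ h₁ h₂ =>
      obtain ⟨G₁, hG₁, e₁⟩ := h₁
      obtain ⟨G₂, hG₂, e₂⟩ := h₂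
      exact ⟨_, Submodule.add_mem _ hG₁ hG₂, (Lp.coeFn_add _ _).trans (e₁.add e₂)⟩
    | smul c g _ h =>
      obtain ⟨G, hG, e⟩ := h
      exact ⟨_, Submodule.smul_mem _ c hG, (Lp.coeFn_smul _ _).trans (e.const_smul c)⟩
  rw [Metric.dense_iff]
  intro F r hr
  obtain ⟨g, hg, hle⟩ := h.2 F (Lp.memLp F) (ENNReal.ofReal (r / 2)) (by simpa using hr)
  obtain ⟨G, hG, e⟩ := key g hg
  refine ⟨G, ?_, hG⟩
  rw [Metric.mem_ball, dist_comm, dist_eq_norm, Lp.norm_def]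
  have h1 : eLpNorm (F - G : Lp ℝ p μ) p μ = eLpNorm ((F : α → ℝ) - g) p μ :=
    eLpNorm_congr_ae ((Lp.coeFn_sub _ _).trans ((ae_eq_refl _).sub e))
  rw [h1]
  have h2 := ENNReal.toReal_mono ENNReal.ofReal_ne_top hle
  rw [ENNReal.toReal_ofReal (by positivity)] at h2
  linarith

/-- The function whose only non-zero coordinate is the `j`-th one. -/
def singleFun {d : ℕ} (j : Fin d) (u : α → ℝ) (x : α) : EuclideanSpace ℝ (Fin d) :=
  EuclideanSpace.single j (u x)

/-- `EuclideanSpace.single` as a continuous linear map. -/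
def singleCLM {d : ℕ} (j : Fin d) : ℝ →L[ℝ] EuclideanSpace ℝ (Fin d) :=
  ContinuousLinearMap.toSpanSingleton ℝ (EuclideanSpace.single j (1 : ℝ))

lemma singleCLM_apply {d : ℕ} (j : Fin d) (a : ℝ) :
    singleCLM j a = EuclideanSpace.single j a := by
  ext i
  simp [singleCLM]

omit [Fact (1 ≤ p)] in
lemma memLp_singleFun {d : ℕ} (j : Fin d) {u : α → ℝ} (hu : MemLp u p μ) :
    MemLp (singleFun j u) p μ := by
  refine (memLp_congr_ae (ae_of_all _ fun x => ?_)).1 ((singleCLM j).comp_memLp' hu)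
  exact singleCLM_apply j _

lemma dense_span_singleFun {d : ℕ} {v : Fin d → κ → α → ℝ}
    (h : ∀ j, IsDenseSubspaceOfLp (Submodule.span ℝ (Set.range (v j))) p μ)
    (hv : ∀ j k, MemLp (v j k) p μ) :
    Dense (Submodule.span ℝ (Set.range fun z : Fin d × κ =>
      (memLp_singleFun z.1 (hv z.1 z.2)).toLp (singleFun z.1 (v z.1 z.2))) :
      Set (Lp (EuclideanSpace ℝ (Fin d)) p μ)) := by
  set V := Submodule.span ℝ (Set.range fun z : Fin d × κ =>
      (memLp_singleFun z.1 (hv z.1 z.2)).toLp (singleFun z.1 (v z.1 z.2))) with hV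
  have h1 : ∀ j (u : Lp ℝ p μ), (singleCLM j).compLpL p μ u ∈ V.topologicalClosure := by
    intro j u
    refine map_mem_closure ((singleCLM j).compLpL p μ).continuous
      (dense_span_toLp (h j) (hv j) u) fun w hw => ?_
    have h2 : Submodule.span ℝ (Set.range fun k => (hv j k).toLp (v j k)) ≤
        V.comap ((singleCLM j).compLpL p μ).toLinearMap := by
      rw [Submodule.span_le]
      rintro _ ⟨k, rfl⟩
      refine Submodule.subset_span ⟨(j, k), ?_⟩
      refine Lp.ext ?_
      filter_upwards [(memLp_singleFun j (hv j k)).coeFn_toLp, (hv j k).coeFn_toLp,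
        (singleCLM j).coeFn_compLpL ((hv j k).toLp (v j k))] with x e1 e2 e3
      exact e1.trans ((singleCLM_apply j _).symm.trans ((congrArg _ e2.symm).trans e3.symm))
    exact h2 hw
  intro F
  have h2 : F = ∑ j, (singleCLM j).compLpL p μ ((EuclideanSpace.proj (𝕜 := ℝ) j).compLpL p μ F) := by
    refine Lp.ext ?_
    have e1 : ∀ᵐ x ∂μ, ∀ j : Fin d, (singleCLM j).compLpL p μ
        ((EuclideanSpace.proj (𝕜 := ℝ) j).compLpL p μ F) x = singleCLM j (F x j) := by
      refine eventually_all.2 fun j => ?_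
      filter_upwards [(singleCLM j).coeFn_compLpL ((EuclideanSpace.proj (𝕜 := ℝ) j).compLpL p μ F),
        (EuclideanSpace.proj (𝕜 := ℝ) j).coeFn_compLpL F] with x e2 e3
      rw [e2, e3]
      rfl
    filter_upwards [e1, Lp.coeFn_finsetSum Finset.univ fun j : Fin d => (singleCLM j).compLpL p μ
        ((EuclideanSpace.proj (𝕜 := ℝ) j).compLpL p μ F)] with x e1 e2
    rw [e2, Finset.sum_apply]
    simp only [e1, singleCLM_apply]
    ext i
    simp
  rw [h2]
  exact V.topologicalClosure.sum_mem fun j _ => h1 j _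

end density

/-! ### The operators on `L^p` -/

namespace EigenSystem

variable {d : ℕ} {S : ProductSetting d} {B : EigenSystem S} {p q : ℝ≥0∞} [Fact (1 ≤ p)]
  [Fact (1 ≤ q)]

/-- `φₖ` as an element of `L^p`. -/
def phiLp (hT3 : B.T3) (hp : p ≠ ∞) (k : Fin d → ℕ) : Lp ℝ p S.mu :=
  (hT3.memLp_mode none k Fact.out hp).toLp (B.mode none k)

/-- `λₖ^{-1/2} (δ₁φₖ, …, δ_dφₖ)`. -/
def rieszMode (B : EigenSystem S) (k : Fin d → ℕ) (x : Fin d → ℝ) : EuclideanSpace ℝ (Fin d) :=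
  WithLp.toLp 2 fun j => (B.freq k)⁻¹ * B.mode (some j) k x

lemma T3.memLp_rieszMode (hT3 : B.T3) (k : Fin d → ℕ) {p : ℝ≥0∞} [Fact (1 ≤ p)] (hp : p ≠ ∞) :
    MemLp (B.rieszMode k) p S.mu :=
  memLp_piLp_iff.2 fun j => (hT3.memLp_mode (some j) k Fact.out hp).const_mul _

/-- `λₖ^{-1/2} (δ₁φₖ, …, δ_dφₖ)` as an element of `L^p`. -/
def rieszLp (hT3 : B.T3) (hp : p ≠ ∞) (k : Fin d → ℕ) : Lp (EuclideanSpace ℝ (Fin d)) p S.mu :=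
  (hT3.memLp_rieszMode k hp).toLp (B.rieszMode k)

/-- The vector with the only non-zero coordinate `δⱼφₖ`, as an element of `L^p`. -/
def deltaLp (hT3 : B.T3) (hp : p ≠ ∞) (z : Fin d × (Fin d → ℕ)) :
    Lp (EuclideanSpace ℝ (Fin d)) p S.mu :=
  (memLp_singleFun z.1 (hT3.memLp_mode (some z.1) z.2 Fact.out hp)).toLp
    (singleFun z.1 (B.mode (some z.1) z.2))

lemma dense_span_phiLp (hT3 : B.T3) (hp : p ≠ ∞) :
    Dense (Submodule.span ℝ (Set.range (phiLp hT3 hp)) : Set (Lp ℝ p S.mu)) := by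
  refine dense_span_toLp ?_ fun k => hT3.memLp_mode none k Fact.out hp
  rw [mode_none]
  exact (hT3 p Fact.out hp).1

lemma dense_span_deltaLp (hT3 : B.T3) (hp : p ≠ ∞) :
    Dense (Submodule.span ℝ (Set.range (deltaLp hT3 hp)) :
      Set (Lp (EuclideanSpace ℝ (Fin d)) p S.mu)) := by
  refine dense_span_singleFun (v := fun j k => B.mode (some j) k) (fun j => ?_)
    fun j k => hT3.memLp_mode (some j) k Fact.out hp
  simp only [mode_some]
  exact (hT3 p Fact.out hp).2 j

lemma integral_phi_mul_phi (hT1 : B.T1) (k l : Fin d → ℕ) :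
    ∫ x, B.mode none k x * B.mode none l x ∂S.mu = if k = l then 1 else 0 := by
  split_ifs with h
  · rw [h, B.integral_phi_sq]
  · exact B.integral_mode_mul_mode hT1 _ h

lemma integral_inner_rieszMode (hT1 : B.T1) (j : Fin d) (k l : Fin d → ℕ) :
    ∫ x, inner ℝ (B.rieszMode k x) (singleFun j (B.mode (some j) l) x) ∂S.mu =
      if k = l then (B.freq l)⁻¹ * B.gram j l else 0 := by
  have h : ∀ x, inner ℝ (B.rieszMode k x) (singleFun j (B.mode (some j) l) x) =
      (B.freq k)⁻¹ * (B.mode (some j) k x * B.mode (some j) l x) := by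
    intro x
    rw [singleFun, EuclideanSpace.inner_single_right]
    simp only [rieszMode, conj_trivial]
    ring
  simp only [h]
  rw [integral_const_mul]
  split_ifs with hkl
  · rw [hkl, gram]
  · rw [B.integral_mode_mul_mode hT1 _ hkl, mul_zero]

variable [ENNReal.HolderConjugate p q]

lemma innerPairing_phiLp (hT1 : B.T1) (hT3 : B.T3) (hp : p ≠ ∞) (hq : q ≠ ∞) (k l : Fin d → ℕ) :
    innerPairing (phiLp hT3 hp k) (phiLp hT3 hq l) = if k = l then 1 else 0 := by
  rw [innerPairing_apply, ← integral_phi_mul_phi hT1]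
  refine integral_congr_ae ?_
  filter_upwards [(hT3.memLp_mode none k (Fact.out : 1 ≤ p) hp).coeFn_toLp,
    (hT3.memLp_mode none l (Fact.out : 1 ≤ q) hq).coeFn_toLp] with x h1 h2
  rw [phiLp, phiLp, h1, h2, RCLike.inner_apply, conj_trivial, mul_comm]

lemma innerPairing_phiLp_right (hT3 : B.T3) (hq : q ≠ ∞) (f : Lp ℝ p S.mu) (k : Fin d → ℕ) :
    innerPairing f (phiLp hT3 hq k) = ∫ x, f x * B.phi k x ∂S.mu := by
  rw [innerPairing_apply, ← mode_none]
  refine integral_congr_ae ?_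
  filter_upwards [(hT3.memLp_mode none k (Fact.out : 1 ≤ q) hq).coeFn_toLp] with x h1
  rw [phiLp, h1, RCLike.inner_apply, conj_trivial, mul_comm]

lemma innerPairing_rieszLp (hT1 : B.T1) (hT3 : B.T3) (hp : p ≠ ∞) (hq : q ≠ ∞) (j : Fin d)
    (k l : Fin d → ℕ) : innerPairing (rieszLp hT3 hp k) (deltaLp hT3 hq (j, l)) =
      if k = l then (B.freq l)⁻¹ * B.gram j l else 0 := by
  rw [innerPairing_apply, ← integral_inner_rieszMode hT1]
  refine integral_congr_ae ?_
  filter_upwards [(hT3.memLp_rieszMode k hp).coeFn_toLp,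
    (memLp_singleFun j (hT3.memLp_mode (some j) l (Fact.out : 1 ≤ q) hq)).coeFn_toLp] with x h1 h2
  rw [rieszLp, deltaLp, h1, h2]

lemma innerPairing_deltaLp_right (hT3 : B.T3) (hq : q ≠ ∞)
    (g : Lp (EuclideanSpace ℝ (Fin d)) p S.mu) (j : Fin d) (l : Fin d → ℕ) :
    innerPairing g (deltaLp hT3 hq (j, l)) =
      ∫ x, inner ℝ (g x) (singleFun j (B.mode (some j) l) x) ∂S.mu := by
  rw [innerPairing_apply]
  refine integral_congr_ae ?_
  filter_upwards [(memLp_singleFun j (hT3.memLp_mode (some j) l (Fact.out : 1 ≤ q) hq)).coeFn_toLp]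
    with x h2
  rw [deltaLp, h2]

omit [Fact (1 ≤ p)] [Fact (1 ≤ q)] [ENNReal.HolderConjugate p q] in
lemma gram_eq (hT1 : B.T1) (j : Fin d) (k : Fin d → ℕ) :
    B.gram j k = B.ev1 j (k j) - S.a j := by
  have h1 : ∫ x, B.Y true j (k j) x * B.Y true j (k j) x ∂S.mu1 j = B.ev1 j (k j) - S.a j := by
    have h1 := (hT1 j).2 (k j) (k j)
    have h2 : ∫ x, S.delta1Star j (S.delta1 j (B.phi1 j (k j))) x * B.phi1 j (k j) x ∂S.mu1 j =
        ∫ x, (B.ev1 j (k j) - S.a j) * (B.phi1 j (k j) x * B.phi1 j (k j) x) ∂S.mu1 j := by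
      refine integral_congr_ae ?_
      filter_upwards [S.ae_mem_X j] with x hx
      rw [B.delta1Star_delta1 hx]
      ring
    rw [h2, integral_const_mul, B.orthonormal, if_pos rfl, mul_one] at h1
    exact h1
  unfold gram
  simp only [mode, ← Finset.prod_mul_distrib]
  rw [ProductSetting.mu, integral_fintype_prod_eq_prod
    (fun i y => B.Y (decide (some j = some i)) i (k i) y * B.Y (decide (some j = some i)) i (k i) y),
    ← Finset.mul_prod_erase _ _ (Finset.mem_univ j), Finset.prod_eq_one fun i hi => ?_]
  · simpa using h1
  · have := (Finset.ne_of_mem_erase hi).symm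
    simpa [this, Y] using B.orthonormal i (k i) (k i)

omit [Fact (1 ≤ p)] [Fact (1 ≤ q)] [ENNReal.HolderConjugate p q] in
lemma freq_of_notMem {k : Fin d → ℕ} (hk : k ∉ B.indexSet) : B.freq k = 0 ∧ ∀ i, B.ev1 i (k i) = 0 := by
  simp only [indexSet, Set.mem_ofPred_eq, not_or, not_lt, not_not] at hk
  obtain ⟨h0, rfl⟩ := hk
  refine ⟨Real.sqrt_eq_zero_of_nonpos h0, fun i => ?_⟩
  have h1 : B.ev 0 = 0 := le_antisymm h0 (Finset.sum_nonneg fun i _ => B.ev1_nonneg i _)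
  exact (Finset.sum_eq_zero_iff_of_nonneg fun i _ => B.ev1_nonneg i _).1 h1 i (Finset.mem_univ i)

omit [Fact (1 ≤ p)] [Fact (1 ≤ q)] [ENNReal.HolderConjugate p q] in
-- Outside `indexSet` all the one-dimensional eigenvalues vanish, so the squared norm `λ_j - a_j` of
-- `δ_j φ_k` is at most `0`. Such indices can therefore be dropped from `g` without changing its
-- norm.
lemma mode_some_ae_eq_zero (hT1 : B.T1) (hT3 : B.T3) (j : Fin d) {k : Fin d → ℕ}
    (hk : k ∉ B.indexSet) : ∀ᵐ x ∂S.mu, B.mode (some j) k x = 0 := by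
  have h1 : B.gram j k ≤ 0 := by
    rw [gram_eq hT1, (freq_of_notMem hk).2 j]
    linarith [S.a_nonneg j]
  have h2 : 0 ≤ B.gram j k := integral_nonneg fun x => mul_self_nonneg _
  have h3 : B.gram j k = 0 := le_antisymm h1 h2
  have hm := hT3.memLp_mode (some j) k (p := 2) one_le_two ENNReal.ofNat_ne_top
  rw [gram, integral_eq_zero_iff_of_nonneg (fun x => mul_self_nonneg _) (hm.integrable_mul hm)] at h3
  filter_upwards [h3] with x hx
  exact mul_self_eq_zero.1 hx

end EigenSystem

namespace EigenSystem

variable {d : ℕ} {S : ProductSetting d} {B : EigenSystem S} {p q : ℝ≥0∞} [Fact (1 ≤ p)]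
  [Fact (1 ≤ q)] [ENNReal.HolderConjugate p q]

lemma coeFn_sum_phiLp (hT3 : B.T3) (hp : p ≠ ∞) (s : Finset (Fin d → ℕ)) (c : (Fin d → ℕ) → ℝ) :
    (∑ k ∈ s, c k • phiLp hT3 hp k : Lp ℝ p S.mu) =ᵐ[S.mu]
      fun x => ∑ k ∈ s, c k * B.mode none k x := by
  have h1 : ∀ᵐ x ∂S.mu, ∀ k ∈ s, (c k • phiLp hT3 hp k : Lp ℝ p S.mu) x = c k * B.mode none k x :=
    (eventually_all_finset s).2 fun k _ => by
      filter_upwards [Lp.coeFn_smul (c k) (phiLp hT3 hp k),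
        (hT3.memLp_mode none k (Fact.out : 1 ≤ p) hp).coeFn_toLp] with x h1 h2
      rw [h1, Pi.smul_apply, phiLp, h2, smul_eq_mul]
  filter_upwards [h1, Lp.coeFn_finsetSum s fun k => c k • phiLp hT3 hp k] with x h1 h2
  rw [h2, Finset.sum_apply]
  exact Finset.sum_congr rfl fun k hk => h1 k hk

lemma coeFn_sum_deltaLp (hT3 : B.T3) (hp : p ≠ ∞) (s : Finset (Fin d → ℕ))
    (e : Fin d → (Fin d → ℕ) → ℝ) :
    (∑ j, ∑ k ∈ s, e j k • deltaLp hT3 hp (j, k) : Lp (EuclideanSpace ℝ (Fin d)) p S.mu) =ᵐ[S.mu]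
      fun x => WithLp.toLp 2 fun j => ∑ k ∈ s, e j k * B.mode (some j) k x := by
  have h1 : ∀ᵐ x ∂S.mu, ∀ j, ∀ k ∈ s,
      (e j k • deltaLp hT3 hp (j, k) : Lp (EuclideanSpace ℝ (Fin d)) p S.mu) x =
        e j k • singleFun j (B.mode (some j) k) x :=
    eventually_all.2 fun j => (eventually_all_finset s).2 fun k _ => by
      filter_upwards [Lp.coeFn_smul (e j k) (deltaLp hT3 hp (j, k)), (memLp_singleFun j
        (hT3.memLp_mode (some j) k (Fact.out : 1 ≤ p) hp)).coeFn_toLp] with x h1 h2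
      rw [h1, Pi.smul_apply, deltaLp, h2]
  have h2 : ∀ᵐ x ∂S.mu, ∀ j, (∑ k ∈ s, e j k • deltaLp hT3 hp (j, k) :
      Lp (EuclideanSpace ℝ (Fin d)) p S.mu) x = ∑ k ∈ s,
        (e j k • deltaLp hT3 hp (j, k) : Lp (EuclideanSpace ℝ (Fin d)) p S.mu) x :=
    eventually_all.2 fun j => by
      filter_upwards [Lp.coeFn_finsetSum s fun k => e j k • deltaLp hT3 hp (j, k)] with x h
      rw [h, Finset.sum_apply]
  filter_upwards [h1, h2, Lp.coeFn_finsetSum Finset.univ fun j =>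
    ∑ k ∈ s, e j k • deltaLp hT3 hp (j, k)] with x h1 h2 h3
  rw [h3, Finset.sum_apply]
  ext i
  simp only [h2, WithLp.ofLp_sum, Finset.sum_apply]
  rw [Finset.sum_eq_single i]
  · refine Finset.sum_congr rfl fun k hk => ?_
    rw [h1 i k hk]
    simp [singleFun]
  · intro j _ hj
    refine Finset.sum_eq_zero fun k hk => ?_
    rw [h1 j k hk]
    simp [singleFun, hj.symm]
  · simp

lemma innerPairing_sum (hT1 : B.T1) (hT3 : B.T3) (hp : p ≠ ∞) (hq : q ≠ ∞)
    (s : Finset (Fin d → ℕ)) (c : (Fin d → ℕ) → ℝ) (e : Fin d → (Fin d → ℕ) → ℝ) :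
    innerPairing (∑ k ∈ s, c k • rieszLp hT3 hp k)
      (∑ j, ∑ k ∈ s, e j k • deltaLp hT3 hq (j, k)) =
      ∑ j, ∑ k ∈ s, c k * e j k * ((B.freq k)⁻¹ * B.gram j k) := by
  simp only [map_sum, map_smul, _root_.sum_apply, smul_apply]
  refine Finset.sum_congr rfl fun j _ => Finset.sum_congr rfl fun l hl => ?_
  simp only [innerPairing_rieszLp hT1, smul_eq_mul]
  rw [Finset.sum_eq_single l]
  · simp; ring
  · intro k _ hk
    simp [hk]
  · exact fun h => absurd hl h

/-- The bilinear estimate. -/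
lemma innerPairing_sum_le (hA1 : S.A1) {K : ℝ} (hK : 0 ≤ K) (hA2 : S.A2 K) (hT1 : B.T1)
    (hT2 : B.T2) (hT3 : B.T3) (hp : p ≠ ∞) (hq : q ≠ ∞)
    (hpq : p.toReal.HolderConjugate q.toReal) [DecidablePred (· ∈ B.indexSet)]
    (s : Finset (Fin d → ℕ)) (c : (Fin d → ℕ) → ℝ) (e : Fin d → (Fin d → ℕ) → ℝ) :
    innerPairing (∑ k ∈ s, c k • rieszLp hT3 hp k)
      (∑ j, ∑ k ∈ s, e j k • deltaLp hT3 hq (j, k)) ≤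
      24 * (1 + √K) * (max p.toReal q.toReal - 1) *
        (‖∑ k ∈ s with k ∈ B.indexSet, c k • phiLp hT3 hp k‖ *
          ‖∑ j, ∑ k ∈ s, e j k • deltaLp hT3 hq (j, k)‖) := by
  have hmax : 0 ≤ max p.toReal q.toReal - 1 := by
    have := hpq.lt.le.trans (le_max_left p.toReal q.toReal)
    linarith
  refine le_mul_of_scaled_le hpq (by positivity) (norm_nonneg _) (norm_nonneg _)
    fun x y hx hy => ?_
  have h := sum_gram_le_add hA1 hK hA2 hT1 hT2 hT3 hpq
    (s := s.filter (· ∈ B.indexSet)) (fun k hk => (Finset.mem_filter.1 hk).2)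
    (fun k => x * c k) (fun j k => y * e j k)
  have e1 : (x * ‖∑ k ∈ s with k ∈ B.indexSet, c k • phiLp hT3 hp k‖) ^ p.toReal =
      ∫ z, |∑ k ∈ s with k ∈ B.indexSet, x * c k * B.mode none k z| ^ p.toReal ∂S.mu := by
    rw [← Real.norm_of_nonneg hx.le, ← norm_smul, Finset.smul_sum, Lp_norm_rpow hp]
    simp only [smul_smul]
    refine integral_congr_ae ?_
    filter_upwards [coeFn_sum_phiLp hT3 hp (s.filter (· ∈ B.indexSet)) fun k => x * c k] with z hz
    rw [hz, Real.norm_eq_abs, Real.norm_of_nonneg hx.le]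
  have e2 : (y * ‖∑ j, ∑ k ∈ s, e j k • deltaLp hT3 hq (j, k)‖) ^ q.toReal =
      ∫ z, ‖(WithLp.toLp 2 fun j => ∑ k ∈ s with k ∈ B.indexSet, y * e j k * B.mode (some j) k z :
        EuclideanSpace ℝ (Fin d))‖ ^ q.toReal ∂S.mu := by
    rw [← Real.norm_of_nonneg hy.le, ← norm_smul, Finset.smul_sum, Lp_norm_rpow hq]
    simp only [Finset.smul_sum, smul_smul]
    refine integral_congr_ae ?_
    have hz0 : ∀ᵐ z ∂S.mu, ∀ j, ∀ k ∈ s, k ∉ B.indexSet → B.mode (some j) k z = 0 :=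
      eventually_all.2 fun j => (eventually_all_finset s).2 fun k _ => by
        by_cases hk : k ∈ B.indexSet
        · exact Eventually.of_forall fun z h => absurd hk h
        · filter_upwards [mode_some_ae_eq_zero hT1 hT3 j hk] with z hz _ using hz
    filter_upwards [coeFn_sum_deltaLp hT3 hq s fun j k => y * e j k, hz0] with z hz hz0
    rw [hz, Real.norm_of_nonneg hy.le]
    congr 3
    ext j
    refine (Finset.sum_filter_of_ne fun k hk hne => ?_).symm
    by_contra hk2
    exact hne (by rw [hz0 j k hk hk2, mul_zero])
  rw [e1, e2]
  refine le_of_eq_of_le ?_ h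
  rw [innerPairing_sum hT1, Finset.mul_sum]
  refine Finset.sum_congr rfl fun j _ => ?_
  rw [Finset.mul_sum]
  -- Outside `indexSet` the frequency is `0` and its inverse is `0` by convention, so these terms
  -- vanish.
  have e3 : ∀ k ∈ s, x * c k * (y * e j k) * ((B.freq k)⁻¹ * B.gram j k) ≠ 0 → k ∈ B.indexSet := by
    intro k _ hne
    by_contra hk
    exact hne (by rw [(freq_of_notMem hk).1]; simp)
  rw [Finset.sum_filter_of_ne e3]
  exact Finset.sum_congr rfl fun k _ => by ring

open Classical in
/-- `Π` on `L^p`. -/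
def proj (hT3 : B.T3) (hp : p ≠ ∞) (hq : q ≠ ∞) : Lp ℝ p S.mu →L[ℝ] Lp ℝ p S.mu :=
  -- At most the index `0` is excluded, so `Π` is the identity up to one operator of rank one,
  -- bounded on `L^p` because `φ_0` lies in both `L^p` and `L^q`.
  if (0 : Fin d → ℕ) ∈ B.indexSet then ContinuousLinearMap.id ℝ _ else
    ContinuousLinearMap.id ℝ _ -
      (innerPairing.flip (phiLp hT3 hq 0)).smulRight (phiLp hT3 hp 0)

lemma mem_indexSet_of_ne_zero {k : Fin d → ℕ} (hk : k ≠ 0) : k ∈ B.indexSet := Or.inr hk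

open Classical in
lemma proj_phiLp (hT1 : B.T1) (hT3 : B.T3) (hp : p ≠ ∞) (hq : q ≠ ∞) (k : Fin d → ℕ) :
    proj hT3 hp hq (phiLp hT3 hp k) = if k ∈ B.indexSet then phiLp hT3 hp k else 0 := by
  unfold proj
  by_cases h0 : (0 : Fin d → ℕ) ∈ B.indexSet
  · have hk : k ∈ B.indexSet := by
      rcases eq_or_ne k 0 with rfl | hk
      · exact h0
      · exact mem_indexSet_of_ne_zero hk
    rw [if_pos h0, if_pos hk]
    rfl
  · rw [if_neg h0]
    simp only [sub_apply, ContinuousLinearMap.coe_id', id_eq, ContinuousLinearMap.smulRight_apply,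
      ContinuousLinearMap.flip_apply, innerPairing_phiLp hT1]
    rcases eq_or_ne k 0 with rfl | hk
    · simp [h0]
    · simp [hk, mem_indexSet_of_ne_zero hk]

/-- Finite combinations are tested against the dense span of the `δ_j φ_k` in `L^q`; after both sums
are written over one finite index set, the bilinear estimate applies. -/
lemma norm_riesz_le (hA1 : S.A1) {K : ℝ} (hK : 0 ≤ K) (hA2 : S.A2 K) (hT1 : B.T1)
    (hT2 : B.T2) (hT3 : B.T3) (hp : p ≠ ∞) (hq : q ≠ ∞)
    (hpq : p.toReal.HolderConjugate q.toReal) (c : (Fin d → ℕ) →₀ ℝ) :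
    ‖Finsupp.linearCombination ℝ (rieszLp hT3 hp) c‖ ≤
      24 * (1 + √K) * (max p.toReal q.toReal - 1) *
        ‖proj hT3 hp hq (Finsupp.linearCombination ℝ (phiLp hT3 hp) c)‖ := by
  classical
  have hmax : 0 ≤ max p.toReal q.toReal - 1 := by
    have := hpq.lt.le.trans (le_max_left p.toReal q.toReal)
    linarith
  refine norm_le_of_dense hp hq (dense_span_deltaLp hT3 hq) _ (by positivity) fun g hg => ?_
  obtain ⟨e, rfl⟩ := Finsupp.mem_span_range_iff_exists_finsupp.1 hg
  set s := c.support ∪ e.support.image Prod.snd with hs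
  have e1 : ∀ {M : Type _} [AddCommMonoid M] [Module ℝ M] (v : (Fin d → ℕ) → M),
      Finsupp.linearCombination ℝ v c = ∑ k ∈ s, c k • v k := by
    intro M _ _ v
    rw [Finsupp.linearCombination_apply]
    exact Finsupp.sum_of_support_subset _ Finset.subset_union_left _ fun _ _ => zero_smul _ _
  have e2 : (e.sum fun z a => a • deltaLp hT3 hq z) =
      ∑ j, ∑ k ∈ s, e (j, k) • deltaLp hT3 hq (j, k) := by
    rw [← Finset.sum_product' (f := fun j k => e (j, k) • deltaLp hT3 hq (j, k))]
    refine Finsupp.sum_of_support_subset _ (fun z hz => ?_) _ fun _ _ => zero_smul _ _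
    exact Finset.mem_product.2 ⟨Finset.mem_univ _,
      Finset.mem_union_right _ (Finset.mem_image_of_mem _ hz)⟩
  have e3 : proj hT3 hp hq (Finsupp.linearCombination ℝ (phiLp hT3 hp) c) =
      ∑ k ∈ s with k ∈ B.indexSet, c k • phiLp hT3 hp k := by
    rw [e1, map_sum, Finset.sum_filter]
    refine Finset.sum_congr rfl fun k _ => ?_
    rw [map_smul, proj_phiLp hT1]
    split_ifs <;> simp
  rw [e2, e3, e1, mul_assoc]
  refine abs_le'.2 ⟨innerPairing_sum_le hA1 hK hA2 hT1 hT2 hT3 hp hq hpq s c fun j k => e (j, k), ?_⟩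
  have h := innerPairing_sum_le hA1 hK hA2 hT1 hT2 hT3 hp hq hpq s (fun k => -c k)
    fun j k => e (j, k)
  simpa only [neg_smul, Finset.sum_neg_distrib, map_neg, neg_apply, norm_neg] using h

lemma denseRange_linearCombination_phiLp (hT3 : B.T3) (hp : p ≠ ∞) :
    DenseRange (Finsupp.linearCombination ℝ (phiLp hT3 hp)) := by
  have h := dense_span_phiLp hT3 hp
  rw [← Finsupp.range_linearCombination] at h
  exact h

/-- `𝐑` on `L^p`. -/
def riesz (hT3 : B.T3) (hp : p ≠ ∞) : Lp ℝ p S.mu →L[ℝ] Lp (EuclideanSpace ℝ (Fin d)) p S.mu :=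
  (Finsupp.linearCombination ℝ (rieszLp hT3 hp)).extendOfNorm
    (Finsupp.linearCombination ℝ (phiLp hT3 hp))

section extension

variable (hA1 : S.A1) {K : ℝ} (hK : 0 ≤ K) (hA2 : S.A2 K) (hT1 : B.T1)
    (hT2 : B.T2) (hT3 : B.T3) (hp : p ≠ ∞) (hq : q ≠ ∞) (hpq : p.toReal.HolderConjugate q.toReal)

include hA1 hK hA2 hT1 hT2 hq hpq

lemma riesz_linearCombination (c : (Fin d → ℕ) →₀ ℝ) :
    riesz hT3 hp (Finsupp.linearCombination ℝ (phiLp hT3 hp) c) =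
      Finsupp.linearCombination ℝ (rieszLp hT3 hp) c := by
  have hmax : 0 ≤ max p.toReal q.toReal - 1 := by
    have := hpq.lt.le.trans (le_max_left p.toReal q.toReal)
    linarith
  refine LinearMap.extendOfNorm_eq (denseRange_linearCombination_phiLp hT3 hp)
    ⟨24 * (1 + √K) * (max p.toReal q.toReal - 1) * ‖proj hT3 hp hq‖, fun c => ?_⟩ c
  refine (norm_riesz_le hA1 hK hA2 hT1 hT2 hT3 hp hq hpq c).trans ?_
  rw [mul_assoc _ ‖proj hT3 hp hq‖]
  exact mul_le_mul_of_nonneg_left (ContinuousLinearMap.le_opNorm _ _) (by positivity)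

lemma riesz_phiLp (k : Fin d → ℕ) : riesz hT3 hp (phiLp hT3 hp k) = rieszLp hT3 hp k := by
  simpa using riesz_linearCombination hA1 hK hA2 hT1 hT2 hT3 hp hq hpq (Finsupp.single k 1)

lemma norm_riesz_apply_le (f : Lp ℝ p S.mu) :
    ‖riesz hT3 hp f‖ ≤ 24 * (1 + √K) * (max p.toReal q.toReal - 1) * ‖proj hT3 hp hq f‖ := by
  refine (denseRange_linearCombination_phiLp hT3 hp).induction_on f ?_ fun c => ?_
  · exact isClosed_le (riesz hT3 hp).continuous.norm
      ((proj hT3 hp hq).continuous.norm.const_mul _)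
  · rw [riesz_linearCombination hA1 hK hA2 hT1 hT2 hT3 hp hq hpq]
    exact norm_riesz_le hA1 hK hA2 hT1 hT2 hT3 hp hq hpq c

/-- Both functions are paired with the dense family `δ_j φ_l` of `L^q`. For the `L^p` operator the
pairing is continuous in `f` and known on the `φ_k`. For the `L²` series orthogonality leaves at
most one term, with the same coefficient. -/
lemma extendsL2Operator_riesz : ExtendsL2Operator B.IsRiesz (riesz hT3 hp) := by
  classical
  intro f g _ hfg
  refine eq_of_innerPairing_eq hp hq (dense_span_deltaLp hT3 hq) fun z => ?_
  obtain ⟨j, l⟩ := z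
  have h1 : innerPairing (riesz hT3 hp f) (deltaLp hT3 hq (j, l)) =
      ((B.freq l)⁻¹ * B.gram j l) * innerPairing f (phiLp hT3 hq l) := by
    have : (innerPairing.flip (deltaLp hT3 hq (j, l))).comp (riesz hT3 hp) =
        ((B.freq l)⁻¹ * B.gram j l) • innerPairing.flip (phiLp hT3 hq l) := by
      refine ContinuousLinearMap.ext_on (dense_span_phiLp hT3 hp) ?_
      rintro _ ⟨k, rfl⟩
      simp only [ContinuousLinearMap.comp_apply, ContinuousLinearMap.flip_apply,
        riesz_phiLp hA1 hK hA2 hT1 hT2 hT3 hp hq hpq, innerPairing_rieszLp hT1, smul_apply,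
        innerPairing_phiLp hT1, smul_eq_mul, mul_ite, mul_one, mul_zero]
    exact congrArg (fun T => T f) this
  have he : ∀ k : B.indexSet, MemLp (B.rieszMode k) 2 S.mu := fun k =>
    haveI : Fact (1 ≤ (2 : ℝ≥0∞)) := ⟨one_le_two⟩
    hT3.memLp_rieszMode k ENNReal.ofNat_ne_top
  have hψ : MemLp (singleFun j (B.mode (some j) l)) 2 S.mu :=
    memLp_singleFun j (hT3.memLp_mode (some j) l one_le_two ENNReal.ofNat_ne_top)
  have hexp : HasL2Expansion S.mu (fun k : B.indexSet => B.phi k)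
      (fun k : B.indexSet => B.rieszMode k) f g := by
    have e : (fun k : B.indexSet => B.rieszMode k) = fun (k : B.indexSet) x =>
        WithLp.toLp 2 (fun i => (Real.sqrt (B.ev k))⁻¹ * S.delta i (B.phi k) x) := by
      ext k x i
      simp only [rieszMode, mode_some, freq]
    rw [e]
    exact hfg
  rw [h1, innerPairing_deltaLp_right]
  by_cases hl : l ∈ B.indexSet
  · rw [hexp.integral_inner he hψ {⟨l, hl⟩} fun k hk => ?_, Finset.sum_singleton,
      integral_inner_rieszMode hT1, if_pos rfl, ← innerPairing_phiLp_right hT3 hq, mul_comm]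
    rw [integral_inner_rieszMode hT1, if_neg]
    rintro rfl
    exact hk (Finset.mem_singleton.2 rfl)
  · rw [hexp.integral_inner he hψ ∅ fun k _ => ?_, Finset.sum_empty, (freq_of_notMem hl).1]
    · simp
    · rw [integral_inner_rieszMode hT1, if_neg]
      rintro rfl
      exact hl k.2

end extension

lemma extendsL2Operator_proj (hT1 : B.T1) (hT3 : B.T3) (hp : p ≠ ∞) (hq : q ≠ ∞) :
    ExtendsL2Operator B.IsProj (proj hT3 hp hq) := by
  classical
  intro f g _ hfg
  refine eq_of_innerPairing_eq hp hq (dense_span_phiLp hT3 hq) fun l => ?_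
  have h1 : innerPairing (proj hT3 hp hq f) (phiLp hT3 hq l) =
      (if l ∈ B.indexSet then 1 else 0) * innerPairing f (phiLp hT3 hq l) := by
    have : (innerPairing.flip (phiLp hT3 hq l)).comp (proj hT3 hp hq) =
        (if l ∈ B.indexSet then (1 : ℝ) else 0) • innerPairing.flip (phiLp hT3 hq l) := by
      refine ContinuousLinearMap.ext_on (dense_span_phiLp hT3 hp) ?_
      rintro _ ⟨k, rfl⟩
      simp only [ContinuousLinearMap.comp_apply, ContinuousLinearMap.flip_apply,
        proj_phiLp hT1, smul_apply, innerPairing_phiLp hT1, smul_eq_mul]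
      rcases eq_or_ne k l with rfl | hkl
      · by_cases hk : k ∈ B.indexSet <;> simp [hk, innerPairing_phiLp hT1]
      · split_ifs <;> simp [innerPairing_phiLp hT1, hkl]
    exact congrArg (fun T => T f) this
  have he : ∀ k : B.indexSet, MemLp (B.phi k) 2 S.mu := fun k => by
    rw [← mode_none]; exact hT3.memLp_mode none k one_le_two ENNReal.ofNat_ne_top
  have hψ : MemLp (B.mode none l) 2 S.mu :=
    hT3.memLp_mode none l one_le_two ENNReal.ofNat_ne_top
  have hin : ∀ k, ∫ x, inner ℝ (B.phi k x) (B.mode none l x) ∂S.mu = if k = l then 1 else 0 := by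
    intro k
    rw [← integral_phi_mul_phi hT1, ← mode_none]
    simp only [RCLike.inner_apply, conj_trivial, mul_comm]
  have h2 : innerPairing g (phiLp hT3 hq l) = ∫ x, inner ℝ (g x) (B.mode none l x) ∂S.mu := by
    rw [innerPairing_phiLp_right, mode_none]
    simp only [RCLike.inner_apply, conj_trivial, mul_comm]
  rw [h1, h2]
  by_cases hl : l ∈ B.indexSet
  · rw [hfg.integral_inner he hψ {⟨l, hl⟩} fun k hk => ?_, Finset.sum_singleton,
      hin, if_pos rfl, if_pos hl, ← innerPairing_phiLp_right hT3 hq, mul_comm]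
    rw [hin, if_neg]
    rintro rfl
    exact hk (Finset.mem_singleton.2 rfl)
  · rw [hfg.integral_inner he hψ ∅ fun k _ => ?_, Finset.sum_empty, if_neg hl, zero_mul]
    rw [hin, if_neg]
    rintro rfl
    exact hl k.2

omit [ENNReal.HolderConjugate p q] [Fact (1 ≤ q)] in
lemma memLp_phiLp_two (hT3 : B.T3) (hp : p ≠ ∞) (k : Fin d → ℕ) :
    MemLp (phiLp hT3 hp k) 2 S.mu :=
  (memLp_congr_ae (hT3.memLp_mode none k Fact.out hp).coeFn_toLp).2
    (hT3.memLp_mode none k one_le_two ENNReal.ofNat_ne_top)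

omit [ENNReal.HolderConjugate p q] [Fact (1 ≤ q)] in
lemma integral_phiLp_mul_phi (hT1 : B.T1) (hT3 : B.T3) (hp : p ≠ ∞) (k l : Fin d → ℕ) :
    ∫ x, phiLp hT3 hp k x * B.phi l x ∂S.mu = if k = l then 1 else 0 := by
  rw [← integral_phi_mul_phi hT1, mode_none]
  refine integral_congr_ae ?_
  filter_upwards [(hT3.memLp_mode none k (Fact.out : 1 ≤ p) hp).coeFn_toLp] with x hx
  rw [phiLp, hx, mode_none]

omit [ENNReal.HolderConjugate p q] [Fact (1 ≤ q)] in
/-- Operators that extend an `L²`-operator defined at all `φₖ` agree. -/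
lemma eq_of_extendsL2Operator {E : Type*} [NormedAddCommGroup E] [NormedSpace ℝ E] (hT1 : B.T1)
    (hT3 : B.T3) (hp : p ≠ ∞) {e : (Fin d → ℕ) → (Fin d → ℝ) → E}
    (he2 : ∀ k, MemLp (e k) 2 S.mu) (hep : ∀ k, MemLp (e k) p S.mu)
    {T T' : Lp ℝ p S.mu →L[ℝ] Lp E p S.mu}
    (hT : ExtendsL2Operator (HasL2Expansion S.mu (fun k : B.indexSet => B.phi k)
      fun k : B.indexSet => e k) T)
    (hT' : ExtendsL2Operator (HasL2Expansion S.mu (fun k : B.indexSet => B.phi k)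
      fun k : B.indexSet => e k) T') : T = T' := by
  classical
  refine ContinuousLinearMap.ext_on (dense_span_phiLp hT3 hp) ?_
  rintro _ ⟨k, rfl⟩
  -- The expansion of `φ_k` has at most one term, so the `L²`-operator takes a value in `L^p` there;
  -- by density these values determine the bounded operator.
  suffices h : ∃ g : Lp E p S.mu, HasL2Expansion S.mu (fun k : B.indexSet => B.phi k)
      (fun k : B.indexSet => e k) (phiLp hT3 hp k) g by
    obtain ⟨g, hg⟩ := h
    rw [hT _ g (memLp_phiLp_two hT3 hp k) hg, hT' _ g (memLp_phiLp_two hT3 hp k) hg]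
  by_cases hk : k ∈ B.indexSet
  · refine ⟨(hep k).toLp (e k), hasL2Expansion_of_finset {⟨k, hk⟩}
      ((memLp_congr_ae (hep k).coeFn_toLp).2 (he2 k)) (fun l hl => ?_) ?_⟩
    · rw [integral_phiLp_mul_phi hT1, if_neg]
      rintro rfl
      exact hl (Finset.mem_singleton.2 rfl)
    · filter_upwards [(hep k).coeFn_toLp] with x hx
      rw [hx, Finset.sum_singleton, integral_phiLp_mul_phi hT1, if_pos rfl, one_smul]
  · refine ⟨0, hasL2Expansion_of_finset ∅ ?_ (fun l _ => ?_) ?_⟩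
    · exact (memLp_congr_ae (Lp.coeFn_zero _ _ _)).2 MemLp.zero
    · rw [integral_phiLp_mul_phi hT1, if_neg]
      rintro rfl
      exact hk l.2
    · filter_upwards [Lp.coeFn_zero E p S.mu] with x hx
      rw [hx, Finset.sum_empty]
      rfl

end EigenSystem

end

theorem theorem3p1 {d : ℕ} (S : ProductSetting d) (B : EigenSystem S) (K : ℝ) (hK : 0 ≤ K)
    (hA1 : S.A1) (hA2 : S.A2 K) (hT1 : B.T1) (hT2 : B.T2) (hT3 : B.T3)
    (p : ℝ≥0∞) [Fact (1 ≤ p)] (hp1 : 1 < p) (hp : p ≠ ∞) :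
    ∃ (P : Lp ℝ p S.mu →L[ℝ] Lp ℝ p S.mu)
      (R : Lp ℝ p S.mu →L[ℝ] Lp (EuclideanSpace ℝ (Fin d)) p S.mu),
      (∀ P' : Lp ℝ p S.mu →L[ℝ] Lp ℝ p S.mu, ExtendsL2Operator B.IsProj P' ↔ P' = P) ∧
      (∀ R' : Lp ℝ p S.mu →L[ℝ] Lp (EuclideanSpace ℝ (Fin d)) p S.mu,
        ExtendsL2Operator B.IsRiesz R' ↔ R' = R) ∧
      ∀ f : Lp ℝ p S.mu, ‖R f‖ ≤ 24 * (1 + Real.sqrt K) * (pStar p - 1) * ‖P f‖ := by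
  set q := ENNReal.conjExponent p with hqdef
  have hpq : ENNReal.HolderConjugate p q := inferInstance
  have : Fact (1 ≤ q) := ⟨ENNReal.HolderConjugate.one_le q p⟩
  have hq : q ≠ ∞ := (ENNReal.HolderConjugate.lt_top_iff_one_lt q p).2 hp1 |>.ne
  have hpr : 1 < p.toReal := by
    rw [← ENNReal.toReal_one, ENNReal.toReal_lt_toReal ENNReal.one_ne_top hp]
    exact hp1
  have hpqr : p.toReal.HolderConjugate q.toReal :=
    (ENNReal.HolderConjugate.toReal_iff hpr).2 hpq
  have hR := EigenSystem.extendsL2Operator_riesz hA1 hK hA2 hT1 hT2 hT3 hp hq hpqr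
  have hP := EigenSystem.extendsL2Operator_proj hT1 hT3 hp hq
  have hvec : ∀ k {r : ℝ≥0∞}, 1 ≤ r → r ≠ ∞ → MemLp (fun x => WithLp.toLp 2 (fun i =>
      (Real.sqrt (B.ev k))⁻¹ * S.delta i (B.phi k) x) :
        (Fin d → ℝ) → EuclideanSpace ℝ (Fin d)) r S.mu := by
    intro k r h1 h2
    have : Fact (1 ≤ r) := ⟨h1⟩
    refine memLp_piLp_iff.2 fun i => MemLp.const_mul ?_ _
    rw [← EigenSystem.mode_some]
    exact hT3.memLp_mode (some i) k h1 h2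
  refine ⟨EigenSystem.proj hT3 hp hq, EigenSystem.riesz hT3 hp, fun P' => ⟨fun h => ?_, ?_⟩,
    fun R' => ⟨fun h => ?_, ?_⟩, fun f => ?_⟩
  · refine EigenSystem.eq_of_extendsL2Operator (e := B.phi) hT1 hT3 hp (fun k => ?_) (fun k => ?_)
      h hP
    · rw [← EigenSystem.mode_none]
      exact hT3.memLp_mode none k one_le_two ENNReal.ofNat_ne_top
    · rw [← EigenSystem.mode_none]
      exact hT3.memLp_mode none k hp1.le hp
  · rintro rfl
    exact hP
  · exact EigenSystem.eq_of_extendsL2Operator (e := fun k x => WithLp.toLp 2 (fun i =>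
      (Real.sqrt (B.ev k))⁻¹ * S.delta i (B.phi k) x)) hT1 hT3 hp
      (fun k => hvec k one_le_two ENNReal.ofNat_ne_top) (fun k => hvec k hp1.le hp) h hR
  · rintro rfl
    exact hR
  · have h := EigenSystem.norm_riesz_apply_le hA1 hK hA2 hT1 hT2 hT3 hp hq hpqr f
    rw [hpqr.conjugate_eq] at h
    exact h
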